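/- Let $G=(V,E)$ be a finite connected graph with at least one edge (loops and multiple edges allowed), each edge parametrised by $[0,1]$, and let $k\ge 1$ be an integer. Let $\mathcal M$ be one of the following two spaces of metrics on $G$, where a metric $g$ gives the edge $e$ the line element $dx_g=\sqrt{g_e}\,dx$: (A) $\mathcal M=\mathbb R_+^{E}$, the metrics that are constant on every edge; or (B) the metrics $g=(g_e)_{e\in E}$ with $g_e\in C^\infty([0,1])$, $g_e>0$. Let $\mathcal C_+$ be the set of densities $\rho=(\rho_e)_{e\in E}$ with $\rho_e\in C^\infty([0,1])$, $\rho_e>0$, and $\mathcal A_+=\mathcal M\times\mathcal C_+$. For $(g,\rho)\in\mathcal A_+$ put $|\nabla_g f|^2=(f')^2/g$ and $\Delta_g=-\frac1{\sqrt g}\frac{d}{dx}\frac1{\sqrt g}\frac{d}{dx}$, let $E(\mu)$ be the space of solutions of $\Delta_g f=\mu\rho f$ that are $C^2$ on every closed edge, continuous on $G$ and have, at every vertex, outward arc length derivatives with sum zero, and let $$\lambda_k(g,\rho)=\min_{S\subset W^{1,2}(G),\ \dim S=k+1}\ \max_{f\in S\setminus\{0\}}\frac{\int_G|\nabla_g f|^2dx_g}{\int_G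 f^2\rho\,dx_g}$$ be the eigenvalues $0=\lambda_0<\lambda_1\le\lambda_2\le\cdots$, counted with multiplicity. A smooth family through $(g,\rho)$ is a family $(g(t),\rho(t))\in\mathcal A_+$, $|t|<\varepsilon$, that is $C^\infty$ jointly in $t$ and in the position on each closed edge, with $(g(0),\rho(0))=(g,\rho)$. A pair $(g,\rho)$ is extremal for $F:\mathcal A_+\to\mathbb R$ if along every smooth family through it $F(g(t),\rho(t))\le F(g,\rho)+o(t)$ or $F(g(t),\rho(t))\ge F(g,\rho)+o(t)$ as $t\to0$. A gradient of $N:\mathcal A_+\to\mathbb R$ at $(g,\rho)$ is a pair $\nabla N(g,\rho)=(N_1,N_2)\in L^2(G)\times L^2(G)$, with $N_1$ constant on every edge in case (A), such that for every smooth family through $(g,\rho)$ $$\frac{d}{dt}N(g(t),\rho(t))\Big|_{t=0}=\int_G\big(N_1\dot g(0)+N_2\dot\rho(0)\big)dx_g .$$ Let $N:\mathcal A_+\to(0,\infty)$ be such that $F=\lambda_kN$ satisfies $F(ag,b\rho)=F(g,\rho)$ for all $a,b>0$ and all $(g,\rho)\in\mathcal A_+$. Let $(g,\rho)\in\mathcal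 A_+$, let $\nabla N(g,\rho)=(N_1,N_2)$ be a gradient of $N$ at $(g,\rho)$, and write $\lambda_k=\lambda_k(g,\rho)$. 1. If $(g,\rho)$ is extremal for $F$, then there are finitely many $f_1,\dots,f_n\in E(\lambda_k)$ with $$\sum_{i=1}^n|\nabla_g f_i|^2=2gN_1-\rho N_2,\qquad \sum_{i=1}^n f_i^2=\frac{N_2}{\lambda_k}.\qquad(*)$$ The second equation holds almost everywhere. The first holds almost everywhere in case (B); in case (A) it holds almost everywhere on each edge on which $\rho$ is constant, and on every edge it holds after integration over that edge against $dx_g$. 2. Conversely, if there are $f_1,\dots,f_n\in E(\lambda_k)$ satisfying $(*)$ (where in case (A) the first equation is required only after integration over every edge), and if $\lambda_k>\lambda_{k-1}(g,\rho)$ or $\lambda_k<\lambda_{k+1}(g,\rho)$, then $(g,\rho)$ is extremal for $F$. -/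

import Mathlib

open Set Filter Topology MeasureTheory Asymptotics
open scoped unitInterval ContDiff

/-- A graph with vertex set `V` and edge set `E`; loops and multiple edges are allowed. Every edge
is parametrised by `[0,1]`, running from `src e` to `tgt e`. -/
structure EdgeGraph (V E : Type*) where
  src : E → V
  tgt : E → V

/-- Functions on the disjoint union of the edges, all parametrised by `I = [0,1]`. -/
abbrev EdgeFun (E : Type*) := E → I → ℝ

/-- The two spaces of metrics `g` on the graph (the line element of the edge `e` is
`√(g e x) dx`): `edgewiseConstant` is the space `ℝ_+^E` of metrics with `g` constant on every edge,
`edgewiseSmooth` the space of all metrics with `g` a positive smooth function on every edge. -/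
inductive MetricClass where
  | edgewiseConstant
  | edgewiseSmooth

namespace EdgeGraph

section Edges

variable {E : Type*}

/-- Smooth on every closed edge. -/
def SmoothOnEdges (h : EdgeFun E) : Prop :=
  ∀ e, ∃ H : ℝ → ℝ, ContDiff ℝ ∞ H ∧ ∀ x : I, h e x = H x

/-- Derivative of a function on `[0,1]` (one-sided at the ends). -/
noncomputable def edgeDeriv (u : I → ℝ) (x : I) : ℝ :=
  derivWithin (Set.IccExtend zero_le_one u) (Set.Icc 0 1) (x : ℝ)

/-- The gradient `∇_g f` has squared length `|f'|² / g`. -/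
noncomputable def gradSq (g f : EdgeFun E) (e : E) (x : I) : ℝ :=
  edgeDeriv (f e) x ^ 2 / g e x

/-- The Laplacian `-d²/ds²`, with `s` the arc length of `g`: `ds = √g dx`. It is `-f'' / g` where
`g` is constant. -/
noncomputable def laplacian (g f : EdgeFun E) (e : E) (x : I) : ℝ :=
  -(edgeDeriv (fun y => edgeDeriv (f e) y / √(g e y)) x / √(g e x))

/-- Functions of the kind of `g` allowed by the class `c`, without positivity. -/
def MetricDirection (c : MetricClass) (φ : EdgeFun E) : Prop :=
  match c with
  | MetricClass.edgewiseConstant => ∀ e x y, φ e x = φ e y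
  | MetricClass.edgewiseSmooth => SmoothOnEdges φ

/-- The space `𝒜_+` of pairs (metric, density): `g` is a positive metric of class `c`, and `ρ` is
positive and smooth on every edge. -/
structure IsPair (c : MetricClass) (g ρ : EdgeFun E) : Prop where
  metric : MetricDirection c g
  metric_pos : ∀ e x, 0 < g e x
  density : SmoothOnEdges ρ
  density_pos : ∀ e x, 0 < ρ e x

/-- Joint smoothness in `t ∈ (-ε, ε)` and in the position on each closed edge. -/
def SmoothInTime (ε : ℝ) (h : ℝ → EdgeFun E) : Prop :=
  ∀ e, ∃ H : ℝ × ℝ → ℝ, ContDiffOn ℝ ∞ H (Set.Ioo (-ε) ε ×ˢ Set.univ) ∧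
    ∀ t ∈ Set.Ioo (-ε) ε, ∀ x : I, h t e x = H (t, x)

/-- `(γ t, τ t)`, `|t| < ε`, is a smooth one-parameter family in `𝒜_+` with value `(g, ρ)` at
`t = 0`. Values at other `t` are irrelevant. -/
structure IsFamily (c : MetricClass) (g ρ : EdgeFun E) (ε : ℝ) (γ τ : ℝ → EdgeFun E) : Prop where
  pos : 0 < ε
  start_metric : γ 0 = g
  start_density : τ 0 = ρ
  isPair : ∀ t ∈ Set.Ioo (-ε) ε, IsPair c (γ t) (τ t)
  smooth_metric : SmoothInTime ε γ
  smooth_density : SmoothInTime ε τ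

/-- `(g, ρ)` is extremal for `F`: along every smooth family through it, `F ≤ F(g, ρ) + o(t)` or
`F ≥ F(g, ρ) + o(t)` as `t → 0`. -/
def IsExtremal (c : MetricClass) (F : EdgeFun E → EdgeFun E → ℝ) (g ρ : EdgeFun E) : Prop :=
  ∀ (ε : ℝ) (γ τ : ℝ → EdgeFun E), IsFamily c g ρ ε γ τ →
    (∃ r : ℝ → ℝ, r =o[𝓝 0] (fun t : ℝ => t) ∧ ∀ᶠ t in 𝓝 0, F (γ t) (τ t) ≤ F g ρ + r t) ∨
    (∃ r : ℝ → ℝ, r =o[𝓝 0] (fun t : ℝ => t) ∧ ∀ᶠ t in 𝓝 0, F g ρ + r t ≤ F (γ t) (τ t))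

variable [Fintype E]

/-- The inner product of `L²(G,g) × L²(G,g)`. -/
noncomputable def innerH (g A₁ A₂ B₁ B₂ : EdgeFun E) : ℝ :=
  ∑ e, ∫ x : I, (A₁ e x * B₁ e x + A₂ e x * B₂ e x) * √(g e x)

/-- `(N₁, N₂)` is the gradient of `N` at `(g, ρ)`. It lies in the tangent plane, i.e. in the
closure in `L² × L²` of the set of velocities of smooth families: so `N₁`, `N₂` are square
integrable, and `N₁` is (a.e.) constant on edges if all metrics of the class are. It represents the
derivative of `N` along every smooth family through `(g, ρ)`. -/
structure IsGradient (c : MetricClass) (N : EdgeFun E → EdgeFun E → ℝ) (g ρ N₁ N₂ : EdgeFun E) :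
    Prop where
  memLp_fst : ∀ e, MemLp (N₁ e) 2 (volume : Measure I)
  memLp_snd : ∀ e, MemLp (N₂ e) 2 (volume : Measure I)
  tangent : c = MetricClass.edgewiseConstant →
    ∀ e, ∃ a : ℝ, ∀ᵐ x : I, N₁ e x = a
  hasDerivAt : ∀ (ε : ℝ) (γ τ : ℝ → EdgeFun E), IsFamily c g ρ ε γ τ →
    HasDerivAt (fun t => N (γ t) (τ t))
      (innerH g N₁ N₂ (fun e x => deriv (fun t => γ t e x) 0)
        (fun e x => deriv (fun t => τ t e x) 0)) 0

/-- Equality of `A` and `B` against all infinitesimal variations of a metric of class `c`. If the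
metrics are arbitrary smooth functions on edges this is equality a.e.; if they are constant on edges
it is equality of the integrals over every edge. -/
def EqOnDirections (c : MetricClass) (g A B : EdgeFun E) : Prop :=
  match c with
  | MetricClass.edgewiseConstant =>
      ∀ e, ∫ x : I, A e x * √(g e x) = ∫ x : I, B e x * √(g e x)
  | MetricClass.edgewiseSmooth => ∀ e, ∀ᵐ x : I, A e x = B e x

end Edges

variable {V E : Type*} (G : EdgeGraph V E)

/-- Any two vertices are joined by a path of edges (ignoring directions), and there is a vertex. -/
def IsConnected : Prop :=
  Nonempty V ∧ ∀ v w : V, Relation.EqvGen (fun a b => ∃ e, G.src e = a ∧ G.tgt e = b) v w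

/-- The values at the ends of the edges fit together at the vertices. -/
def MatchesAtVertices (u : EdgeFun E) : Prop :=
  ∃ h : V → ℝ, ∀ e, u e 0 = h (G.src e) ∧ u e 1 = h (G.tgt e)

/-- The space of pairs `(u, u')` with `u` in the Sobolev space `W^{1,2}(G)`: `u` is continuous on
the graph, and on every edge it is a primitive of its square integrable weak derivative `u'`. -/
noncomputable def sobolev :
    Submodule ℝ (EdgeFun E × (E → Lp ℝ 2 (volume : Measure I))) where
  carrier := {p | G.MatchesAtVertices p.1 ∧
    ∀ e (x : I), p.1 e x = p.1 e 0 + ∫ s in Set.Iic x, p.2 e s}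
  zero_mem' := by
    refine ⟨⟨0, fun e => by simp⟩, fun e x => ?_⟩
    simp
  add_mem' := by
    rintro p q ⟨⟨h, hh⟩, hp⟩ ⟨⟨k, hk⟩, hq⟩
    refine ⟨⟨h + k, fun e => ?_⟩, fun e x => ?_⟩
    · simp [hh e, hk e]
    · have hi : ∀ w : Lp ℝ 2 (volume : Measure I), IntegrableOn w (Set.Iic x) := fun w =>
        ((Lp.memLp w).integrable (by norm_num)).integrableOn
      have ha : (fun s => ((p.2 e + q.2 e : Lp ℝ 2 (volume : Measure I)) : I → ℝ) s)
          =ᵐ[volume.restrict (Set.Iic x)] fun s => p.2 e s + q.2 e s :=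
        ae_restrict_of_ae (Lp.coeFn_add (p.2 e) (q.2 e))
      simp only [Prod.fst_add, Prod.snd_add, Pi.add_apply]
      rw [integral_congr_ae ha, integral_add (hi _) (hi _), hp e x, hq e x]
      ring
  smul_mem' := by
    rintro a p ⟨⟨h, hh⟩, hp⟩
    refine ⟨⟨a • h, fun e => ?_⟩, fun e x => ?_⟩
    · simp [hh e]
    · have ha : (fun s => ((a • p.2 e : Lp ℝ 2 (volume : Measure I)) : I → ℝ) s)
          =ᵐ[volume.restrict (Set.Iic x)] fun s => a * p.2 e s :=
        ae_restrict_of_ae (Lp.coeFn_smul a (p.2 e))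
      simp only [Prod.smul_fst, Prod.smul_snd, Pi.smul_apply, smul_eq_mul]
      rw [integral_congr_ae ha, integral_const_mul, hp e x]
      ring

variable [Fintype E]

/-- The Rayleigh quotient `∫ |∇_g u|² dx_g / ∫ u² ρ dx_g`, where `dx_g = √g dx`. -/
noncomputable def rayleigh (g ρ : EdgeFun E) (p : EdgeFun E × (E → Lp ℝ 2 (volume : Measure I))) :
    ℝ :=
  (∑ e, ∫ x : I, (p.2 e x) ^ 2 / √(g e x)) / (∑ e, ∫ x : I, (p.1 e x) ^ 2 * ρ e x * √(g e x))

/-- The eigenvalue `λ_k(g, ρ)`, `k ≥ 0`, counted with multiplicity: the infimum, over the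
`(k+1)`-dimensional subspaces `S` of `W^{1,2}(G)`, of the maximum of the Rayleigh quotient on
`S \ {0}` (written as the infimum of all upper bounds of these sets of quotients). -/
noncomputable def eigenvalue (g ρ : EdgeFun E) (k : ℕ) : ℝ :=
  sInf {b : ℝ | ∃ S : Submodule ℝ (EdgeFun E × (E → Lp ℝ 2 (volume : Measure I))),
    S ≤ G.sobolev ∧ Module.finrank ℝ S = k + 1 ∧ ∀ p ∈ S, p ≠ 0 → rayleigh g ρ p ≤ b}

/-- `f` belongs to the eigenspace `E(μ)` of the problem `Δ_g f = μ ρ f`, with `f` continuous on the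
graph and with the outward arc length derivatives at every vertex adding up to zero (a loop
contributes both its ends). -/
structure InEigenspace (g ρ : EdgeFun E) (μ : ℝ) (f : EdgeFun E) : Prop where
  contDiff : ∀ e, ∃ H : ℝ → ℝ, ContDiff ℝ 2 H ∧ ∀ x : I, f e x = H x
  matchesAtVertices : G.MatchesAtVertices f
  equation : ∀ e x, laplacian g f e x = μ * ρ e x * f e x
  kirchhoff : ∀ v : V,
    (∑ e, Set.indicator {e | G.src e = v} (fun e => edgeDeriv (f e) 0 / √(g e 0)) e)
      - (∑ e, Set.indicator {e | G.tgt e = v} (fun e => edgeDeriv (f e) 1 / √(g e 1)) e) = 0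

end EdgeGraph

open EdgeGraph

/-! With the weights `1/√g` and `ρ √g`, the eigenvalues are the min-max values of the pencil `D - b
M` on the Sobolev space, where `D` is the Dirichlet form and `M` the weighted mass form. Put `l =
λ_k` and `Q = D - l M`. The space splits into a finite dimensional part `Wm` where `Q` is negative,
the radical of `Q`, and a part `Wp` where `Q` is coercive (`exists_isSplitting`). The min-max
principle gives `dim Wm ≤ k < dim (Wm ⊔ ker Q)`. A gap below `λ_k` yields `k ≤ dim Wm`, a gap above
yields `dim (Wm ⊔ ker Q) ≤ k + 1`. The radical is the eigenspace `E(λ_k)`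
(`InEigenspace.exists_mem_ker`, `inEigenspace_of_mem_ker`).

Differentiable eigenvalue branches are not needed. Along a family, `D t - (l + c t) M t` equals `Q +
t (D' - l M' - c M) + o(t)`, with an error controlled by the Sobolev norm. Its sign on a subspace of
the radical therefore persists, for small `t > 0`, on the sum with `Wp` (or, with signs reversed,
with `Wm`); this is `eventually_nonneg`. Counting dimensions turns this into one-sided bounds of
`λ_k(t)` by `l + c t`. With the factor `N` included, the decisive form on the radical is `T = N (D'
- l M') + l ⟨∇N, (φ, ψ)⟩ M`, where `(φ, ψ)` is the velocity of the family (`directionForm`).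

Necessity: if `T` were positive definite on the radical for some direction, `F` would grow at a
positive rate to the right of `0` and lie below its value at a positive rate to the left, so neither
estimate of extremality could hold. The forms `T` make up a linear space, and a separation argument
(`exists_sum_eq_zero`) yields eigenfunctions `u_i`, not all zero, with `∑ T(u_i, u_i) = 0` for all
directions at once. By `IsPair.velocityForm_apply`, `(D' - l M')(u, u)` is minus the pairing of `(φ,
ψ)` with the densities `(|∇u|² + l ρ u²) / (2g)` and `l u²`. After rescaling the `u_i`, the summed
densities pair with every direction as the gradient of `N` does; this is the pair of equations
`(*)`. If `g` and `ρ` are constant on an edge, the first density is constant there by conservation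
of energy, so equality of integrals becomes equality almost everywhere.

Sufficiency: the computation is reversible once `l ∑ M(u_i, u_i) = N` is known, and this is Euler's
relation for the scaling of `ρ`. Then `∑ T(u_i, u_i) = 0`, so some `u_i ≠ 0` has `T ≤ 0` and some
has `T ≥ 0`. At an end of a cluster of equal eigenvalues the line through one such `u_i` is a large
enough part of the radical for the dimension count: it bounds the first value of the cluster from
above and the last from below, on both sides of `t = 0`. -/

open LinearMap (BilinForm)

/-! ### Symmetric bilinear forms: comparison, perturbation and splitting by sign -/

section Forms

variable {H : Type*} [AddCommGroup H] [Module ℝ H]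

namespace FormPencil

theorem apply_add_add (B : BilinForm ℝ H) (hB : ∀ u v, B u v = B v u) (u v : H) :
    B (u + v) (u + v) = B u u + 2 * B u v + B v v := by
  simp only [map_add, LinearMap.add_apply, hB v u]
  ring

/-- A positive definite form on a finite dimensional space dominates every other form. -/
theorem exists_pos_mul_le {X : Type*} [AddCommGroup X] [Module ℝ X] [FiniteDimensional ℝ X]
    (B A : BilinForm ℝ X) (hB : ∀ x, x ≠ 0 → 0 < B x x) :
    ∃ η > 0, ∀ x, η * A x x ≤ B x x := by
  let e : X ≃ₗ[ℝ] EuclideanSpace ℝ (Fin (Module.finrank ℝ X)) :=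
    LinearEquiv.ofFinrankEq _ _ (by simp)
  have hc : ∀ C : BilinForm ℝ X, Continuous fun y => C (e.symm y) (e.symm y) := by
    intro C
    have := (C.compl₁₂ e.symm.toLinearMap e.symm.toLinearMap).toContinuousBilinearMap
    have h : Continuous fun y =>
      (C.compl₁₂ e.symm.toLinearMap e.symm.toLinearMap).toContinuousBilinearMap y y := by
      fun_prop
    simpa using h
  have hS : IsCompact (Metric.sphere (0 : EuclideanSpace ℝ (Fin (Module.finrank ℝ X))) 1) :=
    isCompact_sphere _ _
  by_cases hne : (Metric.sphere (0 : EuclideanSpace ℝ (Fin (Module.finrank ℝ X))) 1).Nonempty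
  · obtain ⟨y₀, hy₀, hmin⟩ := hS.exists_isMinOn hne (hc B).continuousOn
    obtain ⟨y₁, hy₁, hmax⟩ := hS.exists_isMaxOn hne (hc A).continuousOn
    set m := B (e.symm y₀) (e.symm y₀) with hm
    set K := A (e.symm y₁) (e.symm y₁) with hK
    have hm0 : 0 < m := by
      apply hB
      intro h
      have : y₀ = 0 := by simpa using h
      simp [this] at hy₀
    -- `m` is the minimum of `B` and `K` the maximum of `A` on the unit sphere; homogeneity does the
    -- rest.
    refine ⟨m / (|K| + 1), by positivity, fun x => ?_⟩
    by_cases hx : x = 0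
    · simp [hx]
    have hn : 0 < ‖e x‖ := by
      rw [norm_pos_iff]
      simpa using hx
    set y := ‖e x‖⁻¹ • e x with hy
    have hys : y ∈ Metric.sphere (0 : EuclideanSpace ℝ (Fin (Module.finrank ℝ X))) 1 := by
      simp [hy, norm_smul, hn.ne']
    have hxy : x = ‖e x‖ • e.symm y := by
      simp [hy, smul_smul, hn.ne']
    have h1 : m ≤ B (e.symm y) (e.symm y) := hmin hys
    have h2 : A (e.symm y) (e.symm y) ≤ K := hmax hys
    have h3 : ∀ C : BilinForm ℝ X, C x x = ‖e x‖ ^ 2 * C (e.symm y) (e.symm y) := by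
      intro C
      conv_lhs => rw [hxy]
      simp
      ring
    rw [h3 A, h3 B]
    have h4 : m / (|K| + 1) * A (e.symm y) (e.symm y) ≤ m := by
      rw [div_mul_eq_mul_div, div_le_iff₀ (by positivity)]
      apply mul_le_mul_of_nonneg_left _ hm0.le
      linarith [le_abs_self K]
    nlinarith [sq_nonneg ‖e x‖]
  · refine ⟨1, one_pos, fun x => ?_⟩
    have hx : x = 0 := by
      by_contra hx
      have hn : 0 < ‖e x‖ := by
        rw [norm_pos_iff]
        simpa using hx
      exact hne ⟨‖e x‖⁻¹ • e x, by simp [norm_smul, hn.ne']⟩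
    simp [hx]

theorem exists_pos_mul_le_on (P : Submodule ℝ H) [FiniteDimensional ℝ P] (B A : BilinForm ℝ H)
    (hB : ∀ x ∈ P, x ≠ 0 → 0 < B x x) : ∃ η > 0, ∀ x ∈ P, η * A x x ≤ B x x := by
  obtain ⟨η, hη, h⟩ := exists_pos_mul_le (B.restrict P) (A.restrict P)
    (fun x hx => hB x x.2 (by simpa using hx))
  exact ⟨η, hη, fun x hx => h ⟨x, hx⟩⟩

/-- Off-diagonal values are controlled by the values on the diagonal. -/
theorem two_mul_abs_le (D A : BilinForm ℝ H) (hD : ∀ u v, D u v = D v u)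
    (hA : ∀ u v, A u v = A v u) {C : ℝ} (h : ∀ u, |D u u| ≤ C * A u u) {s : ℝ} (hs : 0 < s)
    (u v : H) : 2 * |D u v| ≤ C * (s * A u u + A v v / s) := by
  have hss : √s ^ 2 = s := Real.sq_sqrt hs.le
  have hs0 : √s ≠ 0 := (Real.sqrt_pos.2 hs).ne'
  -- Polarisation: the two values of `D` differ by `4 D u v`, while the two values of `A` add up to
  -- `2 (s A u u + A v v / s)`.
  have h1 := h (√s • u + (√s)⁻¹ • v)
  have h2 := h (√s • u + (-(√s)⁻¹) • v)
  rw [apply_add_add D hD, apply_add_add A hA] at h1 h2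
  simp only [map_smul, LinearMap.smul_apply, smul_eq_mul] at h1 h2
  have e1 : √s * (√s * D u u) = s * D u u := by rw [← mul_assoc, ← sq, hss]
  have e2 : √s * (√s * A u u) = s * A u u := by rw [← mul_assoc, ← sq, hss]
  have e3 : ∀ x : ℝ, (√s)⁻¹ * ((√s)⁻¹ * x) = x / s := by
    intro x
    rw [← mul_assoc, ← mul_inv, ← sq, hss]
    field_simp
  have e4 : ∀ x : ℝ, -(√s)⁻¹ * (-(√s)⁻¹ * x) = x / s := by
    intro x
    rw [← e3]
    ring
  have e5' : ∀ x : ℝ, (√s)⁻¹ * (√s * x) = x := fun x => by field_simp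
  have e6' : ∀ x : ℝ, -(√s)⁻¹ * (√s * x) = -x := fun x => by field_simp
  simp only [e1, e2, e3, e4, e5', e6'] at h1 h2
  rw [abs_le] at h1 h2
  have : |2 * D u v| ≤ C * (s * A u u + A v v / s) := by
    rw [abs_le]
    constructor <;> nlinarith
  rwa [abs_mul, abs_two] at this

/-- A path of forms `B t` with derivative `B'` at `0` that is positive on a finite dimensional
subspace of the radical of `B 0` stays nonnegative for small `t > 0` on its sum with a subspace on
which `B 0` is coercive. -/
theorem eventually_nonneg (A B' : BilinForm ℝ H) (B : ℝ → BilinForm ℝ H)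
    (hA : ∀ u v, A u v = A v u) (hA0 : ∀ u, 0 ≤ A u u) (hB : ∀ t u v, B t u v = B t v u)
    (hbd : ∃ C, ∀ u, |B' u u| ≤ C * A u u)
    (hexp : ∀ η > 0, ∀ᶠ t in 𝓝[>] (0 : ℝ), ∀ u, |B t u u - B 0 u u - t * B' u u| ≤ η * t * A u u)
    (P W : Submodule ℝ H) [FiniteDimensional ℝ P] (hP : P ≤ LinearMap.ker (B 0))
    (hpos : ∀ f ∈ P, f ≠ 0 → 0 < B' f f) {δ : ℝ} (hδ : 0 < δ)
    (hW : ∀ w ∈ W, δ * A w w ≤ B 0 w w) :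
    ∀ᶠ t in 𝓝[>] (0 : ℝ), ∀ u ∈ P ⊔ W, 0 ≤ B t u u := by
  obtain ⟨η, hη, hηP⟩ := exists_pos_mul_le_on P B' A hpos
  obtain ⟨C₀, hC₀⟩ := hbd
  -- The additional `1` pays for the remainder of the expansion taken with `η = 1`.
  set C := max C₀ 0 + 1 with hC
  have hCpos : 0 < C := by positivity
  have hCb : ∀ u, |B' u u| ≤ (C - 1) * A u u := fun u =>
    (hC₀ u).trans (mul_le_mul_of_nonneg_right (by simp [hC]) (hA0 u))
  -- With this weight the mixed term costs at most `(η / 2) t A f f`, which is exactly what the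
  -- expansion leaves of `B t f f`. Its other half is charged to `w`, where the coercivity `δ`
  -- absorbs it for small `t`.
  set s := η / (2 * C) with hs
  have hs0 : 0 < s := by positivity
  have hsmall : ∀ᶠ t in 𝓝[>] (0 : ℝ), t * (C / s + C) < δ := by
    have : Tendsto (fun t : ℝ => t * (C / s + C)) (𝓝[>] 0) (𝓝 (0 * (C / s + C))) :=
      (tendsto_id.mul_const _).mono_left nhdsWithin_le_nhds
    rw [zero_mul] at this
    exact this.eventually_lt_const hδ
  filter_upwards [hexp (η / 2) (by positivity), hexp 1 one_pos, hsmall, self_mem_nhdsWithin]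
    with t h1 h2 h3 (ht : 0 < t) u hu
  obtain ⟨f, hf, w, hw, rfl⟩ := Submodule.mem_sup.1 hu
  have hD : ∀ v, |(B t - B 0) v v| ≤ (C * t) * A v v := by
    intro v
    have e1 := abs_le.1 (h2 v)
    have e2 := abs_le.1 (hCb v)
    simp only [LinearMap.sub_apply]
    rw [abs_le]
    constructor <;> nlinarith [hA0 v]
  have hfr : ∀ v, B 0 f v = 0 := fun v => by
    have := hP hf
    rw [LinearMap.mem_ker] at this
    simp [this]
  have hcross := two_mul_abs_le (B t - B 0) A
    (fun u v => by simp [hB t u v, hB 0 u v]) hA hD hs0 f w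
  have e1 := (abs_le.1 (h1 f)).1
  have e2 := hηP f hf
  have e3 := (abs_le.1 (hD w)).1
  have e4 := hW w hw
  have e5 := neg_abs_le ((B t - B 0) f w)
  simp only [LinearMap.sub_apply, hfr, sub_zero] at e1 e3 hcross e5
  rw [apply_add_add (B t) (hB t)]
  have e6 : C * t * (s * A f f + A w w / s) = η / 2 * t * A f f + C / s * t * A w w := by
    rw [hs]; field_simp
  rw [e6] at hcross
  have e7 : t * (η * A f f) ≤ t * B' f f := mul_le_mul_of_nonneg_left e2 ht.le
  have e8 : t * (C / s + C) * A w w ≤ δ * A w w := mul_le_mul_of_nonneg_right h3.le (hA0 w)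
  nlinarith

/-- A subspace that is large enough meets `P ⊔ W`. -/
theorem exists_mem_sup_ne_zero {G₀ W P S : Submodule ℝ H} [FiniteDimensional ℝ G₀]
    [FiniteDimensional ℝ S] (hc : IsCompl G₀ W) (hP : P ≤ G₀)
    (hdim : Module.finrank ℝ G₀ < Module.finrank ℝ S + Module.finrank ℝ P) :
    ∃ p ∈ S, p ≠ 0 ∧ p ∈ P ⊔ W := by
  let P' : Submodule ℝ G₀ := P.submoduleOf G₀
  have hP' : Module.finrank ℝ P' = Module.finrank ℝ P :=
    (Submodule.submoduleOfEquivOfLe hP).finrank_eq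
  -- The kernel of this map is `S ∩ (P ⊔ W)`, and it is nonzero because the target has smaller
  -- dimension than `S`.
  let T : S →ₗ[ℝ] (G₀ ⧸ P') := P'.mkQ ∘ₗ (G₀.projectionOnto W hc) ∘ₗ S.subtype
  have hlt : Module.finrank ℝ (G₀ ⧸ P') < Module.finrank ℝ S := by
    have := P'.finrank_quotient_add_finrank
    omega
  obtain ⟨x, hx, hx0⟩ := (Submodule.ne_bot_iff _).1 (LinearMap.ker_ne_bot_of_finrank_lt (f := T) hlt)
  refine ⟨x, x.2, by simpa using hx0, ?_⟩
  have hxP : (G₀.projectionOnto W hc x : H) ∈ P := by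
    have : T x = 0 := hx
    simp only [T, LinearMap.comp_apply, Submodule.mkQ_apply, Submodule.Quotient.mk_eq_zero] at this
    exact this
  rw [← Submodule.projection_add_projection_eq_self hc (x : H)]
  exact Submodule.add_mem_sup hxP (Submodule.coe_mem _)

/-- A symmetric form that is coercive on a subspace `Z` of finite codimension, from which every
vector can be projected onto `Z`, splits the space into a finite dimensional negative definite part,
its radical, and a part on which it is coercive. -/
theorem exists_decomposition (Q A : BilinForm ℝ H) (hQ : ∀ u v, Q u v = Q v u)
    (hA : ∀ u v, A u v = A v u) (hA0 : ∀ u, u ≠ 0 → 0 < A u u) (Z : Submodule ℝ H)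
    {δ : ℝ} (hδ : 0 < δ) (hZ : ∀ z ∈ Z, δ * A z z ≤ Q z z)
    (hproj : ∀ u, ∃ z ∈ Z, ∀ v ∈ Z, Q (u - z) v = 0)
    {ι : Type*} [Finite ι] (ev : H →ₗ[ℝ] (ι → ℝ)) (hev : LinearMap.ker ev ≤ Z) :
    ∃ Wm Wp : Submodule ℝ H, FiniteDimensional ℝ Wm ∧ FiniteDimensional ℝ (LinearMap.ker Q) ∧
      Disjoint Wm (LinearMap.ker Q) ∧ IsCompl (Wm ⊔ LinearMap.ker Q) Wp ∧
      (∀ u ∈ Wm, u ≠ 0 → Q u u < 0) ∧ ∃ δ > 0, ∀ w ∈ Wp, δ * A w w ≤ Q w w := by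
  have hAn : ∀ u, 0 ≤ A u u := fun u => by
    by_cases h : u = 0
    · simp [h]
    · exact (hA0 u h).le
  -- `F` is the `Q`-orthogonal complement of `Z`. It meets `Z` only in `0` by coercivity, so `ev`
  -- embeds it in a finite dimensional space; by `hproj` it spans the whole space together with `Z`.
  -- Only the signs of `Q` on `F` remain to be sorted.
  let F : Submodule ℝ H := LinearMap.ker ((LinearMap.lcomp ℝ ℝ Z.subtype) ∘ₗ Q)
  have hFm : ∀ u, u ∈ F ↔ ∀ v ∈ Z, Q u v = 0 := by
    intro u
    simp only [F, LinearMap.mem_ker, LinearMap.comp_apply]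
    constructor
    · intro h v hv
      simpa using LinearMap.congr_fun h ⟨v, hv⟩
    · intro h
      ext v
      simpa using h v v.2
  have hFZ : ∀ u ∈ F, u ∈ Z → u = 0 := by
    intro u hu hz
    by_contra h
    have h1 := hZ u hz
    rw [(hFm u).1 hu u hz] at h1
    nlinarith [hA0 u h]
  have hFfin : FiniteDimensional ℝ F := by
    apply FiniteDimensional.of_injective (ev ∘ₗ F.subtype)
    rw [← LinearMap.ker_eq_bot, LinearMap.ker_eq_bot']
    intro u hu
    exact Subtype.ext (hFZ u u.2 (hev hu))
  have hker : LinearMap.ker Q ≤ F := by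
    intro u hu
    rw [hFm]
    intro v _
    rw [LinearMap.mem_ker] at hu
    simp [hu]
  obtain ⟨v, hv⟩ := LinearMap.BilinForm.exists_orthogonal_basis (B := Q.restrict F)
    ⟨fun x y => by simpa using hQ x y⟩
  generalize Module.finrank ℝ F = n at v hv
  have hv' : ∀ i j, i ≠ j → Q (v i) (v j) = 0 := fun i j hij => by
    simpa using hv hij
  have hdiag : ∀ (s : Fin n → Prop) [DecidablePred s] (c : {i // s i} → ℝ),
      Q (∑ i, c i • (v i : H)) (∑ i, c i • (v i : H)) = ∑ i, c i ^ 2 * Q (v i) (v i) := by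
    intro s _ c
    simp only [map_sum, map_smul, LinearMap.sum_apply, LinearMap.smul_apply, smul_eq_mul]
    refine Finset.sum_congr rfl fun i _ => ?_
    rw [Finset.sum_eq_single i]
    · ring
    · intro j _ hji
      rw [hv' j i (fun h => hji (Subtype.ext h))]
      simp
    · simp
  classical
  let sp : (Fin n → Prop) → Submodule ℝ H := fun s =>
    LinearMap.range (Fintype.linearCombination ℝ (fun i : {i // s i} => (v i : H)))
  have hmem : ∀ s x, x ∈ sp s ↔ ∃ c : {i // s i} → ℝ, ∑ i, c i • (v i : H) = x := by
    intro s x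
    simp only [sp, LinearMap.mem_range, Fintype.linearCombination_apply]
  have hspF : ∀ s, sp s ≤ F := by
    intro s x hx
    obtain ⟨c, rfl⟩ := (hmem s x).1 hx
    exact F.sum_mem fun i _ => F.smul_mem _ (v i).2
  have hsum : ∀ x : F, (x : H) = ∑ i, v.repr x i • (v i : H) := by
    intro x
    have := congrArg F.subtype (v.sum_repr x)
    rw [map_sum] at this
    simpa using this.symm
  -- An isotropic basis vector is orthogonal to `F`, because the basis is orthogonal, and to `Z`,
  -- because it lies in `F`.
  have hrad : sp (fun i => Q (v i) (v i) = 0) ≤ LinearMap.ker Q := by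
    intro x hx
    obtain ⟨c, rfl⟩ := (hmem _ x).1 hx
    refine Submodule.sum_mem _ fun i _ => Submodule.smul_mem _ _ ?_
    rw [LinearMap.mem_ker]
    ext u
    obtain ⟨z, hz, hzz⟩ := hproj u
    have huz : u - z ∈ F := (hFm _).2 hzz
    have e1 : Q (v i) (u - z) = 0 := by
      have := hsum ⟨u - z, huz⟩
      simp only at this
      rw [this]
      simp only [map_sum, map_smul, smul_eq_mul]
      refine Finset.sum_eq_zero fun j _ => ?_
      by_cases hij : (i : Fin n) = j
      · rw [← hij, i.2, mul_zero]
      · rw [hv' _ _ hij, mul_zero]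
    have e2 : Q (v i) z = 0 := (hFm _).1 (v i).2 z hz
    have : Q (v i) u = Q (v i) (u - z) + Q (v i) z := by rw [← map_add]; simp
    rw [this, e1, e2]
    simp
  have hneg : ∀ u ∈ sp (fun i => Q (v i) (v i) < 0), u ≠ 0 → Q u u < 0 := by
    intro u hu hu0
    obtain ⟨c, rfl⟩ := (hmem _ u).1 hu
    rw [hdiag]
    have hle : ∀ i ∈ Finset.univ,
        c i ^ 2 * Q (v (i : Fin n)) (v (i : Fin n)) ≤ 0 := fun i _ =>
      mul_nonpos_of_nonneg_of_nonpos (sq_nonneg _) i.2.le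
    apply lt_of_le_of_ne (Finset.sum_nonpos hle)
    intro h0
    rw [Finset.sum_eq_zero_iff_of_nonpos hle] at h0
    apply hu0
    refine Finset.sum_eq_zero fun i hi => ?_
    have := h0 i hi
    rw [mul_eq_zero] at this
    rcases this with h | h
    · rw [sq_eq_zero_iff.1 h, zero_smul]
    · exact absurd h i.2.ne
  have hpos : ∀ u ∈ sp (fun i => 0 < Q (v i) (v i)), u ≠ 0 → 0 < Q u u := by
    intro u hu hu0
    obtain ⟨c, rfl⟩ := (hmem _ u).1 hu
    rw [hdiag]
    have hle : ∀ i ∈ Finset.univ,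
        0 ≤ c i ^ 2 * Q (v (i : Fin n)) (v (i : Fin n)) := fun i _ =>
      mul_nonneg (sq_nonneg _) i.2.le
    apply lt_of_le_of_ne (Finset.sum_nonneg hle)
    intro h0
    have h0' := (Finset.sum_eq_zero_iff_of_nonneg hle).1 h0.symm
    apply hu0
    refine Finset.sum_eq_zero fun i hi => ?_
    have := h0' i hi
    rw [mul_eq_zero] at this
    rcases this with h | h
    · rw [sq_eq_zero_iff.1 h, zero_smul]
    · exact absurd h i.2.ne'
  set Wm := sp (fun i => Q (v i) (v i) < 0) with hWm
  set Fp := sp (fun i => 0 < Q (v i) (v i)) with hFp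
  have hfd : ∀ s, FiniteDimensional ℝ (sp s) := fun s =>
    Submodule.finiteDimensional_of_le (hspF s)
  obtain ⟨δ₁, hδ₁, hFpc⟩ : ∃ δ₁ > 0, ∀ x ∈ Fp, δ₁ * A x x ≤ Q x x := by
    have := hfd (fun i => 0 < Q (v i) (v i))
    exact exists_pos_mul_le_on Fp Q A hpos
  -- `Q` is additive on the orthogonal sum of `Fp` and `Z`, whereas `A` of a sum is at most twice
  -- the sum of the values of `A`; hence the factor `1 / 2`.
  have hcoer : ∀ w ∈ Fp ⊔ Z, (min δ₁ δ / 2) * A w w ≤ Q w w := by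
    intro w hw
    obtain ⟨a, ha, z, hz, rfl⟩ := Submodule.mem_sup.1 hw
    have e0 : Q a z = 0 := (hFm a).1 (hspF _ ha) z hz
    have e1 := hFpc a ha
    have e2 := hZ z hz
    have e3 : A (a + z) (a + z) ≤ 2 * A a a + 2 * A z z := by
      have := hAn (a + (-1 : ℝ) • z)
      rw [apply_add_add A hA] at this ⊢
      simp only [map_smul, LinearMap.smul_apply, smul_eq_mul] at this
      linarith
    rw [apply_add_add Q hQ, e0]
    have h1 : min δ₁ δ * A a a ≤ δ₁ * A a a :=
      mul_le_mul_of_nonneg_right (min_le_left _ _) (hAn a)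
    have h2 : min δ₁ δ * A z z ≤ δ * A z z :=
      mul_le_mul_of_nonneg_right (min_le_right _ _) (hAn z)
    have h3 : 0 < min δ₁ δ := lt_min hδ₁ hδ
    nlinarith
  have hmin : 0 < min δ₁ δ / 2 := half_pos (lt_min hδ₁ hδ)
  refine ⟨Wm, Fp ⊔ Z, hfd _, Submodule.finiteDimensional_of_le hker, ?_, ⟨?_, ?_⟩, hneg,
    _, hmin, hcoer⟩
  · rw [Submodule.disjoint_def]
    intro x hx hx'
    by_contra h
    have := hneg x hx h
    rw [LinearMap.mem_ker] at hx'
    simp [hx'] at this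
  · rw [Submodule.disjoint_def]
    intro x hx hx'
    by_contra h
    have h1 := hcoer x hx'
    obtain ⟨a, ha, f, hf, rfl⟩ := Submodule.mem_sup.1 hx
    rw [LinearMap.mem_ker] at hf
    have h2 : Q (a + f) (a + f) = Q a a := by
      rw [apply_add_add Q hQ, hQ a f, hf]
      simp
    have h3 : Q a a ≤ 0 := by
      by_cases ha0 : a = 0
      · simp [ha0]
      · exact (hneg a ha ha0).le
    have h4 := mul_pos hmin (hA0 _ h)
    linarith
  · rw [codisjoint_iff, eq_top_iff]
    intro u _
    obtain ⟨z, hz, hzz⟩ := hproj u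
    have huz : u - z ∈ F := (hFm _).2 hzz
    have hs := hsum ⟨u - z, huz⟩
    simp only at hs
    have htri : ∑ i, v.repr ⟨u - z, huz⟩ i • (v i : H)
        ∈ (Wm ⊔ LinearMap.ker Q) ⊔ (Fp ⊔ Z) := by
      refine Submodule.sum_mem _ fun i _ => Submodule.smul_mem _ _ ?_
      have hin : ∀ (s : Fin n → Prop), s i → (v i : H) ∈ sp s := by
        intro s hsi
        rw [hmem]
        refine ⟨Pi.single ⟨i, hsi⟩ 1, ?_⟩
        rw [Finset.sum_eq_single ⟨i, hsi⟩]
        · simp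
        · intro j _ hj
          simp [Pi.single_eq_of_ne hj]
        · simp
      rcases lt_trichotomy (Q (v i) (v i)) 0 with h | h | h
      · exact Submodule.mem_sup_left (Submodule.mem_sup_left (hin _ h))
      · exact Submodule.mem_sup_left (Submodule.mem_sup_right (hrad (hin _ h)))
      · exact Submodule.mem_sup_right (Submodule.mem_sup_left (hin _ h))
    have : u = (u - z) + z := by abel
    rw [this, hs]
    exact Submodule.add_mem _ htri
      (Submodule.mem_sup_right (Submodule.mem_sup_right hz))

end FormPencil

end Forms

/-! ### Min-max values of a pencil of forms -/

section MinMax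

variable {H : Type*} [AddCommGroup H] [Module ℝ H]

namespace FormPencil

/-- The min-max value of index `k` of the pencil `D - b M`. -/
noncomputable def minmax (D M : BilinForm ℝ H) (k : ℕ) : ℝ :=
  sInf {b : ℝ | ∃ S : Submodule ℝ H, Module.finrank ℝ S = k + 1 ∧ ∀ p ∈ S, D p p ≤ b * M p p}

theorem exists_le_finrank_eq (S : Submodule ℝ H) {n : ℕ} (h : n ≤ Module.finrank ℝ S) :
    ∃ S' ≤ S, Module.finrank ℝ S' = n := by
  obtain ⟨f, hf⟩ := exists_linearIndependent_of_le_finrank h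
  refine ⟨(Submodule.span ℝ (range f)).map S.subtype, ?_, ?_⟩
  · exact Submodule.map_subtype_le _ _
  · rw [Submodule.finrank_map_subtype_eq, finrank_span_eq_card hf]
    simp

theorem exists_ne_zero_of_finrank {S : Submodule ℝ H} {n : ℕ} (h : Module.finrank ℝ S = n + 1) :
    ∃ p ∈ S, p ≠ 0 := by
  by_contra! hc
  have : S = ⊥ := (Submodule.eq_bot_iff S).2 hc
  rw [this] at h
  simp at h

theorem minmax_bddBelow {D M : BilinForm ℝ H} (hD : ∀ u, 0 ≤ D u u)
    (hM : ∀ u, u ≠ 0 → 0 < M u u) (k : ℕ) :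
    0 ∈ lowerBounds {b : ℝ | ∃ S : Submodule ℝ H, Module.finrank ℝ S = k + 1 ∧
      ∀ p ∈ S, D p p ≤ b * M p p} := by
  rintro b ⟨S, hS, hb⟩
  obtain ⟨p, hp, hp0⟩ := exists_ne_zero_of_finrank hS
  have h1 := hb p hp
  have h2 := hD p
  have h3 := hM p hp0
  by_contra hlt
  push Not at hlt
  nlinarith [mul_neg_of_neg_of_pos hlt h3]

theorem minmax_le {D M : BilinForm ℝ H} (hD : ∀ u, 0 ≤ D u u) (hM : ∀ u, u ≠ 0 → 0 < M u u)
    {k : ℕ} {b : ℝ} {S : Submodule ℝ H} (hS : k + 1 ≤ Module.finrank ℝ S)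
    (hb : ∀ p ∈ S, D p p ≤ b * M p p) : minmax D M k ≤ b := by
  obtain ⟨S', hS', hfr⟩ := exists_le_finrank_eq S hS
  exact csInf_le ⟨0, minmax_bddBelow hD hM k⟩ ⟨S', hfr, fun p hp => hb p (hS' hp)⟩

/-- On a finite dimensional test space a multiple of `M` dominates `D`. This keeps the infimum in
`minmax` away from the default value of `sInf` at the empty set. -/
theorem minmax_nonempty {D M : BilinForm ℝ H} (hM : ∀ u, u ≠ 0 → 0 < M u u)
    (hinf : ∀ n : ℕ, ∃ S : Submodule ℝ H, Module.finrank ℝ S = n) (k : ℕ) :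
    {b : ℝ | ∃ S : Submodule ℝ H, Module.finrank ℝ S = k + 1 ∧
      ∀ p ∈ S, D p p ≤ b * M p p}.Nonempty := by
  obtain ⟨S, hS⟩ := hinf (k + 1)
  -- `finrank` is `0` on infinite dimensional spaces, so a positive value forces finite dimension.
  have : FiniteDimensional ℝ S := Module.finite_of_finrank_pos (by omega)
  obtain ⟨η, hη, h⟩ := exists_pos_mul_le_on S M D fun x _ => hM x
  refine ⟨1 / η, S, hS, fun p hp => ?_⟩
  have := h p hp
  rw [div_mul_eq_mul_div, le_div_iff₀ hη]
  linarith

theorem minmax_nonneg {D M : BilinForm ℝ H} (hD : ∀ u, 0 ≤ D u u) (hM : ∀ u, u ≠ 0 → 0 < M u u)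
    (k : ℕ) : 0 ≤ minmax D M k :=
  Real.sInf_nonneg fun _ hb => minmax_bddBelow hD hM k hb

theorem le_minmax {D M : BilinForm ℝ H} (hM : ∀ u, u ≠ 0 → 0 < M u u)
    (hinf : ∀ n : ℕ, ∃ S : Submodule ℝ H, Module.finrank ℝ S = n) {k : ℕ} {b : ℝ}
    (h : ∀ S : Submodule ℝ H, Module.finrank ℝ S = k + 1 →
      ∃ p ∈ S, p ≠ 0 ∧ b * M p p ≤ D p p) : b ≤ minmax D M k := by
  apply le_csInf (minmax_nonempty hM hinf k)
  rintro c ⟨S, hS, hc⟩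
  obtain ⟨p, hp, hp0, hb⟩ := h S hS
  exact le_of_mul_le_mul_right (hb.trans (hc p hp)) (hM p hp0)

/-- `Wm`, the radical of `Q` and `Wp` split the space; `Q` is negative on `Wm` and coercive on
`Wp`. -/
structure IsSplitting (Q A : BilinForm ℝ H) (Wm Wp : Submodule ℝ H) : Prop where
  finite_neg : FiniteDimensional ℝ Wm
  finite_ker : FiniteDimensional ℝ (LinearMap.ker Q)
  disjoint : Disjoint Wm (LinearMap.ker Q)
  isCompl : IsCompl (Wm ⊔ LinearMap.ker Q) Wp
  neg : ∀ u ∈ Wm, u ≠ 0 → Q u u < 0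
  coercive : ∃ δ > 0, ∀ w ∈ Wp, δ * A w w ≤ Q w w

theorem IsSplitting.finrank_sup {Q A : BilinForm ℝ H} {Wm Wp : Submodule ℝ H}
    (h : IsSplitting Q A Wm Wp) {P : Submodule ℝ H} (hP : P ≤ LinearMap.ker Q) :
    Module.finrank ℝ ↥(Wm ⊔ P) = Module.finrank ℝ Wm + Module.finrank ℝ P := by
  have := h.finite_neg
  have := h.finite_ker
  have : FiniteDimensional ℝ P := Submodule.finiteDimensional_of_le hP
  have h1 := Submodule.finrank_sup_add_finrank_inf_eq Wm P
  rw [(h.disjoint.mono_right hP).eq_bot] at h1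
  simpa using h1

theorem ker_apply {Q : BilinForm ℝ H} {f : H} (hf : f ∈ LinearMap.ker Q) (v : H) : Q f v = 0 := by
  rw [LinearMap.mem_ker] at hf
  simp [hf]

/-! ### Position of the index `k` relative to the dimensions of the splitting -/

section Index

variable {A D M : BilinForm ℝ H} (hA0 : ∀ u, 0 ≤ A u u)
  (hDs : ∀ u v, D u v = D v u) (hMs : ∀ u v, M u v = M v u)
  (hD : ∀ u, 0 ≤ D u u) (hM : ∀ u, u ≠ 0 → 0 < M u u) (hMA : ∃ C, ∀ u, |M u u| ≤ C * A u u)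
  (hinf : ∀ n : ℕ, ∃ S : Submodule ℝ H, Module.finrank ℝ S = n) {k : ℕ}
  {Wm Wp : Submodule ℝ H} {l : ℝ} (h : IsSplitting (D - l • M) A Wm Wp)
include h

include hD hM in
-- Otherwise `Wm` is an admissible test space, and by compactness `D ≤ (l - η) M` on it for some `η
-- > 0`, which pushes the min-max value below `l`.
theorem finrank_neg_le (hl : minmax D M k = l) : Module.finrank ℝ Wm ≤ k := by
  by_contra! hlt
  have := h.finite_neg
  obtain ⟨η, hη, hb⟩ := exists_pos_mul_le_on Wm (-(D - l • M)) M fun x hx hx0 => by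
    have := h.neg x hx hx0
    simp only [LinearMap.neg_apply]
    linarith
  have := minmax_le hD hM (b := l - η) hlt fun p hp => by
    have := hb p hp
    simp only [LinearMap.neg_apply, LinearMap.sub_apply, LinearMap.smul_apply, smul_eq_mul] at this
    linarith
  linarith

include hDs hMs in
theorem apply_sup_nonpos {P : Submodule ℝ H} (hP : P ≤ LinearMap.ker (D - l • M)) :
    ∀ p ∈ Wm ⊔ P, D p p ≤ l * M p p := by
  intro p hp
  obtain ⟨a, ha, f, hf, rfl⟩ := Submodule.mem_sup.1 hp
  have h1 : (D - l • M) (a + f) (a + f) = (D - l • M) a a := by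
    rw [apply_add_add _ (fun u v => by simp [hDs u v, hMs u v])]
    have e1 : (D - l • M) a f = (D - l • M) f a := by simp [hDs a f, hMs a f]
    rw [e1, ker_apply (hP hf), ker_apply (hP hf)]
    ring
  have h2 : (D - l • M) a a ≤ 0 := by
    by_cases ha0 : a = 0
    · simp [ha0]
    · exact (h.neg a ha ha0).le
  rw [← h1] at h2
  simp only [LinearMap.sub_apply, LinearMap.smul_apply, smul_eq_mul] at h2
  linarith

include hinf hA0 hMA hM in
-- Otherwise every test space of dimension `k + 1` meets `Wp`, where coercivity gives `D ≥ (l + δ')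
-- M` with a fixed `δ' > 0`.
theorem lt_finrank_sup_ker (hl : minmax D M k = l) :
    k < Module.finrank ℝ ↥(Wm ⊔ LinearMap.ker (D - l • M)) := by
  by_contra! hle
  have := h.finite_neg
  have := h.finite_ker
  obtain ⟨δ, hδ, hc⟩ := h.coercive
  obtain ⟨C, hC⟩ := hMA
  have hCpos : 0 < max C 1 := by positivity
  have := le_minmax (b := l + δ / max C 1) hM hinf (k := k) (D := D) fun S hS => by
    have : FiniteDimensional ℝ S := Module.finite_of_finrank_pos (by omega)
    obtain ⟨p, hp, hp0, hpW⟩ := exists_mem_sup_ne_zero (S := S) (P := ⊥) h.isCompl bot_le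
      (by simp only [finrank_bot]; omega)
    rw [bot_sup_eq] at hpW
    refine ⟨p, hp, hp0, ?_⟩
    have h1 := hc p hpW
    have h2 : M p p ≤ max C 1 * A p p := (le_abs_self _).trans ((hC p).trans
      (mul_le_mul_of_nonneg_right (le_max_left _ _) (hA0 p)))
    have h3 : δ / max C 1 * M p p ≤ δ * A p p := by
      rw [div_mul_eq_mul_div, div_le_iff₀ hCpos]
      nlinarith
    simp only [LinearMap.sub_apply, LinearMap.smul_apply, smul_eq_mul] at h1
    linarith
  have : 0 < δ / max C 1 := by positivity
  linarith

include hinf hDs hMs hA0 hM in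
-- The gap provides a `k`-dimensional space with `D ≤ b M`, `b < l`. If `Wm` were smaller than that,
-- this space would meet `ker ⊔ Wp`, where `D ≥ l M`. The truncated subtraction is harmless: for `k
-- = 0` the bound is empty.
theorem le_finrank_neg_of_gap (hgap : minmax D M (k - 1) < l) : k ≤ Module.finrank ℝ Wm := by
  by_contra! hlt
  have := h.finite_neg
  have := h.finite_ker
  obtain ⟨b, ⟨S, hS, hb⟩, hbl⟩ := exists_lt_of_csInf_lt (minmax_nonempty hM hinf (k - 1)) hgap
  have : FiniteDimensional ℝ S := Module.finite_of_finrank_pos (by omega)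
  obtain ⟨p, hp, hp0, hpW⟩ := exists_mem_sup_ne_zero (S := S) h.isCompl le_sup_right
    (by rw [h.finrank_sup le_rfl]; omega)
  obtain ⟨f, hf, w, hw, rfl⟩ := Submodule.mem_sup.1 hpW
  obtain ⟨δ, hδ, hc⟩ := h.coercive
  have h1 : (D - l • M) (f + w) (f + w) = (D - l • M) w w := by
    rw [apply_add_add _ (fun u v => by simp [hDs u v, hMs u v])]
    rw [ker_apply hf, ker_apply hf]
    ring
  have h2 := hc w hw
  rw [← h1] at h2
  have h3 := hb _ hp
  have h4 := hM _ hp0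
  have h5 := mul_nonneg hδ.le (hA0 w)
  simp only [LinearMap.sub_apply, LinearMap.smul_apply, smul_eq_mul] at h2
  nlinarith

include hDs hMs hD hM in
-- `D ≤ l M` on `Wm ⊔ ker`, so dimension `k + 2` there would bring the next min-max value down to
-- `l`.
theorem finrank_sup_ker_le_of_gap (hgap : l < minmax D M (k + 1)) :
    Module.finrank ℝ ↥(Wm ⊔ LinearMap.ker (D - l • M)) ≤ k + 1 := by
  by_contra! hlt
  have := minmax_le hD hM (k := k + 1) hlt (apply_sup_nonpos hDs hMs h le_rfl)
  linarith

end Index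

/-! ### One-sided first order bounds for min-max values along a path of forms -/

/-- Paths of forms `D t`, `M t` with velocities `D'`, `M'` at `t = 0`, uniformly with respect to
the reference form `A`. -/
structure IsFormPath (A : BilinForm ℝ H) (D M : ℝ → BilinForm ℝ H) (D' M' : BilinForm ℝ H) :
    Prop where
  symm_ref : ∀ u v, A u v = A v u
  ref_nonneg : ∀ u, 0 ≤ A u u
  symm_fst : ∀ t u v, D t u v = D t v u
  symm_snd : ∀ t u v, M t u v = M t v u
  fst_nonneg : ∀ᶠ t in 𝓝 0, ∀ u, 0 ≤ D t u u
  snd_pos : ∀ᶠ t in 𝓝 0, ∀ u, u ≠ 0 → 0 < M t u u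
  fst_expansion : ∀ η > 0, ∀ᶠ t in 𝓝 0, ∀ u,
    |D t u u - D 0 u u - t * D' u u| ≤ η * |t| * A u u
  snd_expansion : ∀ η > 0, ∀ᶠ t in 𝓝 0, ∀ u,
    |M t u u - M 0 u u - t * M' u u| ≤ η * |t| * A u u
  fst_bound : ∃ C, ∀ u, |D' u u| ≤ C * A u u
  snd_bound : ∃ C, ∀ u, |M' u u| ≤ C * A u u
  snd_zero_bound : ∃ C, ∀ u, |M 0 u u| ≤ C * A u u

namespace IsFormPath

variable {A : BilinForm ℝ H} {D M : ℝ → BilinForm ℝ H} {D' M' : BilinForm ℝ H}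

/-- All estimates are made for `t > 0`; the reversed path transports them to `t < 0`. -/
theorem reverse (h : IsFormPath A D M D' M') :
    IsFormPath A (fun t => D (-t)) (fun t => M (-t)) (-D') (-M') where
  symm_ref := h.symm_ref
  ref_nonneg := h.ref_nonneg
  symm_fst t := h.symm_fst _
  symm_snd t := h.symm_snd _
  fst_nonneg := by
    have : Tendsto (fun t : ℝ => -t) (𝓝 0) (𝓝 0) := by simpa using (continuous_neg (G := ℝ)).tendsto 0
    exact this.eventually h.fst_nonneg
  snd_pos := by
    have : Tendsto (fun t : ℝ => -t) (𝓝 0) (𝓝 0) := by simpa using (continuous_neg (G := ℝ)).tendsto 0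
    exact this.eventually h.snd_pos
  fst_expansion η hη := by
    have : Tendsto (fun t : ℝ => -t) (𝓝 0) (𝓝 0) := by simpa using (continuous_neg (G := ℝ)).tendsto 0
    simpa using this.eventually (h.fst_expansion η hη)
  snd_expansion η hη := by
    have : Tendsto (fun t : ℝ => -t) (𝓝 0) (𝓝 0) := by simpa using (continuous_neg (G := ℝ)).tendsto 0
    simpa using this.eventually (h.snd_expansion η hη)
  fst_bound := by simpa using h.fst_bound
  snd_bound := by simpa using h.snd_bound
  snd_zero_bound := by simpa using h.snd_zero_bound

/-- Expansion of `D t - (l + c t) M t`. -/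
theorem pencil_expansion (h : IsFormPath A D M D' M') (l c : ℝ) :
    ∀ η > 0, ∀ᶠ t in 𝓝[>] (0 : ℝ), ∀ u,
      |(D t - (l + c * t) • M t) u u - (D 0 - l • M 0) u u
        - t * (D' - l • M' - c • M 0) u u| ≤ η * t * A u u := by
  intro η hη
  obtain ⟨C, hC⟩ := h.snd_bound
  -- The remainders of `D t`, of `l M t` and of `c t M t` then use up `η / 3` together, and the
  -- second order term `c t² M'` another `η / 3`.
  set η' := η / (3 * (1 + |l| + |c|)) with hη'
  have hl : 0 < 1 + |l| + |c| := by positivity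
  have hη'0 : 0 < η' := by positivity
  have hsmall : ∀ᶠ t in 𝓝[>] (0 : ℝ), t * (|c| * |C|) < η / 3 := by
    have : Tendsto (fun t : ℝ => t * (|c| * |C|)) (𝓝[>] 0) (𝓝 (0 * (|c| * |C|))) :=
      (tendsto_id.mul_const _).mono_left nhdsWithin_le_nhds
    rw [zero_mul] at this
    exact this.eventually_lt_const (by positivity)
  have hsmall1 : ∀ᶠ t in 𝓝[>] (0 : ℝ), t < 1 :=
    (tendsto_id.mono_left nhdsWithin_le_nhds).eventually_lt_const one_pos
  filter_upwards [(h.fst_expansion η' hη'0).filter_mono nhdsWithin_le_nhds,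
    (h.snd_expansion η' hη'0).filter_mono nhdsWithin_le_nhds, hsmall, hsmall1,
    self_mem_nhdsWithin] with t h1 h2 h3 h4 (ht : 0 < t) u
  have hAu := h.ref_nonneg u
  have e1 := h1 u
  have e2 := h2 u
  rw [abs_of_pos ht] at e1 e2
  set x := D t u u - D 0 u u - t * D' u u with hx
  set y := M t u u - M 0 u u - t * M' u u with hy
  have e3 : (D t - (l + c * t) • M t) u u - (D 0 - l • M 0) u u
      - t * (D' - l • M' - c • M 0) u u = x - l * y - c * t * y - c * t * (t * M' u u) := by
    simp only [LinearMap.sub_apply, LinearMap.smul_apply, smul_eq_mul, hx, hy]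
    ring
  rw [e3]
  have b1 : |l * y| ≤ |l| * (η' * t * A u u) := by
    rw [abs_mul]; exact mul_le_mul_of_nonneg_left e2 (abs_nonneg _)
  have b2 : |c * t * y| ≤ |c| * (η' * t * A u u) := by
    rw [mul_assoc, abs_mul]
    refine mul_le_mul_of_nonneg_left ?_ (abs_nonneg _)
    rw [abs_mul, abs_of_pos ht]
    nlinarith [abs_nonneg y]
  have b3 : |c * t * (t * M' u u)| ≤ η / 3 * t * A u u := by
    have : |c * t * (t * M' u u)| = t * (|c| * t) * |M' u u| := by
      rw [abs_mul, abs_mul, abs_mul, abs_of_pos ht]; ring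
    rw [this]
    have h5 : |M' u u| ≤ |C| * A u u :=
      (hC u).trans (mul_le_mul_of_nonneg_right (le_abs_self _) hAu)
    have h6 : t * (|c| * t) * |M' u u| ≤ t * (|c| * t) * (|C| * A u u) :=
      mul_le_mul_of_nonneg_left h5 (by positivity)
    have h7 : (t * (|c| * |C|)) * (t * A u u) ≤ η / 3 * (t * A u u) :=
      mul_le_mul_of_nonneg_right h3.le (by positivity)
    nlinarith
  have key : η' * (1 + |l| + |c|) = η / 3 := by
    rw [hη']; field_simp
  have tri : |x - l * y - c * t * y - c * t * (t * M' u u)|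
      ≤ |x| + |l * y| + |c * t * y| + |c * t * (t * M' u u)| := by
    refine (abs_sub _ _).trans (add_le_add ((abs_sub _ _).trans (add_le_add (abs_sub _ _) le_rfl)) le_rfl)
  have : η' * t * A u u + |l| * (η' * t * A u u) + |c| * (η' * t * A u u)
      = η / 3 * t * A u u := by
    rw [← key]; ring
  have hp : 0 ≤ η * t * A u u := by positivity
  linarith

theorem pencil_bound (h : IsFormPath A D M D' M') (l c : ℝ) :
    ∃ C, ∀ u, |(D' - l • M' - c • M 0) u u| ≤ C * A u u := by
  obtain ⟨C₁, h₁⟩ := h.fst_bound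
  obtain ⟨C₂, h₂⟩ := h.snd_bound
  obtain ⟨C₃, h₃⟩ := h.snd_zero_bound
  refine ⟨C₁ + |l| * C₂ + |c| * C₃, fun u => ?_⟩
  simp only [LinearMap.sub_apply, LinearMap.smul_apply, smul_eq_mul]
  refine (abs_sub _ _).trans ?_
  have := abs_sub (D' u u) (l * M' u u)
  rw [abs_mul] at this ⊢
  have e1 := mul_le_mul_of_nonneg_left (h₂ u) (abs_nonneg l)
  have e2 := mul_le_mul_of_nonneg_left (h₃ u) (abs_nonneg c)
  have := h₁ u
  nlinarith

variable {Wm Wp P : Submodule ℝ H} {l c : ℝ} {k : ℕ}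

/-- By `eventually_nonneg` the pencil at the level `l + c t` is nonnegative on `P ⊔ Wp`, and the
dimension hypothesis makes every test space of dimension `k + 1` meet this sum. `P` may be the whole
radical or a line in it. -/
theorem eventually_le_minmax (h : IsFormPath A D M D' M')
    (hinf : ∀ n : ℕ, ∃ S : Submodule ℝ H, Module.finrank ℝ S = n)
    (hs : IsSplitting (D 0 - l • M 0) A Wm Wp) (hP : P ≤ LinearMap.ker (D 0 - l • M 0))
    (hdim : Module.finrank ℝ ↥(Wm ⊔ LinearMap.ker (D 0 - l • M 0)) ≤ k + Module.finrank ℝ P)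
    (hpos : ∀ f ∈ P, f ≠ 0 → c * M 0 f f < (D' - l • M') f f) :
    ∀ᶠ t in 𝓝[>] (0 : ℝ), l + c * t ≤ minmax (D t) (M t) k := by
  have := hs.finite_neg
  have := hs.finite_ker
  have : FiniteDimensional ℝ P := Submodule.finiteDimensional_of_le hP
  obtain ⟨δ, hδ, hc⟩ := hs.coercive
  have key := eventually_nonneg A (D' - l • M' - c • M 0) (fun t => D t - (l + c * t) • M t)
    h.symm_ref h.ref_nonneg
    (fun t u v => by simp [h.symm_fst t u v, h.symm_snd t u v])
    (h.pencil_bound l c) (by simpa using h.pencil_expansion l c) P Wp (by simpa using hP)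
    (fun f hf hf0 => by
      have := hpos f hf hf0
      simp only [LinearMap.sub_apply, LinearMap.smul_apply, smul_eq_mul] at this ⊢
      linarith) hδ (by simpa using hc)
  filter_upwards [key, h.snd_pos.filter_mono nhdsWithin_le_nhds] with t ht hMt
  refine le_minmax hMt hinf fun S hS => ?_
  have : FiniteDimensional ℝ S := Module.finite_of_finrank_pos (by omega)
  obtain ⟨p, hp, hp0, hpW⟩ := exists_mem_sup_ne_zero (S := S) hs.isCompl
    (hP.trans le_sup_right) (by omega)
  refine ⟨p, hp, hp0, ?_⟩
  have := ht p hpW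
  simp only [LinearMap.sub_apply, LinearMap.smul_apply, smul_eq_mul] at this
  linarith

/-- Here `Wm ⊔ P` is the test space. The negated pencil is coercive on the finite dimensional `Wm`,
which takes over the role of `Wp`. -/
theorem eventually_minmax_le (h : IsFormPath A D M D' M')
    (hs : IsSplitting (D 0 - l • M 0) A Wm Wp) (hP : P ≤ LinearMap.ker (D 0 - l • M 0))
    (hdim : k + 1 ≤ Module.finrank ℝ Wm + Module.finrank ℝ P)
    (hneg : ∀ f ∈ P, f ≠ 0 → (D' - l • M') f f < c * M 0 f f) :
    ∀ᶠ t in 𝓝[>] (0 : ℝ), minmax (D t) (M t) k ≤ l + c * t := by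
  have := hs.finite_neg
  have := hs.finite_ker
  have : FiniteDimensional ℝ P := Submodule.finiteDimensional_of_le hP
  obtain ⟨δ, hδ, hc⟩ := exists_pos_mul_le_on Wm (-(D 0 - l • M 0)) A fun x hx hx0 => by
    have := hs.neg x hx hx0
    simp only [LinearMap.neg_apply]
    linarith
  have key := eventually_nonneg A (-(D' - l • M' - c • M 0)) (fun t => -(D t - (l + c * t) • M t))
    h.symm_ref h.ref_nonneg
    (fun t u v => by simp [h.symm_fst t u v, h.symm_snd t u v])
    (by simpa only [LinearMap.neg_apply, abs_neg] using h.pencil_bound l c)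
    (fun η hη => by
      filter_upwards [h.pencil_expansion l c η hη] with t ht u
      rw [← abs_neg]
      convert ht u using 2
      simp only [LinearMap.neg_apply, mul_zero, add_zero]
      ring) P Wm (by
        intro f hf
        have := hP hf
        rw [LinearMap.mem_ker] at this ⊢
        simp only [mul_zero, add_zero, LinearMap.neg_apply, this, neg_zero])
    (fun f hf hf0 => by
      have := hneg f hf hf0
      simp only [LinearMap.sub_apply, LinearMap.smul_apply, smul_eq_mul,
        LinearMap.neg_apply] at this ⊢
      linarith) hδ (by simpa using hc)
  filter_upwards [key, h.snd_pos.filter_mono nhdsWithin_le_nhds,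
    h.fst_nonneg.filter_mono nhdsWithin_le_nhds] with t ht hMt hDt
  refine minmax_le hDt hMt (S := Wm ⊔ P) ?_ fun p hp => ?_
  · rw [hs.finrank_sup hP]
    exact hdim
  · have := ht p (by rwa [sup_comm])
    simp only [LinearMap.neg_apply, LinearMap.sub_apply, LinearMap.smul_apply, smul_eq_mul] at this
    linarith

end IsFormPath

end FormPencil

end MinMax

/-! ### Square integrable functions on the unit interval and their primitives -/

section IntervalIntegrals

theorem Continuous.integrable_unitInterval {f : I → ℝ} (hf : Continuous f) :
    Integrable f (volume : Measure I) :=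
  hf.integrable_of_hasCompactSupport (HasCompactSupport.of_compactSpace f)

/-- Every point of `[0,1]`, including the ends, is a limit of interior points, so a nonempty
relatively open set contains a nonempty open set of reals. This lets a continuous function that
vanishes almost everywhere vanish everywhere. -/
instance unitInterval.isOpenPosMeasure_volume : (volume : Measure I).IsOpenPosMeasure where
  open_pos := by
    intro U hU ⟨x, hx⟩ h0
    obtain ⟨W, hW, rfl⟩ := isOpen_induced_iff.1 hU
    have hcl : (x : ℝ) ∈ closure (Ioo (0 : ℝ) 1) := by
      rw [closure_Ioo zero_ne_one]
      exact x.2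
    have hne : (W ∩ Ioo (0 : ℝ) 1).Nonempty := mem_closure_iff.1 hcl W hW hx
    have hpos := (hW.inter isOpen_Ioo).measure_pos volume hne
    rw [unitInterval.volume_apply, Subtype.image_preimage_coe] at h0
    refine hpos.ne' (measure_mono_null ?_ h0)
    rintro y ⟨h1, h2⟩
    exact ⟨⟨h2.1.le, h2.2.le⟩, h1⟩

theorem integrable_mul_mul_of_L2 (a : C(I, ℝ)) (v w : Lp ℝ 2 (volume : Measure I)) :
    Integrable (fun x => a x * (v x * w x)) := by
  have h : Integrable (fun x => v x * w x) := (Lp.memLp v).integrable_mul (Lp.memLp w)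
  exact h.bdd_mul (c := ‖a‖) a.continuous.aestronglyMeasurable
    (Eventually.of_forall fun x => a.norm_coe_le_norm x)

theorem integral_sq_eq_norm_sq (w : Lp ℝ 2 (volume : Measure I)) :
    ∫ x, w x ^ 2 = ‖w‖ ^ 2 := by
  rw [← real_inner_self_eq_norm_sq, L2.inner_def]
  simp [sq]

theorem setIntegral_eq_inner (w : Lp ℝ 2 (volume : Measure I)) {s : Set I}
    (hs : MeasurableSet s) :
    ∫ x in s, w x = inner ℝ (indicatorConstLp 2 hs (measure_ne_top volume s) (1 : ℝ)) w :=
  (L2.inner_indicatorConstLp_one hs (measure_ne_top volume s) w).symm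

theorem setIntegral_sq_le (w : Lp ℝ 2 (volume : Measure I)) {s : Set I}
    (hs : MeasurableSet s) : (∫ x in s, w x) ^ 2 ≤ volume.real s * ‖w‖ ^ 2 := by
  rw [setIntegral_eq_inner w hs]
  have h := abs_real_inner_le_norm (indicatorConstLp 2 hs (measure_ne_top volume s) (1 : ℝ)) w
  have hn : ‖indicatorConstLp 2 hs (measure_ne_top volume s) (1 : ℝ)‖ ^ 2 = volume.real s := by
    rw [norm_indicatorConstLp (by norm_num) (by norm_num)]
    simp only [norm_one, one_mul, ENNReal.toReal_ofNat]
    rw [← Real.sqrt_eq_rpow, Real.sq_sqrt measureReal_nonneg]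
  calc _ ≤ (‖indicatorConstLp 2 hs (measure_ne_top volume s) (1 : ℝ)‖ * ‖w‖) ^ 2 :=
        sq_le_sq' (by linarith [neg_abs_le (inner ℝ (indicatorConstLp 2 hs
          (measure_ne_top volume s) (1 : ℝ)) w)]) ((le_abs_self _).trans h)
    _ = _ := by rw [mul_pow, hn]

theorem L2_integrable (w : Lp ℝ 2 (volume : Measure I)) : Integrable (fun x => w x) :=
  (Lp.memLp w).integrable (by norm_num)

/-- Cauchy-Schwarz on the interval between the two points. This Hölder estimate gives both the
continuity of Sobolev functions and the smallness of functions vanishing on a fine grid. -/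
theorem primitive_sub_sq_le (w : Lp ℝ 2 (volume : Measure I)) (x y : I) :
    ((∫ s in Iic x, w s) - ∫ s in Iic y, w s) ^ 2 ≤ |(x : ℝ) - y| * ‖w‖ ^ 2 := by
  wlog h : y ≤ x generalizing x y
  · rw [abs_sub_comm, ← neg_sub, neg_sq]
    exact this y x (le_of_not_ge h)
  have hd : (∫ s in Iic x, w s) - ∫ s in Iic y, w s = ∫ s in Ioc y x, w s := by
    rw [← Iic_union_Ioc_eq_Iic h, setIntegral_union _ measurableSet_Ioc
      (L2_integrable w).integrableOn (L2_integrable w).integrableOn]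
    · ring
    · rw [Set.disjoint_left]
      intro z hz hz'
      exact absurd hz'.1 (not_lt.2 hz)
  rw [hd]
  refine (setIntegral_sq_le w measurableSet_Ioc).trans ?_
  have hxy : (0 : ℝ) ≤ (x : ℝ) - y := sub_nonneg.2 h
  rw [Measure.real, unitInterval.volume_Ioc, ENNReal.toReal_ofReal hxy, abs_of_nonneg hxy]

/-- The half lines `Iic x` form a π-system generating the Borel sets, so the integral vanishes over
every measurable set. -/
theorem ae_eq_zero_of_primitive_eq_zero {w : I → ℝ} (hw : Integrable w)
    (h : ∀ x : I, ∫ s in Iic x, w s = 0) : w =ᵐ[volume] 0 := by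
  have htop : ∫ s, w s = 0 := by
    have h1 := h 1
    have : Iic (1 : I) = univ := eq_univ_of_forall fun x => unitInterval.le_one'
    rwa [this, setIntegral_univ] at h1
  have key : ∀ s : Set I, MeasurableSet s → ∫ x in s, w x = 0 := by
    intro s hs
    refine MeasurableSpace.induction_on_inter (m := inferInstance)
      (C := fun s _ => ∫ x in s, w x = 0)
      (BorelSpace.measurable_eq.trans (borel_eq_generateFrom_Iic I)) isPiSystem_Iic
      (by simp) ?_ ?_ ?_ s hs
    · rintro _ ⟨x, rfl⟩
      exact h x
    · intro t ht h0
      have := integral_add_compl ht hw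
      rw [h0, htop, zero_add] at this
      exact this
    · intro f hd hm h0
      rw [integral_iUnion hm hd hw.integrableOn]
      simp [h0]
  exact hw.ae_eq_zero_of_forall_setIntegral_eq_zero fun s hs _ => key s hs

theorem setIntegral_Iic_zero (w : I → ℝ) : ∫ s in Iic (0 : I), w s = 0 := by
  have : (Iic (0 : I)) = {0} := by
    ext x
    simp only [mem_Iic, mem_singleton_iff]
    exact ⟨fun h => le_antisymm h unitInterval.nonneg', fun h => h.le⟩
  rw [this]
  simp

end IntervalIntegrals

namespace FormPencil

/-- The weight `s = √(A v v) / √(A u u)` is the optimal one in `two_mul_abs_le`. The result supplies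
the continuity needed for Lax-Milgram. -/
theorem abs_le_sqrt_mul_sqrt {H : Type*} [AddCommGroup H] [Module ℝ H] (D A : BilinForm ℝ H)
    (hD : ∀ u v, D u v = D v u) (hA : ∀ u v, A u v = A v u) (hA0 : ∀ u, u ≠ 0 → 0 < A u u)
    {C : ℝ} (h : ∀ u, |D u u| ≤ C * A u u) (u v : H) :
    |D u v| ≤ C * (√(A u u) * √(A v v)) := by
  by_cases hu : u = 0
  · simp [hu]
  by_cases hv : v = 0
  · simp [hv]
  have h1 := Real.sqrt_pos.2 (hA0 u hu)
  have h2 := Real.sqrt_pos.2 (hA0 v hv)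
  have key := two_mul_abs_le D A hD hA h (div_pos h2 h1) u v
  have e1 : A u u = √(A u u) ^ 2 := (Real.sq_sqrt (hA0 u hu).le).symm
  have e2 : A v v = √(A v v) ^ 2 := (Real.sq_sqrt (hA0 v hv).le).symm
  have e3 : √(A v v) / √(A u u) * A u u + A v v / (√(A v v) / √(A u u))
      = 2 * (√(A u u) * √(A v v)) := by
    rw [e1, e2, Real.sqrt_sq h1.le, Real.sqrt_sq h2.le]
    field_simp
    ring
  rw [e3] at key
  linarith

end FormPencil

/-! ### Dirichlet, mass and energy forms on the Sobolev space of the graph -/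

namespace EdgeGraph

open FormPencil

variable {V E : Type*} (G : EdgeGraph V E)

section Basic

variable {G}

theorem sobolev_apply (u : G.sobolev) (e : E) (x : I) :
    u.1.1 e x = u.1.1 e 0 + ∫ s in Iic x, u.1.2 e s := u.2.2 e x

theorem sobolev_sub_sq_le (u : G.sobolev) (e : E) (x y : I) :
    (u.1.1 e x - u.1.1 e y) ^ 2 ≤ |(x : ℝ) - y| * ‖u.1.2 e‖ ^ 2 := by
  rw [sobolev_apply u e x, sobolev_apply u e y, add_sub_add_left_eq_sub]
  exact primitive_sub_sq_le _ _ _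

theorem sobolev_continuous (u : G.sobolev) (e : E) : Continuous (u.1.1 e) := by
  rw [continuous_iff_continuousAt]
  intro y
  have h : Tendsto (fun x : I => (u.1.1 e x - u.1.1 e y) ^ 2) (𝓝 y) (𝓝 0) := by
    have hc : Continuous fun x : I => |(x : ℝ) - y| * ‖u.1.2 e‖ ^ 2 := by fun_prop
    refine squeeze_zero (fun x => sq_nonneg _) (fun x => sobolev_sub_sq_le u e x y) ?_
    simpa using hc.tendsto y
  have h2 : Tendsto (fun x : I => |u.1.1 e x - u.1.1 e y|) (𝓝 y) (𝓝 0) := by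
    have := (Real.continuous_sqrt.tendsto 0).comp h
    simpa [Function.comp_def, Real.sqrt_sq_eq_abs] using this
  rw [ContinuousAt, tendsto_iff_dist_tendsto_zero]
  exact h2

/-- The weak derivative is determined almost everywhere by its primitive, so the second component of
the pair carries no extra freedom. -/
theorem sobolev_ext {u : G.sobolev} (h : u.1.1 = 0) : u = 0 := by
  have h2 : u.1.2 = 0 := by
    funext e
    have hz : ∀ x : I, ∫ s in Iic x, u.1.2 e s = 0 := by
      intro x
      have := sobolev_apply u e x
      rw [h] at this
      simpa using this.symm
    have hi : Integrable (u.1.2 e) := L2_integrable _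
    have : (u.1.2 e : I → ℝ) =ᵐ[volume] 0 := ae_eq_zero_of_primitive_eq_zero hi hz
    exact Lp.ext (this.trans (Lp.coeFn_zero ..).symm)
  exact Subtype.ext (Prod.ext h h2)

end Basic

variable [Fintype E]

/-- The form `∑ ∫ α u' v'`. -/
noncomputable def derivForm (α : E → C(I, ℝ)) : BilinForm ℝ G.sobolev :=
  LinearMap.mk₂ ℝ (fun u v => ∑ e, ∫ x, α e x * (u.1.2 e x * v.1.2 e x))
    (fun u u' v => by
      rw [← Finset.sum_add_distrib]
      refine Finset.sum_congr rfl fun e _ => ?_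
      rw [← integral_add (integrable_mul_mul_of_L2 _ _ _) (integrable_mul_mul_of_L2 _ _ _)]
      refine integral_congr_ae ?_
      filter_upwards [Lp.coeFn_add (u.1.2 e) (u'.1.2 e)] with x hx
      have : (u + u').1.2 e x = u.1.2 e x + u'.1.2 e x := hx
      rw [this]
      ring)
    (fun a u v => by
      rw [smul_eq_mul, Finset.mul_sum]
      refine Finset.sum_congr rfl fun e _ => ?_
      rw [← integral_const_mul]
      refine integral_congr_ae ?_
      filter_upwards [Lp.coeFn_smul a (u.1.2 e)] with x hx
      have : (a • u).1.2 e x = a * u.1.2 e x := hx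
      rw [this]
      ring)
    (fun v u u' => by
      rw [← Finset.sum_add_distrib]
      refine Finset.sum_congr rfl fun e _ => ?_
      rw [← integral_add (integrable_mul_mul_of_L2 _ _ _) (integrable_mul_mul_of_L2 _ _ _)]
      refine integral_congr_ae ?_
      filter_upwards [Lp.coeFn_add (u.1.2 e) (u'.1.2 e)] with x hx
      have : (u + u').1.2 e x = u.1.2 e x + u'.1.2 e x := hx
      rw [this]
      ring)
    (fun a v u => by
      rw [smul_eq_mul, Finset.mul_sum]
      refine Finset.sum_congr rfl fun e _ => ?_
      rw [← integral_const_mul]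
      refine integral_congr_ae ?_
      filter_upwards [Lp.coeFn_smul a (u.1.2 e)] with x hx
      have : (a • u).1.2 e x = a * u.1.2 e x := hx
      rw [this]
      ring)

omit [Fintype E] in
variable {G} in
theorem integrable_mul_mul_sobolev (β : C(I, ℝ)) (u v : G.sobolev) (e : E) :
    Integrable (fun x => β x * (u.1.1 e x * v.1.1 e x)) :=
  (β.continuous.mul ((sobolev_continuous u e).mul (sobolev_continuous v e))).integrable_unitInterval

/-- The form `∑ ∫ β u v`. -/
noncomputable def massForm (β : E → C(I, ℝ)) : BilinForm ℝ G.sobolev :=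
  LinearMap.mk₂ ℝ (fun u v => ∑ e, ∫ x, β e x * (u.1.1 e x * v.1.1 e x))
    (fun u u' v => by
      rw [← Finset.sum_add_distrib]
      refine Finset.sum_congr rfl fun e _ => ?_
      rw [← integral_add (integrable_mul_mul_sobolev _ _ _ _) (integrable_mul_mul_sobolev _ _ _ _)]
      refine integral_congr_ae (Eventually.of_forall fun x => ?_)
      have : (u + u').1.1 e x = u.1.1 e x + u'.1.1 e x := rfl
      simp only [this]
      ring)
    (fun a u v => by
      rw [smul_eq_mul, Finset.mul_sum]
      refine Finset.sum_congr rfl fun e _ => ?_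
      rw [← integral_const_mul]
      refine integral_congr_ae (Eventually.of_forall fun x => ?_)
      have : (a • u).1.1 e x = a * u.1.1 e x := rfl
      simp only [this]
      ring)
    (fun v u u' => by
      rw [← Finset.sum_add_distrib]
      refine Finset.sum_congr rfl fun e _ => ?_
      rw [← integral_add (integrable_mul_mul_sobolev _ _ _ _) (integrable_mul_mul_sobolev _ _ _ _)]
      refine integral_congr_ae (Eventually.of_forall fun x => ?_)
      have : (u + u').1.1 e x = u.1.1 e x + u'.1.1 e x := rfl
      simp only [this]
      ring)
    (fun a v u => by
      rw [smul_eq_mul, Finset.mul_sum]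
      refine Finset.sum_congr rfl fun e _ => ?_
      rw [← integral_const_mul]
      refine integral_congr_ae (Eventually.of_forall fun x => ?_)
      have : (a • u).1.1 e x = a * u.1.1 e x := rfl
      simp only [this]
      ring)

variable {G}

theorem derivForm_apply (α : E → C(I, ℝ)) (u v : G.sobolev) :
    G.derivForm α u v = ∑ e, ∫ x, α e x * (u.1.2 e x * v.1.2 e x) := rfl

theorem massForm_apply (β : E → C(I, ℝ)) (u v : G.sobolev) :
    G.massForm β u v = ∑ e, ∫ x, β e x * (u.1.1 e x * v.1.1 e x) := rfl

theorem derivForm_symm (α : E → C(I, ℝ)) (u v : G.sobolev) :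
    G.derivForm α u v = G.derivForm α v u := by
  simp only [derivForm_apply, mul_comm (u.1.2 _ _)]

theorem massForm_symm (β : E → C(I, ℝ)) (u v : G.sobolev) :
    G.massForm β u v = G.massForm β v u := by
  simp only [massForm_apply, mul_comm (u.1.1 _ _)]

theorem derivForm_add (α α' : E → C(I, ℝ)) :
    G.derivForm (α + α') = G.derivForm α + G.derivForm α' := by
  ext u v
  simp only [derivForm_apply, LinearMap.add_apply, ← Finset.sum_add_distrib]
  refine Finset.sum_congr rfl fun e _ => ?_
  rw [← integral_add (integrable_mul_mul_of_L2 _ _ _) (integrable_mul_mul_of_L2 _ _ _)]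
  simp [add_mul]

theorem derivForm_smul (a : ℝ) (α : E → C(I, ℝ)) :
    G.derivForm (a • α) = a • G.derivForm α := by
  ext u v
  simp only [derivForm_apply, LinearMap.smul_apply, smul_eq_mul, Finset.mul_sum,
    ← integral_const_mul]
  simp [mul_assoc]

theorem massForm_add (α α' : E → C(I, ℝ)) :
    G.massForm (α + α') = G.massForm α + G.massForm α' := by
  ext u v
  simp only [massForm_apply, LinearMap.add_apply, ← Finset.sum_add_distrib]
  refine Finset.sum_congr rfl fun e _ => ?_
  rw [← integral_add (integrable_mul_mul_sobolev _ _ _ _) (integrable_mul_mul_sobolev _ _ _ _)]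
  simp [add_mul]

theorem massForm_smul (a : ℝ) (α : E → C(I, ℝ)) :
    G.massForm (a • α) = a • G.massForm α := by
  ext u v
  simp only [massForm_apply, LinearMap.smul_apply, smul_eq_mul, Finset.mul_sum,
    ← integral_const_mul]
  simp [mul_assoc]

theorem derivForm_mono {α α' : E → C(I, ℝ)} (h : ∀ e x, α e x ≤ α' e x) (u : G.sobolev) :
    G.derivForm α u u ≤ G.derivForm α' u u := by
  simp only [derivForm_apply]
  refine Finset.sum_le_sum fun e _ => integral_mono (integrable_mul_mul_of_L2 _ _ _)
    (integrable_mul_mul_of_L2 _ _ _) fun x => ?_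
  exact mul_le_mul_of_nonneg_right (h e x) (mul_self_nonneg _)

theorem massForm_mono {α α' : E → C(I, ℝ)} (h : ∀ e x, α e x ≤ α' e x) (u : G.sobolev) :
    G.massForm α u u ≤ G.massForm α' u u := by
  simp only [massForm_apply]
  refine Finset.sum_le_sum fun e _ => integral_mono (integrable_mul_mul_sobolev _ _ _ _)
    (integrable_mul_mul_sobolev _ _ _ _) fun x => ?_
  exact mul_le_mul_of_nonneg_right (h e x) (mul_self_nonneg _)

theorem abs_derivForm_le {α : E → C(I, ℝ)} {C : ℝ} (h : ∀ e x, |α e x| ≤ C) (u : G.sobolev) :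
    |G.derivForm α u u| ≤ C * G.derivForm 1 u u := by
  have h1 := derivForm_mono (α := α) (α' := C • 1)
    (fun e x => by simpa using (abs_le.1 (h e x)).2) u
  have h2 := derivForm_mono (α := (-C) • 1) (α' := α)
    (fun e x => by simpa using (abs_le.1 (h e x)).1) u
  rw [derivForm_smul] at h1 h2
  simp only [LinearMap.smul_apply, smul_eq_mul] at h1 h2
  rw [abs_le]
  constructor <;> linarith

theorem abs_massForm_le {α : E → C(I, ℝ)} {C : ℝ} (h : ∀ e x, |α e x| ≤ C) (u : G.sobolev) :
    |G.massForm α u u| ≤ C * G.massForm 1 u u := by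
  have h1 := massForm_mono (α := α) (α' := C • 1)
    (fun e x => by simpa using (abs_le.1 (h e x)).2) u
  have h2 := massForm_mono (α := (-C) • 1) (α' := α)
    (fun e x => by simpa using (abs_le.1 (h e x)).1) u
  rw [massForm_smul] at h1 h2
  simp only [LinearMap.smul_apply, smul_eq_mul] at h1 h2
  rw [abs_le]
  constructor <;> linarith

theorem derivForm_nonneg {α : E → C(I, ℝ)} (h : ∀ e x, 0 ≤ α e x) (u : G.sobolev) :
    0 ≤ G.derivForm α u u := by
  rw [derivForm_apply]
  exact Finset.sum_nonneg fun e _ => integral_nonneg fun x => mul_nonneg (h e x) (mul_self_nonneg _)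

theorem massForm_nonneg {α : E → C(I, ℝ)} (h : ∀ e x, 0 ≤ α e x) (u : G.sobolev) :
    0 ≤ G.massForm α u u := by
  rw [massForm_apply]
  exact Finset.sum_nonneg fun e _ => integral_nonneg fun x => mul_nonneg (h e x) (mul_self_nonneg _)

theorem massForm_pos {β : E → C(I, ℝ)} (h : ∀ e x, 0 < β e x) (u : G.sobolev) (hu : u ≠ 0) :
    0 < G.massForm β u u := by
  apply lt_of_le_of_ne (massForm_nonneg (fun e x => (h e x).le) u)
  intro h0
  apply hu
  apply sobolev_ext
  rw [massForm_apply] at h0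
  have h1 := (Finset.sum_eq_zero_iff_of_nonneg fun e _ => integral_nonneg fun x =>
    mul_nonneg (h e x).le (mul_self_nonneg (u.1.1 e x))).1 h0.symm
  funext e
  have h2 := h1 e (Finset.mem_univ _)
  rw [integral_eq_zero_iff_of_nonneg (fun x => mul_nonneg (h e x).le (mul_self_nonneg _))
    (integrable_mul_mul_sobolev _ _ _ _)] at h2
  have hc : Continuous fun x => β e x * (u.1.1 e x * u.1.1 e x) :=
    (β e).continuous.mul ((sobolev_continuous u e).mul (sobolev_continuous u e))
  have h3 := (hc.ae_eq_iff_eq volume continuous_zero).1 h2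
  funext x
  have h4 := congrFun h3 x
  simp only [Pi.zero_apply, mul_eq_zero, (h e x).ne', false_or, or_self] at h4
  exact h4

variable (G) in
/-- The squared norm of `W^{1,2}`. -/
noncomputable def energyForm : BilinForm ℝ G.sobolev := G.derivForm 1 + G.massForm 1

theorem energyForm_symm (u v : G.sobolev) : G.energyForm u v = G.energyForm v u := by
  simp [energyForm, derivForm_symm _ u v, massForm_symm _ u v]

theorem energyForm_pos (u : G.sobolev) (hu : u ≠ 0) : 0 < G.energyForm u u := by
  have h1 := derivForm_nonneg (G := G) (α := 1) (by simp) u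
  have h2 := massForm_pos (G := G) (β := 1) (by simp) u hu
  simp only [energyForm, LinearMap.add_apply]
  linarith

theorem energyForm_nonneg (u : G.sobolev) : 0 ≤ G.energyForm u u := by
  by_cases hu : u = 0
  · simp [hu]
  · exact (energyForm_pos u hu).le

theorem abs_derivForm_le_energy {α : E → C(I, ℝ)} {C : ℝ} (hC : 0 ≤ C)
    (h : ∀ e x, |α e x| ≤ C) (u : G.sobolev) :
    |G.derivForm α u u| ≤ C * G.energyForm u u := by
  refine (abs_derivForm_le h u).trans (mul_le_mul_of_nonneg_left ?_ hC)
  have := massForm_nonneg (G := G) (α := 1) (by simp) u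
  simp only [energyForm, LinearMap.add_apply]
  linarith

theorem abs_massForm_le_energy {α : E → C(I, ℝ)} {C : ℝ} (hC : 0 ≤ C)
    (h : ∀ e x, |α e x| ≤ C) (u : G.sobolev) :
    |G.massForm α u u| ≤ C * G.energyForm u u := by
  refine (abs_massForm_le h u).trans (mul_le_mul_of_nonneg_left ?_ hC)
  have := derivForm_nonneg (G := G) (α := 1) (by simp) u
  simp only [energyForm, LinearMap.add_apply]
  linarith

theorem exists_weight_bound (α : E → C(I, ℝ)) : ∃ C, 0 ≤ C ∧ ∀ e x, |α e x| ≤ C :=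
  ⟨‖α‖, norm_nonneg _, fun e x => ((α e).norm_coe_le_norm x).trans (norm_le_pi_norm α e)⟩

theorem exists_weight_lower_bound {α : E → C(I, ℝ)} (h : ∀ e x, 0 < α e x) :
    ∃ a > 0, ∀ e x, a ≤ α e x := by
  have : ∀ e, ∃ a > 0, ∀ x, a ≤ α e x := by
    intro e
    obtain ⟨x₀, -, hx₀⟩ := isCompact_univ.exists_isMinOn univ_nonempty (α e).continuous.continuousOn
    exact ⟨α e x₀, h e x₀, fun x => hx₀ (mem_univ x)⟩
  choose a ha hax using this
  by_cases hE : Nonempty E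
  · obtain ⟨e₀, -, he₀⟩ := Finset.exists_min_image Finset.univ a Finset.univ_nonempty
    exact ⟨a e₀, ha e₀, fun e x => (he₀ e (Finset.mem_univ _)).trans (hax e x)⟩
  · exact ⟨1, one_pos, fun e => (hE ⟨e⟩).elim⟩

end EdgeGraph

/-! ### Functions vanishing on a fine grid, and the splitting of the pencil -/

/-- Lax-Milgram for a bilinear form pulled back to a Hilbert space. -/
theorem FormPencil.exists_projection {X H : Type*} [NormedAddCommGroup X] [InnerProductSpace ℝ X]
    [CompleteSpace X] [AddCommGroup H] [Module ℝ H] (Q : BilinForm ℝ H) (J : X →ₗ[ℝ] H) {c C : ℝ}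
    (hc : 0 < c) (hcoer : ∀ x, c * ‖x‖ ^ 2 ≤ Q (J x) (J x))
    (hbd : ∀ x y, |Q (J x) (J y)| ≤ C * ‖x‖ * ‖y‖) (u : H) {K : ℝ}
    (hu : ∀ x, |Q u (J x)| ≤ K * ‖x‖) : ∃ y, ∀ x, Q (J y) (J x) = Q u (J x) := by
  let B : X →L[ℝ] X →L[ℝ] ℝ := LinearMap.mkContinuous₂ (Q.compl₁₂ J J) C hbd
  have hB : IsCoercive B := ⟨c, hc, fun x => by
    rw [mul_assoc, ← sq]
    exact hcoer x⟩
  let ℓ : X →L[ℝ] ℝ := LinearMap.mkContinuous (Q u ∘ₗ J) K hu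
  refine ⟨hB.continuousLinearEquivOfBilin.symm ((InnerProductSpace.toDual ℝ _).symm ℓ),
    fun x => ?_⟩
  have h1 := hB.continuousLinearEquivOfBilin_apply
    (hB.continuousLinearEquivOfBilin.symm ((InnerProductSpace.toDual ℝ _).symm ℓ)) x
  rw [ContinuousLinearEquiv.apply_symm_apply, InnerProductSpace.toDual_symm_apply] at h1
  exact h1.symm

namespace EdgeGraph

open FormPencil

/-- The points `j / n`, `0 ≤ j ≤ n`, of the unit interval. -/
noncomputable def gridPoint (n : ℕ) (j : Fin (n + 1)) : I :=
  ⟨(j : ℝ) / n, by positivity, div_le_one_of_le₀ (by exact_mod_cast Nat.lt_succ_iff.1 j.2)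
    (by positivity)⟩

theorem exists_gridPoint_near {n : ℕ} (hn : 0 < n) (x : I) :
    ∃ j, |(x : ℝ) - gridPoint n j| ≤ 1 / n := by
  have hn' : (0 : ℝ) < n := by exact_mod_cast hn
  have hx0 : 0 ≤ (n : ℝ) * x := mul_nonneg hn'.le x.2.1
  have hle : ⌊(n : ℝ) * x⌋₊ ≤ n := by
    apply Nat.floor_le_of_le
    nlinarith [x.2.2]
  refine ⟨⟨⌊(n : ℝ) * x⌋₊, Nat.lt_succ_of_le hle⟩, ?_⟩
  have h1 := Nat.floor_le hx0
  have h2 := Nat.lt_floor_add_one ((n : ℝ) * x)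
  simp only [gridPoint]
  have e : (x : ℝ) - (⌊(n : ℝ) * x⌋₊ : ℝ) / n = ((n : ℝ) * x - ⌊(n : ℝ) * x⌋₊) / n := by
    field_simp
  rw [e, abs_of_nonneg (div_nonneg (by linarith) hn'.le)]
  exact div_le_div_of_nonneg_right (by linarith) hn'.le

theorem gridPoint_zero (n : ℕ) : gridPoint n 0 = 0 := by
  simp [gridPoint]

theorem gridPoint_last {n : ℕ} (hn : 0 < n) : gridPoint n (Fin.last n) = 1 := by
  have : (n : ℝ) ≠ 0 := by exact_mod_cast hn.ne'
  simp [gridPoint, this]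

variable {V E : Type*} [Fintype E] (G : EdgeGraph V E)

/-- Evaluation at all grid points of all edges. -/
noncomputable def gridEval (n : ℕ) : G.sobolev →ₗ[ℝ] (E × Fin (n + 1) → ℝ) where
  toFun u i := u.1.1 i.1 (gridPoint n i.2)
  map_add' _ _ := rfl
  map_smul' _ _ := rfl

/-- Families of `L²` functions whose primitives vanish at all grid points. -/
noncomputable def gridSpace (E : Type*) [Fintype E] (n : ℕ) :
    Submodule ℝ (PiLp 2 fun _ : E => Lp ℝ 2 (volume : Measure I)) :=
  ⨅ i : E × Fin (n + 1), LinearMap.ker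
    ((innerSL ℝ (indicatorConstLp 2 (measurableSet_Iic (a := gridPoint n i.2))
      (measure_ne_top volume _) (1 : ℝ))).comp
      (PiLp.proj 2 (𝕜 := ℝ) (fun _ : E => Lp ℝ 2 (volume : Measure I)) i.1)).toLinearMap

theorem mem_gridSpace {n : ℕ} {w : PiLp 2 fun _ : E => Lp ℝ 2 (volume : Measure I)} :
    w ∈ gridSpace E n ↔ ∀ e j, ∫ s in Iic (gridPoint n j), w e s = 0 := by
  simp only [gridSpace, Submodule.mem_iInf, LinearMap.mem_ker, Prod.forall,
    setIntegral_eq_inner _ measurableSet_Iic]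
  rfl

instance (n : ℕ) : CompleteSpace (gridSpace E n) := by
  have : IsClosed (gridSpace E n : Set (PiLp 2 fun _ : E => Lp ℝ 2 (volume : Measure I))) := by
    rw [gridSpace, Submodule.coe_iInf]
    exact isClosed_iInter fun i => ContinuousLinearMap.isClosed_ker _
  exact this.completeSpace_coe

/-- Passage to primitives. -/
noncomputable def gridPrimitive {n : ℕ} (hn : 0 < n) : gridSpace E n →ₗ[ℝ] G.sobolev where
  toFun w := ⟨(fun e x => ∫ s in Iic x, w.1 e s, fun e => w.1 e), by
    refine ⟨⟨0, fun e => ⟨?_, ?_⟩⟩, fun e x => ?_⟩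
    · simp
    · simpa [gridPoint_last hn] using mem_gridSpace.1 w.2 e (Fin.last n)
    · simp only [setIntegral_Iic_zero, zero_add]⟩
  map_add' w w' := by
    refine Subtype.ext (Prod.ext ?_ rfl)
    funext e x
    have hi : ∀ w : Lp ℝ 2 (volume : Measure I), IntegrableOn w (Set.Iic x) := fun w =>
      (L2_integrable w).integrableOn
    change ∫ s in Iic x, (w.1 e + w'.1 e : Lp ℝ 2 (volume : Measure I)) s
      = (∫ s in Iic x, w.1 e s) + ∫ s in Iic x, w'.1 e s
    rw [← integral_add (hi _) (hi _)]
    exact integral_congr_ae (ae_restrict_of_ae (Lp.coeFn_add _ _))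
  map_smul' a w := by
    refine Subtype.ext (Prod.ext ?_ rfl)
    funext e x
    change ∫ s in Iic x, (a • w.1 e : Lp ℝ 2 (volume : Measure I)) s = a * ∫ s in Iic x, w.1 e s
    rw [← integral_const_mul]
    exact integral_congr_ae (ae_restrict_of_ae (Lp.coeFn_smul _ _))

variable {G}

theorem gridEval_gridPrimitive {n : ℕ} (hn : 0 < n) (w : gridSpace E n) :
    G.gridEval n (G.gridPrimitive hn w) = 0 := by
  funext i
  exact mem_gridSpace.1 w.2 i.1 i.2

theorem exists_gridPrimitive_eq {n : ℕ} (hn : 0 < n) {z : G.sobolev} (hz : G.gridEval n z = 0) :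
    ∃ w, G.gridPrimitive hn w = z := by
  have hz' : ∀ e j, z.1.1 e (gridPoint n j) = 0 := fun e j => congrFun hz (e, j)
  have h0 : ∀ e, z.1.1 e 0 = 0 := fun e => by simpa [gridPoint_zero] using hz' e 0
  have hp : ∀ e x, ∫ s in Iic x, z.1.2 e s = z.1.1 e x := fun e x => by
    rw [sobolev_apply z e x, h0, zero_add]
  refine ⟨⟨WithLp.toLp 2 z.1.2, mem_gridSpace.2 fun e j => ?_⟩, ?_⟩
  · exact (hp e _).trans (hz' e j)
  · refine Subtype.ext (Prod.ext ?_ rfl)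
    funext e x
    exact hp e x

theorem derivForm_one_eq (u : G.sobolev) : G.derivForm 1 u u = ∑ e, ‖u.1.2 e‖ ^ 2 := by
  rw [derivForm_apply]
  refine Finset.sum_congr rfl fun e _ => ?_
  rw [← integral_sq_eq_norm_sq]
  simp [sq]

/-- A function vanishing at all grid points is small compared to its derivative. -/
theorem massForm_le_of_gridEval_eq_zero {n : ℕ} (hn : 0 < n) {z : G.sobolev}
    (hz : G.gridEval n z = 0) : G.massForm 1 z z ≤ 1 / n * G.derivForm 1 z z := by
  rw [derivForm_one_eq, massForm_apply, Finset.mul_sum]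
  refine Finset.sum_le_sum fun e _ => ?_
  have hb : ∀ x, (1 : E → C(I, ℝ)) e x * (z.1.1 e x * z.1.1 e x) ≤ 1 / n * ‖z.1.2 e‖ ^ 2 := by
    intro x
    obtain ⟨j, hj⟩ := exists_gridPoint_near hn x
    have h := sobolev_sub_sq_le z e x (gridPoint n j)
    have hzj : z.1.1 e (gridPoint n j) = 0 := congrFun hz (e, j)
    rw [hzj, sub_zero] at h
    simp only [Pi.one_apply, ContinuousMap.one_apply, one_mul, ← sq]
    exact h.trans (mul_le_mul_of_nonneg_right hj (sq_nonneg _))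
  calc _ ≤ ∫ _ : I, 1 / (n : ℝ) * ‖z.1.2 e‖ ^ 2 :=
        integral_mono (integrable_mul_mul_sobolev _ _ _ _) (integrable_const _) hb
    _ = _ := by simp

theorem derivForm_gridPrimitive {n : ℕ} (hn : 0 < n) (w : gridSpace E n) :
    G.derivForm 1 (G.gridPrimitive hn w) (G.gridPrimitive hn w) = ‖w‖ ^ 2 := by
  rw [derivForm_one_eq]
  change _ = ‖w.1‖ ^ 2
  rw [PiLp.norm_sq_eq_of_L2]
  rfl

/-- The pencil `D_α - l M_β` splits the Sobolev space. -/
theorem exists_isSplitting {α : E → C(I, ℝ)} (hα : ∀ e x, 0 < α e x) (β : E → C(I, ℝ)) (l : ℝ) :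
    ∃ Wm Wp, IsSplitting (G.derivForm α - l • G.massForm β) G.energyForm Wm Wp := by
  set Q := G.derivForm α - l • G.massForm β with hQdef
  have hQ : ∀ u v, Q u v = Q v u := fun u v => by
    simp [hQdef, derivForm_symm α u v, massForm_symm β u v]
  obtain ⟨a, ha, haα⟩ := exists_weight_lower_bound hα
  obtain ⟨Ca, hCa, hα'⟩ := exists_weight_bound α
  obtain ⟨Cb, hCb, hβ'⟩ := exists_weight_bound β
  have hQb : ∀ u, |Q u u| ≤ (Ca + |l| * Cb) * G.energyForm u u := fun u => by
    simp only [hQdef, LinearMap.sub_apply, LinearMap.smul_apply, smul_eq_mul]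
    refine (abs_sub _ _).trans ?_
    rw [abs_mul, add_mul, mul_assoc]
    exact add_le_add (abs_derivForm_le_energy hCa hα' u)
      (mul_le_mul_of_nonneg_left (abs_massForm_le_energy hCb hβ' u) (abs_nonneg _))
  -- On functions vanishing at the grid points the mass is at most `1 / n` times the Dirichlet
  -- energy. This `n` makes `l M_β` cost at most half of the lower bound `a` of `D_α`.
  obtain ⟨n, hn⟩ := exists_nat_gt (max 1 (2 * (|l| * Cb) / a))
  have hn1 : (1 : ℝ) < n := (le_max_left _ _).trans_lt hn
  have hn0 : 0 < n := by
    have : (0 : ℝ) < n := by linarith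
    exact_mod_cast this
  have hn2 : |l| * Cb * (1 / n) ≤ a / 2 := by
    have h1 := (le_max_right _ _).trans_lt hn
    rw [div_lt_iff₀ ha] at h1
    rw [mul_one_div, div_le_iff₀ (by linarith)]
    linarith
  have hcoer : ∀ z : G.sobolev, G.gridEval n z = 0 → a / 2 * G.derivForm 1 z z ≤ Q z z := by
    intro z hz
    have h1 := massForm_le_of_gridEval_eq_zero hn0 hz
    have h2 : a * G.derivForm 1 z z ≤ G.derivForm α z z := by
      have := derivForm_mono (G := G) (α := a • 1) (α' := α) (by simpa using haα) z
      rw [derivForm_smul] at this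
      simpa using this
    have h3 := abs_massForm_le hβ' z
    have h4 : l * G.massForm β z z ≤ |l| * (Cb * G.massForm 1 z z) :=
      (le_abs_self _).trans (by
        rw [abs_mul]
        exact mul_le_mul_of_nonneg_left h3 (abs_nonneg _))
    have h5 : |l| * (Cb * G.massForm 1 z z) ≤ |l| * (Cb * (1 / n * G.derivForm 1 z z)) := by
      gcongr
    have h6 : |l| * (Cb * (1 / n * G.derivForm 1 z z)) ≤ a / 2 * G.derivForm 1 z z := by
      rw [← mul_assoc, ← mul_assoc]
      exact mul_le_mul_of_nonneg_right hn2 (derivForm_nonneg (by simp) z)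
    simp only [hQdef, LinearMap.sub_apply, LinearMap.smul_apply, smul_eq_mul]
    linarith
  have henergy : ∀ z : G.sobolev, G.gridEval n z = 0 →
      G.energyForm z z ≤ 2 * G.derivForm 1 z z := by
    intro z hz
    have h1 := massForm_le_of_gridEval_eq_zero hn0 hz
    have h2 : 1 / (n : ℝ) * G.derivForm 1 z z ≤ 1 * G.derivForm 1 z z := by
      apply mul_le_mul_of_nonneg_right _ (derivForm_nonneg (by simp) z)
      rw [div_le_one (by linarith)]
      exact hn1.le
    simp only [energyForm, LinearMap.add_apply]
    linarith
  have hcross := abs_le_sqrt_mul_sqrt Q G.energyForm hQ energyForm_symm energyForm_pos hQb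
  set J := G.gridPrimitive hn0 with hJ
  have hJn : ∀ w, √(G.energyForm (J w) (J w)) ≤ √2 * ‖w‖ := by
    intro w
    have h1 := henergy _ (gridEval_gridPrimitive hn0 w)
    rw [derivForm_gridPrimitive] at h1
    calc _ ≤ √(2 * ‖w‖ ^ 2) := Real.sqrt_le_sqrt h1
      _ = _ := by rw [Real.sqrt_mul zero_le_two, Real.sqrt_sq (norm_nonneg _)]
  have hCnn : 0 ≤ Ca + |l| * Cb := by positivity
  -- Lax-Milgram is applied to derivatives, which fill a closed subspace of a finite sum of `L²`
  -- spaces; `J` identifies it with the functions vanishing on the grid.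
  have hproj : ∀ u, ∃ z ∈ LinearMap.ker (G.gridEval n),
      ∀ v ∈ LinearMap.ker (G.gridEval n), Q (u - z) v = 0 := by
    intro u
    obtain ⟨y, hy⟩ := exists_projection Q J (c := a / 2) (C := (Ca + |l| * Cb) * 2)
      (by positivity)
      (fun w => by
        have := hcoer _ (gridEval_gridPrimitive hn0 w)
        rwa [derivForm_gridPrimitive] at this)
      (fun w w' => by
        refine (hcross _ _).trans ?_
        have := mul_le_mul (hJn w) (hJn w') (Real.sqrt_nonneg _) (by positivity)
        calc _ ≤ (Ca + |l| * Cb) * (√2 * ‖w‖ * (√2 * ‖w'‖)) := mul_le_mul_of_nonneg_left this hCnn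
          _ = (Ca + |l| * Cb) * (√2 ^ 2) * ‖w‖ * ‖w'‖ := by ring
          _ = _ := by rw [Real.sq_sqrt zero_le_two])
      u (K := (Ca + |l| * Cb) * √(G.energyForm u u) * √2)
      (fun w => by
        refine (hcross _ _).trans ?_
        have := mul_le_mul_of_nonneg_left (hJn w) (Real.sqrt_nonneg (G.energyForm u u))
        calc _ ≤ (Ca + |l| * Cb) * (√(G.energyForm u u) * (√2 * ‖w‖)) :=
              mul_le_mul_of_nonneg_left this hCnn
          _ = _ := by ring)
    refine ⟨J y, gridEval_gridPrimitive hn0 y, fun v hv => ?_⟩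
    obtain ⟨w, rfl⟩ := exists_gridPrimitive_eq hn0 hv
    rw [map_sub, LinearMap.sub_apply, hy w, sub_self]
  -- The constant `a / 4` combines the coercivity constant `a / 2` with the bound of the energy form
  -- by twice the Dirichlet form.
  obtain ⟨Wm, Wp, h1, h2, h3, h4, h5, h6⟩ := exists_decomposition Q G.energyForm hQ energyForm_symm
    energyForm_pos (LinearMap.ker (G.gridEval n)) (δ := a / 4) (by positivity)
    (fun z hz => by
      have e1 := hcoer z hz
      have e2 := henergy z hz
      nlinarith) hproj (G.gridEval n) le_rfl
  exact ⟨Wm, Wp, h1, h2, h3, h4, h5, h6⟩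


end EdgeGraph

/-! ### Fundamental theorem, integration by parts, and infinite dimension of the Sobolev space -/

theorem setIntegral_Iic_coe (f : ℝ → ℝ) (x : I) :
    ∫ s : I in Iic x, f s = ∫ t in (0 : ℝ)..x, f t := by
  have h := unitInterval.measurePreserving_coe.setIntegral_preimage_emb
    unitInterval.measurableEmbedding_coe f (Iic (x : ℝ))
  have h1 : ((↑) : I → ℝ) ⁻¹' Iic (x : ℝ) = Iic x := rfl
  rw [h1] at h
  rw [h, Measure.restrict_restrict measurableSet_Iic, intervalIntegral.integral_of_le x.2.1,
    ← integral_Icc_eq_integral_Ioc]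
  congr 2
  ext t
  simp only [mem_inter_iff, mem_Iic, mem_Icc]
  have := x.2.2
  constructor
  · rintro ⟨h1, h2, h3⟩
    exact ⟨h2, h1⟩
  · rintro ⟨h1, h2⟩
    exact ⟨h2, h1, h2.trans this⟩

theorem setIntegral_Iic_deriv {F : ℝ → ℝ} (hF : ContDiff ℝ 1 F) (x : I) :
    ∫ s : I in Iic x, deriv F s = F x - F 0 := by
  rw [setIntegral_Iic_coe]
  exact intervalIntegral.integral_deriv_eq_sub
    (fun t _ => (hF.differentiable (by norm_num)).differentiableAt)
    ((hF.continuous_deriv le_rfl).intervalIntegrable _ _)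

theorem Iic_one_unitInterval : Iic (1 : I) = univ :=
  eq_univ_of_forall fun _ => unitInterval.le_one'

/-- A continuous function on `[0,1]` as an element of `L²`. -/
noncomputable def continuousToL2 (f : C(I, ℝ)) : Lp ℝ 2 (volume : Measure I) :=
  MemLp.toLp f (MemLp.of_bound f.continuous.aestronglyMeasurable ‖f‖
    (Eventually.of_forall fun x => f.norm_coe_le_norm x))

theorem coeFn_continuousToL2 (f : C(I, ℝ)) : (continuousToL2 f : I → ℝ) =ᵐ[volume] f :=
  MemLp.coeFn_toLp _

/-- Integration by parts for two absolutely continuous functions. -/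
theorem integral_mul_primitive_add {j w : I → ℝ} (hj : Integrable j) (hw : Integrable w) :
    (∫ x, (∫ s in Iic x, j s) * w x) + ∫ x, j x * ∫ s in Iic x, w s
      = (∫ x, j x) * ∫ x, w x := by
  have hS : MeasurableSet {p : I × I | p.2 ≤ p.1} :=
    measurableSet_le measurable_snd measurable_fst
  have hint : Integrable (fun p : I × I =>
      {p : I × I | p.2 ≤ p.1}.indicator (fun p => j p.1 * w p.2) p)
      ((volume : Measure I).prod volume) := (hj.mul_prod hw).indicator hS
  -- Fubini for `j x * w s` over the triangle `s ≤ x`.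
  have hswap := integral_integral_swap (f := fun x s : I =>
    {p : I × I | p.2 ≤ p.1}.indicator (fun p => j p.1 * w p.2) (x, s)) hint
  have h1 : ∀ x : I, ∫ s, {p : I × I | p.2 ≤ p.1}.indicator (fun p => j p.1 * w p.2) (x, s)
      = j x * ∫ s in Iic x, w s := by
    intro x
    rw [← integral_const_mul, ← integral_indicator measurableSet_Iic]
    rfl
  have h2 : ∀ s : I, ∫ x, {p : I × I | p.2 ≤ p.1}.indicator (fun p => j p.1 * w p.2) (x, s)
      = (∫ x in Ici s, j x) * w s := by
    intro s
    rw [← integral_mul_const, ← integral_indicator measurableSet_Ici]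
    rfl
  simp only [h1, h2] at hswap
  have h3 : ∀ x : I, (∫ s in Ici x, j s) = (∫ s, j s) - ∫ s in Iic x, j s := by
    intro x
    rw [integral_Ici_eq_integral_Ioi, ← compl_Iic, ← integral_add_compl measurableSet_Iic hj]
    ring
  have hint2 : Integrable (fun x => (∫ s in Iic x, j s) * w x) := by
    have hb : ∀ x, ‖∫ s in Iic x, j s‖ ≤ ∫ s, ‖j s‖ := fun x =>
      (norm_integral_le_integral_norm _).trans
        (setIntegral_le_integral hj.norm (Eventually.of_forall fun _ => norm_nonneg _))
    refine hw.bdd_mul (c := ∫ s, ‖j s‖) ?_ (Eventually.of_forall hb)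
    have : Integrable (fun p : I × I => {p : I × I | p.2 ≤ p.1}.indicator (fun p => j p.2) p)
        ((volume : Measure I).prod volume) :=
      (hj.comp_snd volume).indicator hS
    have h4 := this.integral_prod_left.aestronglyMeasurable
    refine h4.congr (Eventually.of_forall fun x => ?_)
    simp only
    rw [← integral_indicator measurableSet_Iic]
    rfl
  simp only [h3, sub_mul] at hswap
  rw [hswap, integral_sub (hw.const_mul _) hint2, integral_const_mul]
  ring

theorem FormPencil.exists_finrank_eq_of_not_finiteDimensional {H : Type*} [AddCommGroup H]
    [Module ℝ H] (h : ¬ FiniteDimensional ℝ H) (n : ℕ) :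
    ∃ S : Submodule ℝ H, Module.finrank ℝ S = n := by
  have h1 : Cardinal.aleph0 ≤ Module.rank ℝ H := by
    by_contra! hlt
    exact h (Module.rank_lt_aleph0_iff.1 hlt)
  obtain ⟨s, hs, hli⟩ := le_rank_iff_exists_linearIndependent_finset.1
    ((Cardinal.natCast_lt_aleph0 (n := n)).le.trans h1)
  exact ⟨Submodule.span ℝ (s : Set H), by rw [finrank_span_finset_eq_card hli, hs]⟩

namespace EdgeGraph

open FormPencil

variable {V E : Type*} (G : EdgeGraph V E)

/-- A function that is `C¹` on every edge and continuous on the graph, as an element of the Sobolev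
space. -/
noncomputable def ofContDiff (F : E → ℝ → ℝ) (hF : ∀ e, ContDiff ℝ 1 (F e))
    (hm : G.MatchesAtVertices fun e x => F e x) : G.sobolev :=
  ⟨(fun e x => F e x, fun e => continuousToL2
    ⟨fun x : I => deriv (F e) x, ((hF e).continuous_deriv le_rfl).comp continuous_subtype_val⟩),
    hm, fun e x => by
      have : ∫ s in Iic x, continuousToL2 ⟨fun x : I => deriv (F e) x,
          ((hF e).continuous_deriv le_rfl).comp continuous_subtype_val⟩ s
          = ∫ s : I in Iic x, deriv (F e) s :=
        integral_congr_ae (ae_restrict_of_ae (coeFn_continuousToL2 _))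
      simp only [this, setIntegral_Iic_deriv (hF e)]
      simp⟩

variable {G}

theorem ofContDiff_fst {F : E → ℝ → ℝ} (hF : ∀ e, ContDiff ℝ 1 (F e))
    (hm : G.MatchesAtVertices fun e x => F e x) (e : E) (x : I) :
    (G.ofContDiff F hF hm).1.1 e x = F e x := rfl

theorem ofContDiff_snd {F : E → ℝ → ℝ} (hF : ∀ e, ContDiff ℝ 1 (F e))
    (hm : G.MatchesAtVertices fun e x => F e x) (e : E) :
    ((G.ofContDiff F hF hm).1.2 e : I → ℝ) =ᵐ[volume] fun x : I => deriv (F e) x :=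
  coeFn_continuousToL2 _

variable [Fintype E]

/-- The Sobolev space of a graph with an edge is infinite dimensional. -/
theorem exists_finrank_eq (e₀ : E) (n : ℕ) :
    ∃ S : Submodule ℝ G.sobolev, Module.finrank ℝ S = n := by
  classical
  refine exists_finrank_eq_of_not_finiteDimensional (fun hfin => ?_) n
  -- In finite dimension the mass would dominate a multiple `η` of the Dirichlet energy. The
  -- function `sin (m π x)` on one edge contradicts this: it vanishes at the points `j / m`, so its
  -- mass is at most `1 / m < η` times its energy.
  obtain ⟨η, hη, hle⟩ := exists_pos_mul_le (G.massForm 1) (G.derivForm 1)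
    (fun u hu => massForm_pos (by simp) u hu)
  obtain ⟨m, hm⟩ := exists_nat_gt (1 / η)
  have hm0 : (0 : ℝ) < m := (one_div_pos.2 hη).trans hm
  have hm1 : 1 / (m : ℝ) < η := by
    rw [div_lt_comm₀ hη hm0] at hm
    exact hm
  let F : E → ℝ → ℝ := fun e x => if e = e₀ then Real.sin (m * Real.pi * x) else 0
  have hF : ∀ e, ContDiff ℝ 1 (F e) := by
    intro e
    by_cases h : e = e₀
    · simp only [F, h, if_true]
      fun_prop
    · simp only [F, h, if_false]
      fun_prop
  have hgrid : ∀ e j, F e (gridPoint m j) = 0 := by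
    intro e j
    by_cases h : e = e₀
    · have : (m : ℝ) * Real.pi * ((j : ℝ) / m) = (j : ℕ) * Real.pi := by
        field_simp
      simp [F, h, gridPoint, this, Real.sin_nat_mul_pi]
    · simp [F, h]
  have hmat : G.MatchesAtVertices fun e x => F e x := by
    refine ⟨0, fun e => ⟨?_, ?_⟩⟩
    · simpa [gridPoint_zero] using hgrid e 0
    · simpa [gridPoint_last (by exact_mod_cast hm0 : 0 < m)] using hgrid e (Fin.last m)
  set u := G.ofContDiff F hF hmat
  have hu : G.gridEval m u = 0 := by
    funext i
    exact hgrid i.1 i.2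
  have hu0 : u ≠ 0 := by
    intro h
    have h1 : u.1.1 e₀ ⟨1 / (2 * m), by positivity, by
        rw [div_le_one (by positivity)]
        have : (1 : ℝ) ≤ m := by exact_mod_cast hm0
        linarith⟩ = 0 := by rw [h]; rfl
    have h2 : Real.sin (m * Real.pi * (1 / (2 * m))) = 0 := by
      simpa [u, ofContDiff_fst, F] using h1
    have h3 : (m : ℝ) * Real.pi * (1 / (2 * m)) = Real.pi / 2 := by field_simp
    rw [h3, Real.sin_pi_div_two] at h2
    exact one_ne_zero h2
  have h1 := massForm_le_of_gridEval_eq_zero (by exact_mod_cast hm0 : 0 < m) hu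
  have h2 := hle u
  have h3 := massForm_pos (G := G) (β := 1) (by simp) u hu0
  have h4 := derivForm_nonneg (G := G) (α := 1) (by simp) u
  have h5 : 1 / (m : ℝ) * G.derivForm 1 u u ≤ η * G.derivForm 1 u u :=
    mul_le_mul_of_nonneg_right hm1.le h4
  have h6 : (η - 1 / m) * G.derivForm 1 u u = 0 := by linarith
  rcases mul_eq_zero.1 h6 with h | h
  · linarith
  · rw [h] at h1
    linarith

end EdgeGraph

/-! ### Eigenvalues as min-max values; positivity for index at least one -/

theorem FormPencil.finrank_le_one_of_injOn {H : Type*} [AddCommGroup H] [Module ℝ H]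
    (K : Submodule ℝ H) (T : H →ₗ[ℝ] ℝ) (h : ∀ u ∈ K, T u = 0 → u = 0) :
    Module.finrank ℝ K ≤ 1 := by
  have hT : Function.Injective (T ∘ₗ K.subtype) := (injective_iff_map_eq_zero _).2 fun u hu =>
    Subtype.ext (h u u.2 hu)
  simpa using LinearMap.finrank_le_finrank_of_injective hT

namespace EdgeGraph

open FormPencil

variable {V E : Type*} {G : EdgeGraph V E} [Fintype E]

/-- The eigenvalues are the min-max values of the Dirichlet form against the weighted mass form. -/
theorem eigenvalue_eq_minmax {g ρ : EdgeFun E} {α β : E → C(I, ℝ)}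
    (hα : ∀ e x, α e x = (√(g e x))⁻¹) (hβ : ∀ e x, β e x = ρ e x * √(g e x))
    (hpos : ∀ e x, 0 < β e x) (k : ℕ) :
    G.eigenvalue g ρ k = minmax (G.derivForm α) (G.massForm β) k := by
  have hR : ∀ p : G.sobolev, rayleigh g ρ p = G.derivForm α p p / G.massForm β p p := by
    intro p
    simp only [rayleigh, derivForm_apply, massForm_apply, hα, hβ]
    congr 1
    · refine Finset.sum_congr rfl fun e _ => integral_congr_ae (Eventually.of_forall fun x => ?_)
      simp only
      ring
    · refine Finset.sum_congr rfl fun e _ => integral_congr_ae (Eventually.of_forall fun x => ?_)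
      simp only
      ring
  have hiff : ∀ (p : G.sobolev) (b : ℝ),
      (p ≠ 0 → rayleigh g ρ p ≤ b) ↔ G.derivForm α p p ≤ b * G.massForm β p p := by
    intro p b
    by_cases hp : p = 0
    · simp [hp]
    · rw [hR, div_le_iff₀ (massForm_pos hpos p hp)]
      simp [hp]
  unfold eigenvalue minmax
  congr 1
  ext b
  simp only [mem_ofPred_eq]
  constructor
  · rintro ⟨S, hS, hfr, hb⟩
    refine ⟨S.submoduleOf G.sobolev, ?_, fun p hp => ?_⟩
    · rw [← hfr]
      exact (Submodule.submoduleOfEquivOfLe hS).finrank_eq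
    · exact (hiff p b).1 fun hp0 => hb p hp (by simpa using hp0)
  · rintro ⟨S, hfr, hb⟩
    refine ⟨S.map G.sobolev.subtype, Submodule.map_subtype_le _ _, ?_, ?_⟩
    · rw [Submodule.finrank_map_subtype_eq, hfr]
    · rintro _ ⟨p, hp, rfl⟩ hp0
      exact (hiff p b).2 (hb p hp) fun h => hp0 (by simp [h])

theorem deriv_eq_zero_of_derivForm_eq_zero {α : E → C(I, ℝ)} (hα : ∀ e x, 0 < α e x)
    {u : G.sobolev} (h : G.derivForm α u u = 0) (e : E) : u.1.2 e = 0 := by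
  obtain ⟨a, ha, haα⟩ := exists_weight_lower_bound hα
  have h1 := derivForm_mono (G := G) (α := a • 1) (α' := α) (by simpa using haα) u
  rw [derivForm_smul, h, LinearMap.smul_apply, LinearMap.smul_apply, smul_eq_mul,
    derivForm_one_eq] at h1
  have h2 : ∑ e, ‖u.1.2 e‖ ^ 2 = 0 :=
    le_antisymm (by nlinarith) (Finset.sum_nonneg fun e _ => sq_nonneg _)
  have h3 := (Finset.sum_eq_zero_iff_of_nonneg fun e _ => sq_nonneg ‖u.1.2 e‖).1 h2 e
    (Finset.mem_univ _)
  simpa using h3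

/-- On a connected graph only the constants have vanishing Dirichlet energy. -/
theorem eq_zero_of_derivForm_eq_zero (hG : G.IsConnected) {α : E → C(I, ℝ)}
    (hα : ∀ e x, 0 < α e x) {u : G.sobolev} (h : G.derivForm α u u = 0) (e₀ : E)
    (h0 : u.1.1 e₀ 0 = 0) : u = 0 := by
  have hc : ∀ e x, u.1.1 e x = u.1.1 e 0 := by
    intro e x
    rw [sobolev_apply u e x, deriv_eq_zero_of_derivForm_eq_zero hα h e]
    have : ∫ s in Iic x, (0 : Lp ℝ 2 (volume : Measure I)) s = ∫ s : I in Iic x, (0 : ℝ) :=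
      integral_congr_ae (ae_restrict_of_ae (Lp.coeFn_zero _ _ _))
    rw [this]
    simp
  obtain ⟨φ, hφ⟩ := u.2.1
  have hconst : ∀ v w, φ v = φ w := by
    intro v w
    have := hG.2 v w
    induction this with
    | rel a b hab =>
      obtain ⟨e, rfl, rfl⟩ := hab
      rw [← (hφ e).1, ← (hφ e).2, hc e 1]
    | refl a => rfl
    | symm a b _ ih => exact ih.symm
    | trans a b c _ _ ih1 ih2 => exact ih1.trans ih2
  apply sobolev_ext
  funext e x
  rw [hc e x, (hφ e).1, hconst _ (G.src e₀), ← (hφ e₀).1, h0]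
  rfl

/-- If the value were `0`, the splitting at `l = 0` would have no negative part, so the radical of
the Dirichlet form would have dimension greater than `k ≥ 1`. On a connected graph that radical
contains only constants. -/
theorem minmax_pos (hG : G.IsConnected) (e₀ : E) {α β : E → C(I, ℝ)} (hα : ∀ e x, 0 < α e x)
    (hβ : ∀ e x, 0 < β e x) {k : ℕ} (hk : 1 ≤ k) :
    0 < minmax (G.derivForm α) (G.massForm β) k := by
  have hD : ∀ u, 0 ≤ G.derivForm α u u := fun u => derivForm_nonneg (fun e x => (hα e x).le) u
  have hM : ∀ u, u ≠ 0 → 0 < G.massForm β u u := fun u hu => massForm_pos hβ u hu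
  apply lt_of_le_of_ne (minmax_nonneg hD hM k)
  intro h0
  obtain ⟨Wm, Wp, hs⟩ := exists_isSplitting (G := G) hα β 0
  obtain ⟨C, hC, hCb⟩ := exists_weight_bound β
  have hdim := lt_finrank_sup_ker energyForm_nonneg hM
    ⟨C, abs_massForm_le_energy hC hCb⟩ (exists_finrank_eq e₀) hs h0.symm
  have hWm : Wm = ⊥ := by
    rw [Submodule.eq_bot_iff]
    intro u hu
    by_contra hne
    have := hs.neg u hu hne
    simp only [LinearMap.sub_apply, LinearMap.smul_apply, smul_eq_mul, zero_mul, sub_zero] at this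
    exact absurd (hD u) (not_le.2 this)
  rw [hWm, bot_sup_eq] at hdim
  have := hs.finite_ker
  have hker : ∀ u ∈ LinearMap.ker (G.derivForm α - (0 : ℝ) • G.massForm β),
      G.derivForm α u u = 0 := by
    intro u hu
    have := ker_apply hu u
    simpa using this
  let T : G.sobolev →ₗ[ℝ] ℝ :=
    { toFun := fun u => u.1.1 e₀ 0
      map_add' := fun _ _ => rfl
      map_smul' := fun _ _ => rfl }
  have := finrank_le_one_of_injOn (LinearMap.ker (G.derivForm α - (0 : ℝ) • G.massForm β)) T
    fun u hu hu0 => eq_zero_of_derivForm_eq_zero hG hα (hker u hu) e₀ hu0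
  omega

end EdgeGraph

/-! ### One-sided bounds for the product of a min-max value and a differentiable factor -/

section Product

variable {H : Type*} [AddCommGroup H] [Module ℝ H]

theorem HasDerivAt.eventually_add_mul_le {f : ℝ → ℝ} {f' κ : ℝ} (hf : HasDerivAt f f' 0)
    (h : κ < f') : ∀ᶠ t in 𝓝[>] (0 : ℝ), f 0 + κ * t ≤ f t := by
  have h1 := (hasDerivAt_iff_isLittleO.1 hf).def (sub_pos.2 h)
  filter_upwards [h1.filter_mono nhdsWithin_le_nhds, self_mem_nhdsWithin] with t ht (ht0 : 0 < t)
  simp only [sub_zero, smul_eq_mul, Real.norm_eq_abs, abs_of_pos ht0] at ht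
  have := (abs_le.1 ht).1
  nlinarith

theorem HasDerivAt.eventually_le_add_mul {f : ℝ → ℝ} {f' κ : ℝ} (hf : HasDerivAt f f' 0)
    (h : f' < κ) : ∀ᶠ t in 𝓝[>] (0 : ℝ), f t ≤ f 0 + κ * t := by
  have h1 := (hf.fun_neg).eventually_add_mul_le (neg_lt_neg h)
  filter_upwards [h1] with t ht
  linarith

namespace FormPencil.IsFormPath

variable {A : BilinForm ℝ H} {D M : ℝ → BilinForm ℝ H} {D' M' : BilinForm ℝ H}
  {Wm Wp P : Submodule ℝ H} {l κ N' : ℝ} {k : ℕ} {ν : ℝ → ℝ}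

theorem hasDerivAt_affine_mul (hν : HasDerivAt ν N' 0) (l c : ℝ) :
    HasDerivAt (fun t => (l + c * t) * ν t) (c * ν 0 + l * N') 0 := by
  have h1 : HasDerivAt (fun t : ℝ => l + c * t) c 0 := by
    simpa using ((hasDerivAt_id (0 : ℝ)).const_mul c).const_add l
  simpa using h1.fun_mul hν

theorem eventually_le_minmax_mul (h : IsFormPath A D M D' M')
    (hinf : ∀ n : ℕ, ∃ S : Submodule ℝ H, Module.finrank ℝ S = n)
    (hs : IsSplitting (D 0 - l • M 0) A Wm Wp) (hP : P ≤ LinearMap.ker (D 0 - l • M 0))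
    (hdim : Module.finrank ℝ ↥(Wm ⊔ LinearMap.ker (D 0 - l • M 0)) ≤ k + Module.finrank ℝ P)
    (hν : HasDerivAt ν N' 0) (hν0 : ∀ᶠ t in 𝓝 0, 0 < ν t)
    (hpos : ∀ f ∈ P, f ≠ 0 → κ * M 0 f f < (ν 0 • (D' - l • M') + (l * N') • M 0) f f) :
    ∀ᶠ t in 𝓝[>] (0 : ℝ), l * ν 0 + κ * t ≤ minmax (D t) (M t) k * ν t := by
  have := hs.finite_ker
  have : FiniteDimensional ℝ P := Submodule.finiteDimensional_of_le hP
  have hN : 0 < ν 0 := hν0.self_of_nhds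
  have hM : ∀ u, u ≠ 0 → 0 < M 0 u u := h.snd_pos.self_of_nhds
  obtain ⟨η, hη, hle⟩ := exists_pos_mul_le_on P
    (ν 0 • (D' - l • M') + (l * N') • M 0 - κ • M 0) (M 0) (fun x hx hx0 => by
      have := hpos x hx hx0
      rw [LinearMap.sub_apply, LinearMap.sub_apply, LinearMap.smul_apply, LinearMap.smul_apply,
        smul_eq_mul]
      linarith)
  -- The derivative of `(l + c t) ν t` at `0` is then `κ + η / 2`, above the required slope, while
  -- `η / 2` of the definiteness margin `η` remains for the estimate of the min-max value itself.
  set c := (κ - l * N' + η / 2) / ν 0 with hc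
  have hcN : c * ν 0 = κ - l * N' + η / 2 := by rw [hc]; field_simp
  have h1 := h.eventually_le_minmax hinf hs hP hdim (c := c) fun f hf hf0 => by
    have e1 := hle f hf
    have e2 := hM f hf0
    simp only [LinearMap.sub_apply, LinearMap.add_apply, LinearMap.smul_apply, smul_eq_mul]
      at e1 ⊢
    have e3 : ν 0 * (c * M 0 f f) < ν 0 * (D' f f - l * M' f f) := by
      have : ν 0 * (c * M 0 f f) = (κ - l * N' + η / 2) * M 0 f f := by rw [← hcN]; ring
      rw [this]
      nlinarith
    exact lt_of_mul_lt_mul_left e3 hN.le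
  have h2 := (hasDerivAt_affine_mul hν l c).eventually_add_mul_le (κ := κ) (by rw [hcN]; linarith)
  filter_upwards [h1, h2, hν0.filter_mono nhdsWithin_le_nhds] with t ht1 ht2 ht3
  have := mul_le_mul_of_nonneg_right ht1 ht3.le
  simp only [mul_zero, add_zero] at ht2
  linarith

theorem eventually_minmax_mul_le (h : IsFormPath A D M D' M')
    (hs : IsSplitting (D 0 - l • M 0) A Wm Wp) (hP : P ≤ LinearMap.ker (D 0 - l • M 0))
    (hdim : k + 1 ≤ Module.finrank ℝ Wm + Module.finrank ℝ P)
    (hν : HasDerivAt ν N' 0) (hν0 : ∀ᶠ t in 𝓝 0, 0 < ν t)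
    (hneg : ∀ f ∈ P, f ≠ 0 → (ν 0 • (D' - l • M') + (l * N') • M 0) f f < κ * M 0 f f) :
    ∀ᶠ t in 𝓝[>] (0 : ℝ), minmax (D t) (M t) k * ν t ≤ l * ν 0 + κ * t := by
  have := hs.finite_ker
  have : FiniteDimensional ℝ P := Submodule.finiteDimensional_of_le hP
  have hN : 0 < ν 0 := hν0.self_of_nhds
  have hM : ∀ u, u ≠ 0 → 0 < M 0 u u := h.snd_pos.self_of_nhds
  obtain ⟨η, hη, hle⟩ := exists_pos_mul_le_on P
    (κ • M 0 - (ν 0 • (D' - l • M') + (l * N') • M 0)) (M 0) (fun x hx hx0 => by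
      have := hneg x hx hx0
      rw [LinearMap.sub_apply, LinearMap.sub_apply, LinearMap.smul_apply, LinearMap.smul_apply,
        smul_eq_mul]
      linarith)
  set c := (κ - l * N' - η / 2) / ν 0 with hc
  have hcN : c * ν 0 = κ - l * N' - η / 2 := by rw [hc]; field_simp
  have h1 := h.eventually_minmax_le hs hP hdim (c := c) fun f hf hf0 => by
    have e1 := hle f hf
    have e2 := hM f hf0
    simp only [LinearMap.sub_apply, LinearMap.add_apply, LinearMap.smul_apply, smul_eq_mul]
      at e1 ⊢
    have e3 : ν 0 * (D' f f - l * M' f f) < ν 0 * (c * M 0 f f) := by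
      have : ν 0 * (c * M 0 f f) = (κ - l * N' - η / 2) * M 0 f f := by rw [← hcN]; ring
      rw [this]
      nlinarith
    exact lt_of_mul_lt_mul_left e3 hN.le
  have h2 := (hasDerivAt_affine_mul hν l c).eventually_le_add_mul (κ := κ) (by rw [hcN]; linarith)
  filter_upwards [h1, h2, hν0.filter_mono nhdsWithin_le_nhds] with t ht1 ht2 ht3
  have := mul_le_mul_of_nonneg_right ht1 ht3.le
  simp only [mul_zero, add_zero] at ht2
  linarith

end FormPencil.IsFormPath

/-- A function with `f t ≤ f 0 + κ |t|` near `0` for every `κ > 0` is at most `f 0 + o(t)`. -/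
theorem exists_isLittleO_le {f : ℝ → ℝ} (a : ℝ)
    (h : ∀ κ > 0, ∀ᶠ t in 𝓝 (0 : ℝ), f t ≤ a + κ * |t|) :
    ∃ r : ℝ → ℝ, r =o[𝓝 0] (fun t : ℝ => t) ∧ ∀ᶠ t in 𝓝 0, f t ≤ a + r t := by
  refine ⟨fun t => max (f t - a) 0, ?_, Eventually.of_forall fun t => ?_⟩
  · rw [isLittleO_iff]
    intro κ hκ
    filter_upwards [h κ hκ] with t ht
    rw [Real.norm_eq_abs, Real.norm_eq_abs, abs_of_nonneg (le_max_right _ _)]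
    exact max_le (by linarith) (by positivity)
  · have := le_max_left (f t - a) 0
    simp only
    linarith

/-- A one-sided estimate on both sides of `0`, with an exact bound at `0`. -/
theorem eventually_nhds_zero_of_right_left {p : ℝ → Prop} (h0 : p 0)
    (hr : ∀ᶠ t in 𝓝[>] (0 : ℝ), p t) (hl : ∀ᶠ t in 𝓝[>] (0 : ℝ), p (-t)) :
    ∀ᶠ t in 𝓝 (0 : ℝ), p t := by
  rw [← nhdsWithin_univ, ← Iio_union_Ici (a := (0 : ℝ)), nhdsWithin_union, eventually_sup]
  constructor
  · have : Tendsto (fun t : ℝ => -t) (𝓝[<] 0) (𝓝[>] 0) := by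
      have := tendsto_neg_nhdsLT (a := (0 : ℝ))
      simpa using this
    simpa using this.eventually hl
  · rw [← Ioi_insert, nhdsWithin_insert, eventually_sup]
    exact ⟨by simpa using h0, hr⟩

end Product

/-! ### Uniform first order expansion over a compact parameter space -/

section UniformExpansion

/-- First order expansion at `t = 0`, uniform over a compact space. -/
theorem eventually_uniform_expansion {X : Type*} [TopologicalSpace X] [CompactSpace X] {ε : ℝ}
    (hε : 0 < ε) {Φ Φ' : ℝ → X → ℝ}
    (hd : ∀ t ∈ Ioo (-ε) ε, ∀ x, HasDerivAt (fun t => Φ t x) (Φ' t x) t)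
    (hc : ContinuousOn (fun p : ℝ × X => Φ' p.1 p.2) (Ioo (-ε) ε ×ˢ univ)) {η : ℝ} (hη : 0 < η) :
    ∀ᶠ t in 𝓝 (0 : ℝ), ∀ x, |Φ t x - Φ 0 x - t * Φ' 0 x| ≤ η * |t| := by
  have hopen : IsOpen (Ioo (-ε) ε ×ˢ (univ : Set X)) := isOpen_Ioo.prod isOpen_univ
  have h0 : (0 : ℝ) ∈ Ioo (-ε) ε := ⟨by linarith, hε⟩
  have hat : ∀ x, ContinuousAt (fun p : ℝ × X => Φ' p.1 p.2) (0, x) := fun x =>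
    hc.continuousAt (hopen.mem_nhds ⟨h0, mem_univ _⟩)
  have hc0 : ∀ x, ContinuousAt (fun y : X => Φ' 0 y) x := fun x =>
    ContinuousAt.comp (f := fun y : X => ((0 : ℝ), y)) (hat x) (by fun_prop)
  have hloc : ∀ x ∈ (univ : Set X), ∀ᶠ z : ℝ × X in 𝓝 ((0 : ℝ), x),
      |Φ' z.1 z.2 - Φ' 0 z.2| < η := by
    intro x _
    have h1 : Tendsto (fun z : ℝ × X => |Φ' z.1 z.2 - Φ' 0 z.2|) (𝓝 (0, x))
        (𝓝 |Φ' 0 x - Φ' 0 x|) := by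
      refine ((hat x).tendsto.sub ?_).abs
      exact (hc0 x).tendsto.comp continuous_snd.continuousAt
    rw [sub_self, abs_zero] at h1
    exact h1.eventually_lt_const hη
  have hunif : ∀ᶠ s in 𝓝 (0 : ℝ), ∀ x ∈ (univ : Set X), |Φ' s x - Φ' 0 x| < η := by
    refine isCompact_univ.eventually_forall_of_forall_eventually fun x hx => ?_
    exact hloc x hx
  obtain ⟨δ, hδ, hball⟩ := Metric.eventually_nhds_iff_ball.1
    (hunif.and (isOpen_Ioo.mem_nhds h0))
  filter_upwards [Metric.ball_mem_nhds (0 : ℝ) hδ] with t ht x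
  -- Mean value inequality for `s ↦ Φ s x - s Φ' 0 x`, whose derivative is smaller than `η` for all
  -- `x` simultaneously.
  have key := (convex_ball (0 : ℝ) δ).norm_image_sub_le_of_norm_hasDerivWithin_le
    (f := fun s => Φ s x - s * Φ' 0 x) (f' := fun s => Φ' s x - Φ' 0 x) (C := η)
    (fun s hs => (((hd s (hball s hs).2 x).sub (by
      simpa using (hasDerivAt_id s).mul_const (Φ' 0 x)))).hasDerivWithinAt)
    (fun s hs => ((hball s hs).1 x (mem_univ _)).le) (Metric.mem_ball_self hδ) ht
  simp only [zero_mul, sub_zero, Real.norm_eq_abs] at key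
  convert key using 2
  ring

end UniformExpansion

/-! ### Smooth families of metrics and densities as paths of forms -/

namespace EdgeGraph

open FormPencil

section Weights

variable {E : Type*}

/-- A function that is continuous on every edge, as a family of bundled continuous functions. -/
noncomputable def edgeWeight (f : EdgeFun E) (e : E) : C(I, ℝ) :=
  open scoped Classical in if h : Continuous (f e) then ⟨f e, h⟩ else 0

theorem edgeWeight_apply {f : EdgeFun E} {e : E} (h : Continuous (f e)) (x : I) :
    edgeWeight f e x = f e x := by
  simp [edgeWeight, h]

theorem SmoothOnEdges.continuous {h : EdgeFun E} (hs : SmoothOnEdges h) (e : E) :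
    Continuous (h e) := by
  obtain ⟨H, hH, hx⟩ := hs e
  rw [funext hx]
  exact hH.continuous.comp continuous_subtype_val

theorem MetricDirection.smoothOnEdges {c : MetricClass} {φ : EdgeFun E}
    (h : MetricDirection c φ) : SmoothOnEdges φ := by
  cases c with
  | edgewiseConstant => exact fun e => ⟨fun _ => φ e 0, contDiff_const, fun x => h e x 0⟩
  | edgewiseSmooth => exact h

theorem IsPair.continuous_metric {c : MetricClass} {g ρ : EdgeFun E} (h : IsPair c g ρ) (e : E) :
    Continuous (g e) := h.metric.smoothOnEdges.continuous e

theorem IsPair.continuous_density {c : MetricClass} {g ρ : EdgeFun E} (h : IsPair c g ρ) (e : E) :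
    Continuous (ρ e) := h.density.continuous e

theorem IsPair.sqrt_pos {c : MetricClass} {g ρ : EdgeFun E} (h : IsPair c g ρ) (e : E) (x : I) :
    0 < √(g e x) := Real.sqrt_pos.2 (h.metric_pos e x)

/-- The weight `1 / √g` of the Dirichlet form. -/
noncomputable def stiffness (g : EdgeFun E) : E → C(I, ℝ) :=
  edgeWeight fun e x => (√(g e x))⁻¹

/-- The weight `ρ √g` of the mass form. -/
noncomputable def massDensity (g ρ : EdgeFun E) : E → C(I, ℝ) :=
  edgeWeight fun e x => ρ e x * √(g e x)

/-- The derivative of the weight `1 / √g` in the direction `φ`. -/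
noncomputable def stiffnessVelocity (g φ : EdgeFun E) : E → C(I, ℝ) :=
  edgeWeight fun e x => -(φ e x / (2 * g e x * √(g e x)))

/-- The derivative of the weight `ρ √g` in the direction `(φ, ψ)`. -/
noncomputable def massVelocity (g ρ φ ψ : EdgeFun E) : E → C(I, ℝ) :=
  edgeWeight fun e x => ψ e x * √(g e x) + ρ e x * φ e x / (2 * √(g e x))

variable {c : MetricClass} {g ρ φ ψ : EdgeFun E} (h : IsPair c g ρ)
include h

theorem IsPair.stiffness_apply (e : E) (x : I) : stiffness g e x = (√(g e x))⁻¹ :=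
  edgeWeight_apply (f := fun e x => (√(g e x))⁻¹)
    ((Real.continuous_sqrt.comp (h.continuous_metric e)).inv₀ fun x => (h.sqrt_pos e x).ne') x

theorem IsPair.massDensity_apply (e : E) (x : I) : massDensity g ρ e x = ρ e x * √(g e x) :=
  edgeWeight_apply (f := fun e x => ρ e x * √(g e x))
    ((h.continuous_density e).mul (Real.continuous_sqrt.comp (h.continuous_metric e))) x

theorem IsPair.stiffnessVelocity_apply {e : E} (hφ : Continuous (φ e)) (x : I) :
    stiffnessVelocity g φ e x = -(φ e x / (2 * g e x * √(g e x))) :=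
  edgeWeight_apply (f := fun e x => -(φ e x / (2 * g e x * √(g e x))))
    (hφ.div ((continuous_const.mul (h.continuous_metric e)).mul
      (Real.continuous_sqrt.comp (h.continuous_metric e))) fun x =>
        (mul_pos (mul_pos two_pos (h.metric_pos e x)) (h.sqrt_pos e x)).ne').neg x

theorem IsPair.massVelocity_apply {e : E} (hφ : Continuous (φ e)) (hψ : Continuous (ψ e))
    (x : I) : massVelocity g ρ φ ψ e x
      = ψ e x * √(g e x) + ρ e x * φ e x / (2 * √(g e x)) :=
  edgeWeight_apply (f := fun e x => ψ e x * √(g e x) + ρ e x * φ e x / (2 * √(g e x)))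
    ((hψ.mul (Real.continuous_sqrt.comp (h.continuous_metric e))).add
      (((h.continuous_density e).mul hφ).div
        (continuous_const.mul (Real.continuous_sqrt.comp (h.continuous_metric e))) fun x =>
          (mul_pos two_pos (h.sqrt_pos e x)).ne')) x

theorem IsPair.stiffness_pos (e : E) (x : I) : 0 < stiffness g e x := by
  rw [h.stiffness_apply]
  exact inv_pos.2 (h.sqrt_pos e x)

theorem IsPair.massDensity_pos (e : E) (x : I) : 0 < massDensity g ρ e x := by
  rw [h.massDensity_apply]
  exact mul_pos (h.density_pos e x) (h.sqrt_pos e x)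

end Weights

section Families

variable {E : Type*}

/-- The time derivative is a directional derivative of the joint smooth extension. This makes it
jointly continuous, as required by the uniform expansion. -/
theorem SmoothInTime.exists_deriv {ε : ℝ} {h : ℝ → EdgeFun E} (hs : SmoothInTime ε h) (e : E) :
    ∃ h' : ℝ → I → ℝ,
      ContinuousOn (fun p : ℝ × I => h' p.1 p.2) (Ioo (-ε) ε ×ˢ univ) ∧
      ContinuousOn (fun p : ℝ × I => h p.1 e p.2) (Ioo (-ε) ε ×ˢ univ) ∧
      ∀ t ∈ Ioo (-ε) ε, ∀ x, HasDerivAt (fun t => h t e x) (h' t x) t := by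
  obtain ⟨F, hF, hx⟩ := hs e
  have hopen : IsOpen (Ioo (-ε) ε ×ˢ (univ : Set ℝ)) := isOpen_Ioo.prod isOpen_univ
  have hmaps : MapsTo (fun p : ℝ × I => (p.1, (p.2 : ℝ))) (Ioo (-ε) ε ×ˢ univ)
      (Ioo (-ε) ε ×ˢ univ) := fun p hp => ⟨hp.1, mem_univ _⟩
  have hcoe : ContinuousOn (fun p : ℝ × I => (p.1, (p.2 : ℝ))) (Ioo (-ε) ε ×ˢ univ) := by
    fun_prop
  refine ⟨fun t x => fderiv ℝ F (t, (x : ℝ)) (1, 0), ?_, ?_, ?_⟩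
  · have h1 := hF.continuousOn_fderiv_of_isOpen hopen (by simp)
    exact (h1.comp hcoe hmaps).clm_apply continuousOn_const
  · refine (hF.continuousOn.comp hcoe hmaps).congr fun p hp => ?_
    exact hx p.1 hp.1 p.2
  · intro t ht x
    have h1 : HasFDerivAt F (fderiv ℝ F (t, (x : ℝ))) (t, (x : ℝ)) :=
      ((hF.differentiableOn (by simp)).differentiableAt
        (hopen.mem_nhds ⟨ht, mem_univ _⟩)).hasFDerivAt
    have h2 : HasDerivAt (fun s : ℝ => (s, (x : ℝ))) ((1 : ℝ), (0 : ℝ)) t :=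
      (hasDerivAt_id t).prodMk (hasDerivAt_const t _)
    have h3 : HasDerivAt (fun s : ℝ => F (s, (x : ℝ))) (fderiv ℝ F (t, (x : ℝ)) (1, 0)) t :=
      h1.comp_hasDerivAt t h2
    refine h3.congr_of_eventuallyEq ?_
    filter_upwards [isOpen_Ioo.mem_nhds ht] with s hs
    exact hx s hs x

variable {c : MetricClass} {g ρ : EdgeFun E} {ε : ℝ} {γ τ : ℝ → EdgeFun E}

theorem IsFamily.zero_mem (h : IsFamily c g ρ ε γ τ) : (0 : ℝ) ∈ Ioo (-ε) ε :=
  ⟨by linarith [h.pos], h.pos⟩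

theorem IsFamily.isPair_zero (h : IsFamily c g ρ ε γ τ) : IsPair c g ρ := by
  have := h.isPair 0 h.zero_mem
  rwa [h.start_metric, h.start_density] at this

theorem IsFamily.eventually_isPair (h : IsFamily c g ρ ε γ τ) :
    ∀ᶠ t in 𝓝 (0 : ℝ), IsPair c (γ t) (τ t) := by
  filter_upwards [isOpen_Ioo.mem_nhds h.zero_mem] with t ht
  exact h.isPair t ht

/-- The velocity of a family at `t = 0`. -/
noncomputable def velocity (h : ℝ → EdgeFun E) : EdgeFun E := fun e x => deriv (fun t => h t e x) 0

theorem SmoothInTime.velocity_continuous (hε : 0 < ε) {h : ℝ → EdgeFun E}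
    (hs : SmoothInTime ε h) (e : E) : Continuous (velocity h e) := by
  obtain ⟨h', hc, -, hd⟩ := hs.exists_deriv e
  have h0 : (0 : ℝ) ∈ Ioo (-ε) ε := ⟨by linarith, hε⟩
  have : velocity h e = fun x => h' 0 x := funext fun x => (hd 0 h0 x).deriv
  rw [this]
  exact hc.comp_continuous (f := fun x : I => ((0 : ℝ), x)) (by fun_prop)
    fun x => ⟨h0, mem_univ _⟩

theorem IsFamily.stiffness_expansion (h : IsFamily c g ρ ε γ τ) (e : E) {η : ℝ} (hη : 0 < η) :
    ∀ᶠ t in 𝓝 (0 : ℝ), ∀ x, |stiffness (γ t) e x - stiffness g e x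
      - t * stiffnessVelocity g (velocity γ) e x| ≤ η * |t| := by
  obtain ⟨γ', hc', hc, hd⟩ := h.smooth_metric.exists_deriv e
  have hpos : ∀ t ∈ Ioo (-ε) ε, ∀ x, 0 < γ t e x := fun t ht x => (h.isPair t ht).metric_pos e x
  have key := eventually_uniform_expansion h.pos (Φ := fun t x => (√(γ t e x))⁻¹)
    (Φ' := fun t x => -(γ' t x / (2 * γ t e x * √(γ t e x)))) (fun t ht x => by
      have hp := hpos t ht x
      have hs := Real.sqrt_pos.2 hp
      have h1 := ((hd t ht x).sqrt hp.ne').fun_inv hs.ne'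
      refine h1.congr_deriv ?_
      rw [Real.sq_sqrt hp.le]
      field_simp) (by
      refine (hc'.div ((continuousOn_const.mul hc).mul
        (Real.continuous_sqrt.comp_continuousOn hc)) fun p hp => ?_).neg
      have := hpos p.1 hp.1 p.2
      exact (mul_pos (mul_pos two_pos this) (Real.sqrt_pos.2 this)).ne') hη
  filter_upwards [key, h.eventually_isPair] with t ht hp x
  have h2 := ht x
  rw [hp.stiffness_apply, h.isPair_zero.stiffness_apply,
    h.isPair_zero.stiffnessVelocity_apply (h.smooth_metric.velocity_continuous h.pos e)]
  have h3 : velocity γ e x = γ' 0 x := (hd 0 h.zero_mem x).deriv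
  rw [h3]
  simpa only [h.start_metric] using h2

theorem IsFamily.massDensity_expansion (h : IsFamily c g ρ ε γ τ) (e : E) {η : ℝ} (hη : 0 < η) :
    ∀ᶠ t in 𝓝 (0 : ℝ), ∀ x, |massDensity (γ t) (τ t) e x - massDensity g ρ e x
      - t * massVelocity g ρ (velocity γ) (velocity τ) e x| ≤ η * |t| := by
  obtain ⟨γ', hc', hc, hd⟩ := h.smooth_metric.exists_deriv e
  obtain ⟨τ', hc₁', hc₁, hd₁⟩ := h.smooth_density.exists_deriv e
  have hpos : ∀ t ∈ Ioo (-ε) ε, ∀ x, 0 < γ t e x := fun t ht x => (h.isPair t ht).metric_pos e x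
  have hsq : ContinuousOn (fun p : ℝ × I => √(γ p.1 e p.2)) (Ioo (-ε) ε ×ˢ univ) :=
    Real.continuous_sqrt.comp_continuousOn hc
  have key := eventually_uniform_expansion h.pos (Φ := fun t x => τ t e x * √(γ t e x))
    (Φ' := fun t x => τ' t x * √(γ t e x) + τ t e x * γ' t x / (2 * √(γ t e x))) (fun t ht x => by
      have hp := hpos t ht x
      have h1 := (hd₁ t ht x).fun_mul ((hd t ht x).sqrt hp.ne')
      refine h1.congr_deriv ?_
      ring) (by
      refine (hc₁'.mul hsq).add ((hc₁.mul hc').div (continuousOn_const.mul hsq) fun p hp => ?_)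
      exact (mul_pos two_pos (Real.sqrt_pos.2 (hpos p.1 hp.1 p.2))).ne') hη
  filter_upwards [key, h.eventually_isPair] with t ht hp x
  have h2 := ht x
  rw [hp.massDensity_apply, h.isPair_zero.massDensity_apply,
    h.isPair_zero.massVelocity_apply (h.smooth_metric.velocity_continuous h.pos e)
      (h.smooth_density.velocity_continuous h.pos e)]
  have h3 : velocity γ e x = γ' 0 x := (hd 0 h.zero_mem x).deriv
  have h4 : velocity τ e x = τ' 0 x := (hd₁ 0 h.zero_mem x).deriv
  rw [h3, h4]
  simpa only [h.start_metric, h.start_density] using h2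

variable {V : Type*} {G : EdgeGraph V E} [Fintype E]

theorem derivForm_sub_sub_smul (α α₀ α' : E → C(I, ℝ)) (t : ℝ) (u : G.sobolev) :
    G.derivForm α u u - G.derivForm α₀ u u - t * G.derivForm α' u u
      = G.derivForm (α + (-1 : ℝ) • α₀ + (-t) • α') u u := by
  simp only [derivForm_add, derivForm_smul, LinearMap.add_apply, LinearMap.smul_apply, smul_eq_mul]
  ring

theorem massForm_sub_sub_smul (α α₀ α' : E → C(I, ℝ)) (t : ℝ) (u : G.sobolev) :
    G.massForm α u u - G.massForm α₀ u u - t * G.massForm α' u u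
      = G.massForm (α + (-1 : ℝ) • α₀ + (-t) • α') u u := by
  simp only [massForm_add, massForm_smul, LinearMap.add_apply, LinearMap.smul_apply, smul_eq_mul]
  ring

/-- The forms of a smooth family of pairs are a differentiable path. -/
theorem IsFamily.isFormPath (h : IsFamily c g ρ ε γ τ) :
    IsFormPath G.energyForm (fun t => G.derivForm (stiffness (γ t)))
      (fun t => G.massForm (massDensity (γ t) (τ t)))
      (G.derivForm (stiffnessVelocity g (velocity γ)))
      (G.massForm (massVelocity g ρ (velocity γ) (velocity τ))) where
  symm_ref := energyForm_symm
  ref_nonneg := energyForm_nonneg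
  symm_fst t := derivForm_symm _
  symm_snd t := massForm_symm _
  fst_nonneg := by
    filter_upwards [h.eventually_isPair] with t ht u
    exact derivForm_nonneg (fun e x => (ht.stiffness_pos e x).le) u
  snd_pos := by
    filter_upwards [h.eventually_isPair] with t ht u hu
    exact massForm_pos ht.massDensity_pos u hu
  fst_expansion η hη := by
    filter_upwards [eventually_all.2 fun e => h.stiffness_expansion e hη] with t ht u
    simp only [derivForm_sub_sub_smul]
    refine abs_derivForm_le_energy (by positivity) (fun e x => ?_) u
    convert ht e x using 2
    simp only [h.start_metric, Pi.add_apply, Pi.smul_apply, ContinuousMap.add_apply,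
      ContinuousMap.smul_apply, smul_eq_mul]
    ring
  snd_expansion η hη := by
    filter_upwards [eventually_all.2 fun e => h.massDensity_expansion e hη] with t ht u
    simp only [massForm_sub_sub_smul]
    refine abs_massForm_le_energy (by positivity) (fun e x => ?_) u
    convert ht e x using 2
    simp only [h.start_metric, h.start_density, Pi.add_apply, Pi.smul_apply,
      ContinuousMap.add_apply, ContinuousMap.smul_apply, smul_eq_mul]
    ring
  fst_bound := by
    obtain ⟨C, hC, hb⟩ := exists_weight_bound (stiffnessVelocity g (velocity γ))
    exact ⟨C, abs_derivForm_le_energy hC hb⟩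
  snd_bound := by
    obtain ⟨C, hC, hb⟩ := exists_weight_bound (massVelocity g ρ (velocity γ) (velocity τ))
    exact ⟨C, abs_massForm_le_energy hC hb⟩
  snd_zero_bound := by
    obtain ⟨C, hC, hb⟩ := exists_weight_bound (massDensity (γ 0) (τ 0))
    exact ⟨C, abs_massForm_le_energy hC hb⟩

theorem IsPair.eigenvalue_eq (h : IsPair c g ρ) (k : ℕ) :
    G.eigenvalue g ρ k
      = minmax (G.derivForm (stiffness g)) (G.massForm (massDensity g ρ)) k :=
  eigenvalue_eq_minmax h.stiffness_apply h.massDensity_apply h.massDensity_pos k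

end Families

section Directions

variable {E : Type*} [Fintype E] {c : MetricClass} {g ρ φ ψ : EdgeFun E}

theorem exists_perturbation_bound {f φ : EdgeFun E} (hf : ∀ e, Continuous (f e))
    (hpos : ∀ e x, 0 < f e x) (hφ : ∀ e, Continuous (φ e)) :
    ∃ ε > 0, ∀ t ∈ Ioo (-ε) ε, ∀ e x, 0 < f e x + t * φ e x := by
  obtain ⟨a, ha, hle⟩ := exists_weight_lower_bound (α := fun e => ⟨f e, hf e⟩) hpos
  obtain ⟨C, hC, hb⟩ := exists_weight_bound (fun e => (⟨φ e, hφ e⟩ : C(I, ℝ)))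
  refine ⟨a / (C + 1), by positivity, fun t ht e x => ?_⟩
  have h1 : |t| < a / (C + 1) := abs_lt.2 ht
  rw [lt_div_iff₀ (by positivity)] at h1
  have h2 : a ≤ f e x := hle e x
  have h3 : |φ e x| ≤ C := hb e x
  have h4 : |t * φ e x| ≤ |t| * (C + 1) := by
    rw [abs_mul]
    exact mul_le_mul_of_nonneg_left (by linarith) (abs_nonneg _)
  have := (abs_le.1 h4).1
  linarith

omit [Fintype E] in
theorem smoothInTime_affine {f φ : EdgeFun E} (hf : SmoothOnEdges f) (hφ : SmoothOnEdges φ)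
    (ε : ℝ) : SmoothInTime ε fun t e x => f e x + t * φ e x := by
  intro e
  obtain ⟨F, hF, hx⟩ := hf e
  obtain ⟨Φ, hΦ, hy⟩ := hφ e
  refine ⟨fun p => F p.2 + p.1 * Φ p.2, ?_, fun t _ x => by simp only [hx, hy]⟩
  exact ((hF.comp contDiff_snd).add (contDiff_fst.mul (hΦ.comp contDiff_snd))).contDiffOn

omit [Fintype E] in
theorem smoothOnEdges_add_mul {f φ : EdgeFun E} (hf : SmoothOnEdges f) (hφ : SmoothOnEdges φ)
    (t : ℝ) : SmoothOnEdges fun e x => f e x + t * φ e x := by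
  intro e
  obtain ⟨F, hF, hx⟩ := hf e
  obtain ⟨Φ, hΦ, hy⟩ := hφ e
  exact ⟨fun x => F x + t * Φ x, hF.add (contDiff_const.mul hΦ), fun x => by simp only [hx, hy]⟩

omit [Fintype E] in
theorem metricDirection_add_mul (hg : MetricDirection c g) (hφ : MetricDirection c φ) (t : ℝ) :
    MetricDirection c fun e x => g e x + t * φ e x := by
  cases c with
  | edgewiseConstant => exact fun e x y => by simp only [hg e x y, hφ e x y]
  | edgewiseSmooth => exact smoothOnEdges_add_mul hg hφ t

/-- Every direction is the velocity of an affine family. -/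
theorem IsPair.exists_isFamily (h : IsPair c g ρ) (hφ : MetricDirection c φ)
    (hψ : SmoothOnEdges ψ) :
    ∃ ε, IsFamily c g ρ ε (fun t e x => g e x + t * φ e x) (fun t e x => ρ e x + t * ψ e x) := by
  obtain ⟨ε₁, h₁, hp₁⟩ := exists_perturbation_bound h.continuous_metric h.metric_pos
    hφ.smoothOnEdges.continuous
  obtain ⟨ε₂, h₂, hp₂⟩ := exists_perturbation_bound h.continuous_density h.density_pos
    hψ.continuous
  have hsub₁ : ∀ t ∈ Ioo (-min ε₁ ε₂) (min ε₁ ε₂), t ∈ Ioo (-ε₁) ε₁ := fun t ht =>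
    ⟨by linarith [ht.1, min_le_left ε₁ ε₂], ht.2.trans_le (min_le_left _ _)⟩
  have hsub₂ : ∀ t ∈ Ioo (-min ε₁ ε₂) (min ε₁ ε₂), t ∈ Ioo (-ε₂) ε₂ := fun t ht =>
    ⟨by linarith [ht.1, min_le_right ε₁ ε₂], ht.2.trans_le (min_le_right _ _)⟩
  exact ⟨min ε₁ ε₂, lt_min h₁ h₂, by simp, by simp, fun t ht =>
    ⟨metricDirection_add_mul h.metric hφ t, hp₁ t (hsub₁ t ht),
      smoothOnEdges_add_mul h.density hψ t, hp₂ t (hsub₂ t ht)⟩,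
    smoothInTime_affine h.metric.smoothOnEdges hφ.smoothOnEdges _,
    smoothInTime_affine h.density hψ _⟩

omit [Fintype E] in
theorem velocity_affine (f φ : EdgeFun E) : velocity (fun t e x => f e x + t * φ e x) = φ := by
  funext e x
  have : HasDerivAt (fun t : ℝ => f e x + t * φ e x) (φ e x) 0 := by
    simpa using ((hasDerivAt_id (0 : ℝ)).mul_const (φ e x)).const_add (f e x)
  exact this.deriv

end Directions

end EdgeGraph

/-! ### Primitives, extensions of `C¹` functions and one-sided derivatives on edges -/

section Calculus

theorem hasDerivAt_primitive {q : ℝ → ℝ} (hq : Continuous q) (a x : ℝ) :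
    HasDerivAt (fun x => a + ∫ t in (0 : ℝ)..x, q t) (q x) x :=
  (intervalIntegral.integral_hasDerivAt_right (hq.intervalIntegrable _ _)
    hq.aestronglyMeasurable.stronglyMeasurableAtFilter hq.continuousAt).const_add a

theorem contDiff_one_primitive {q : ℝ → ℝ} (hq : Continuous q) (a : ℝ) :
    ContDiff ℝ 1 fun x => a + ∫ t in (0 : ℝ)..x, q t := by
  rw [contDiff_one_iff_deriv]
  refine ⟨fun x => (hasDerivAt_primitive hq a x).differentiableAt, ?_⟩
  rw [funext fun x => (hasDerivAt_primitive hq a x).deriv]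
  exact hq

theorem contDiff_two_primitive {q : ℝ → ℝ} (hq : ContDiff ℝ 1 q) (a : ℝ) :
    ContDiff ℝ 2 fun x => a + ∫ t in (0 : ℝ)..x, q t := by
  rw [show (2 : WithTop ℕ∞) = 1 + 1 from rfl, contDiff_succ_iff_deriv]
  refine ⟨fun x => (hasDerivAt_primitive hq.continuous a x).differentiableAt, by simp, ?_⟩
  rw [funext fun x => (hasDerivAt_primitive hq.continuous a x).deriv]
  exact hq

theorem primitive_coe_eq (q : C(I, ℝ)) (x : I) :
    ∫ t in (0 : ℝ)..x, IccExtend (zero_le_one' ℝ) q t = ∫ s in Iic x, q s := by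
  rw [← setIntegral_Iic_coe]
  simp

/-- A function that is `C¹` on a neighbourhood of `[0,1]` agrees there with a `C¹` function. -/
theorem exists_contDiff_extension {F F' : ℝ → ℝ}
    (hF : ∀ x ∈ Icc (0 : ℝ) 1, HasDerivAt F (F' x) x) (hc : ContinuousOn F' (Icc 0 1)) :
    ∃ S : ℝ → ℝ, ContDiff ℝ 1 S ∧ ∀ x : I, S x = F x := by
  have hq : Continuous (IccExtend (zero_le_one' ℝ) fun x : I => F' x) :=
    (continuousOn_iff_continuous_domRestrict.1 hc).Icc_extend'
  refine ⟨_, contDiff_one_primitive hq (F 0), fun x => ?_⟩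
  have h1 : ∫ t in (0 : ℝ)..x, IccExtend (zero_le_one' ℝ) (fun x : I => F' x) t
      = ∫ t in (0 : ℝ)..x, F' t := by
    refine intervalIntegral.integral_congr fun t ht => ?_
    rw [uIcc_of_le x.2.1] at ht
    exact IccExtend_of_mem (zero_le_one' ℝ) (fun x : I => F' x) ⟨ht.1, ht.2.trans x.2.2⟩
  have hsub : uIcc (0 : ℝ) x ⊆ Icc 0 1 := by
    rw [uIcc_of_le x.2.1]
    exact Icc_subset_Icc_right x.2.2
  simp only [h1]
  rw [intervalIntegral.integral_eq_sub_of_hasDerivAt (fun t ht => hF t (hsub ht))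
    ((hc.mono hsub).intervalIntegrable)]
  ring

/-- Integration by parts between a primitive `J` of `j` and a primitive `v` of `w`. -/
theorem integral_mul_add_integral_mul {j w J v : I → ℝ} (hj : Integrable j) (hw : Integrable w)
    (hJ : ∀ x, J x = J 0 + ∫ s in Iic x, j s) (hv : ∀ x, v x = v 0 + ∫ s in Iic x, w s)
    (hJi : Integrable fun x => J x * w x) (hvi : Integrable fun x => j x * v x) :
    (∫ x, J x * w x) + ∫ x, j x * v x = J 1 * v 1 - J 0 * v 0 := by
  have key := integral_mul_primitive_add hj hw
  have h1 : ∀ x, ∫ s in Iic x, j s = J x - J 0 := fun x => by rw [hJ x]; ring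
  have h2 : ∀ x, ∫ s in Iic x, w s = v x - v 0 := fun x => by rw [hv x]; ring
  have h3 : ∫ x, j x = J 1 - J 0 := by rw [← h1 1, Iic_one_unitInterval, setIntegral_univ]
  have h4 : ∫ x, w x = v 1 - v 0 := by rw [← h2 1, Iic_one_unitInterval, setIntegral_univ]
  simp only [h1, h2, sub_mul, mul_sub] at key
  rw [integral_sub hJi (hw.const_mul _), integral_sub hvi (hj.mul_const _), integral_const_mul,
    integral_mul_const, h3, h4] at key
  linarith

namespace EdgeGraph

theorem hasDerivWithinAt_iccExtend {u : I → ℝ} {F : ℝ → ℝ} {F' : ℝ} {x : I}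
    (hu : ∀ y : I, u y = F y) (hF : HasDerivAt F F' x) :
    HasDerivWithinAt (IccExtend zero_le_one u) F' (Icc 0 1) x := by
  refine hF.hasDerivWithinAt.congr (fun y hy => ?_) ?_
  · rw [IccExtend_of_mem _ _ hy, hu]
  · rw [IccExtend_val, hu]

theorem edgeDeriv_eq {u : I → ℝ} {F : ℝ → ℝ} {F' : ℝ} {x : I}
    (hu : ∀ y : I, u y = F y) (hF : HasDerivAt F F' x) : edgeDeriv u x = F' :=
  (hasDerivWithinAt_iccExtend hu hF).derivWithin (uniqueDiffOn_Icc zero_lt_one x x.2)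

end EdgeGraph

end Calculus

/-! ### The radical of the pencil is the eigenspace -/

namespace EdgeGraph

open FormPencil

variable {V E : Type*} [Fintype E] {G : EdgeGraph V E} {c : MetricClass} {g ρ : EdgeFun E}

omit [Fintype E] in
/-- `√g` extends to a `C¹` function. -/
theorem IsPair.exists_sqrt_extension (h : IsPair c g ρ) (e : E) :
    ∃ S : ℝ → ℝ, ContDiff ℝ 1 S ∧ ∀ x : I, √(g e x) = S x := by
  obtain ⟨F, hF, hx⟩ := h.metric.smoothOnEdges e
  have hpos : ∀ x ∈ Icc (0 : ℝ) 1, 0 < F x := fun x hx' => by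
    rw [← hx ⟨x, hx'⟩]
    exact h.metric_pos e _
  have hF1 : ContDiff ℝ 1 F := hF.of_le (by simp)
  -- The smooth extension `F` is known to be positive only on `[0,1]`, so `√F` need not be
  -- differentiable outside; it is extended afresh from `[0,1]`.
  obtain ⟨S, hS, hSx⟩ := exists_contDiff_extension (F := fun x => √(F x))
    (F' := fun x => deriv F x / (2 * √(F x)))
    (fun x hx' => ((hF1.differentiable (by norm_num)).differentiableAt.hasDerivAt).sqrt
      (hpos x hx').ne')
    (((hF1.continuous_deriv le_rfl).continuousOn).div
      (continuous_const.mul (Real.continuous_sqrt.comp hF.continuous)).continuousOn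
      fun x hx' => (mul_pos two_pos (Real.sqrt_pos.2 (hpos x hx'))).ne')
  exact ⟨S, hS, fun x => by rw [hSx, hx]⟩

/-- The flux `J = u' / √g` turns the form into boundary terms. -/
theorem pencil_apply_of_flux {l : ℝ} {u : G.sobolev} {J : EdgeFun E}
    (hJ : ∀ e x, J e x = J e 0 + ∫ s in Iic x, -l * (massDensity g ρ e s * u.1.1 e s))
    (hu : ∀ e, ∀ᵐ x, stiffness g e x * u.1.2 e x = J e x) (hJc : ∀ e, Continuous (J e))
    (v : G.sobolev) :
    (G.derivForm (stiffness g) - l • G.massForm (massDensity g ρ)) u v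
      = ∑ e, (J e 1 * v.1.1 e 1 - J e 0 * v.1.1 e 0) := by
  simp only [LinearMap.sub_apply, LinearMap.smul_apply, smul_eq_mul, derivForm_apply,
    massForm_apply, Finset.mul_sum, ← Finset.sum_sub_distrib]
  refine Finset.sum_congr rfl fun e _ => ?_
  have hjc : Continuous fun s => -l * (massDensity g ρ e s * u.1.1 e s) :=
    continuous_const.mul ((massDensity g ρ e).continuous.mul (sobolev_continuous u e))
  have hJw : Integrable fun x => J e x * v.1.2 e x :=
    (L2_integrable _).bdd_mul (c := ‖(⟨J e, hJc e⟩ : C(I, ℝ))‖) (hJc e).aestronglyMeasurable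
      (Eventually.of_forall fun x => (⟨J e, hJc e⟩ : C(I, ℝ)).norm_coe_le_norm x)
  rw [← integral_mul_add_integral_mul hjc.integrable_unitInterval (L2_integrable (v.1.2 e))
    (hJ e) (sobolev_apply v e) hJw (hjc.mul (sobolev_continuous v e)).integrable_unitInterval,
    sub_eq_add_neg, ← integral_const_mul, ← integral_neg]
  congr 1
  · refine integral_congr_ae ?_
    filter_upwards [hu e] with x hx
    rw [← hx]
    ring
  · refine integral_congr_ae (Eventually.of_forall fun x => ?_)
    simp only
    ring

/-- Exchanging the two sums collects the boundary terms of the edges at each vertex. The outward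
flux is `J e 0` at the source and `-J e 1` at the target, and a loop contributes both. -/
theorem sum_boundary [Fintype V] (J : EdgeFun E) (φ : V → ℝ) :
    ∑ e, (J e 1 * φ (G.tgt e) - J e 0 * φ (G.src e))
      = -∑ v, φ v * ((∑ e, Set.indicator {e | G.src e = v} (fun e => J e 0) e)
        - ∑ e, Set.indicator {e | G.tgt e = v} (fun e => J e 1) e) := by
  classical
  simp only [mul_sub, Finset.sum_sub_distrib, Finset.mul_sum]
  rw [Finset.sum_comm, Finset.sum_comm (f := fun v e => φ v *
    Set.indicator {e | G.tgt e = v} (fun e => J e 1) e)]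
  simp [Set.indicator_apply, mul_comm]

/-- Elements of the eigenspace are in the radical of the pencil. -/
theorem InEigenspace.exists_mem_ker [Fintype V] (h : IsPair c g ρ) {l : ℝ} {f : EdgeFun E}
    (hf : G.InEigenspace g ρ l f) :
    ∃ u ∈ LinearMap.ker (G.derivForm (stiffness g) - l • G.massForm (massDensity g ρ)),
      u.1.1 = f ∧ ∀ e, ∀ᵐ x, u.1.2 e x = edgeDeriv (f e) x := by
  choose F hF hFx using hf.contDiff
  have hF1 : ∀ e, ContDiff ℝ 1 (F e) := fun e => (hF e).of_le (by norm_num)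
  have hfF : f = fun e (x : I) => F e x := funext fun e => funext (hFx e)
  have hm : G.MatchesAtVertices fun e x => F e x := hfF ▸ hf.matchesAtVertices
  set u := G.ofContDiff F hF1 hm with hu
  have hd : ∀ e (x : I), edgeDeriv (f e) x = deriv (F e) x := fun e x =>
    edgeDeriv_eq (hFx e) ((hF1 e).differentiable (by norm_num)).differentiableAt.hasDerivAt
  have hu2 : ∀ e, ∀ᵐ x, u.1.2 e x = edgeDeriv (f e) x := fun e => by
    filter_upwards [ofContDiff_snd hF1 hm e] with x hx
    rw [hd]
    exact hx
  let J : EdgeFun E := fun e x => edgeDeriv (f e) x / √(g e x)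
  have hJc : ∀ e, Continuous (J e) := fun e => by
    have : Continuous fun x : I => edgeDeriv (f e) x := by
      simp only [hd]
      exact ((hF1 e).continuous_deriv le_rfl).comp continuous_subtype_val
    exact this.div (Real.continuous_sqrt.comp (h.continuous_metric e)) fun x => (h.sqrt_pos e x).ne'
  have hdd : ∀ e, ContDiff ℝ 1 (deriv (F e)) := fun e => by
    have := hF e
    rw [show (2 : WithTop ℕ∞) = 1 + 1 from rfl, contDiff_succ_iff_deriv] at this
    exact this.2.2
  have hJd : ∀ e (x : I), HasDerivWithinAt (IccExtend zero_le_one (J e))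
      (-l * (massDensity g ρ e x * u.1.1 e x)) (Icc 0 1) x := by
    intro e x
    obtain ⟨S, hS, hSx⟩ := h.exists_sqrt_extension e
    have hSpos : S x ≠ 0 := by rw [← hSx]; exact (h.sqrt_pos e x).ne'
    have h1 : HasDerivAt (fun y => deriv (F e) y / S y) _ x :=
      (((hdd e).differentiable (by norm_num)).differentiableAt.hasDerivAt).fun_div
        ((hS.differentiable (by norm_num)).differentiableAt.hasDerivAt) hSpos
    have h2 : ∀ y : I, J e y = deriv (F e) y / S y := fun y => by
      simp only [J, hd, hSx]
    have h3 := hasDerivWithinAt_iccExtend h2 h1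
    have h4 := edgeDeriv_eq h2 h1
    have h5 := hf.equation e x
    have hs := (h.sqrt_pos e x).ne'
    have h6 : edgeDeriv (J e) x = -l * (massDensity g ρ e x * u.1.1 e x) := by
      have : -(edgeDeriv (J e) x / √(g e x)) = l * ρ e x * f e x := h5
      have h7 : u.1.1 e x = f e x := (hFx e x).symm
      rw [h.massDensity_apply, h7]
      field_simp at this
      linarith
    rwa [← h4, h6] at h3
  have hJ : ∀ e x, J e x = J e 0 + ∫ s in Iic x, -l * (massDensity g ρ e s * u.1.1 e s) := by
    intro e x
    have hjc : Continuous fun s : I => -l * (massDensity g ρ e s * u.1.1 e s) :=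
      continuous_const.mul ((massDensity g ρ e).continuous.mul (sobolev_continuous u e))
    have hprim := primitive_coe_eq ⟨_, hjc⟩ x
    simp only [ContinuousMap.coe_mk] at hprim
    rw [← hprim]
    have hIcc : Icc (0 : ℝ) x ⊆ Icc 0 1 := Icc_subset_Icc_right x.2.2
    have hcE : Continuous (IccExtend (zero_le_one' ℝ) (J e)) := (hJc e).Icc_extend'
    -- Only continuity up to the ends and the derivative in the open interval are needed; there the
    -- derivative within `[0,1]` is an ordinary one.
    have key := intervalIntegral.integral_eq_sub_of_hasDerivAt_of_le x.2.1
      (f := IccExtend (zero_le_one' ℝ) (J e))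
      (f' := IccExtend (zero_le_one' ℝ) fun s : I => -l * (massDensity g ρ e s * u.1.1 e s))
      hcE.continuousOn (fun t ht => by
        have htI : t ∈ Icc (0 : ℝ) 1 := hIcc ⟨ht.1.le, ht.2.le⟩
        have := (hJd e ⟨t, htI⟩).hasDerivAt (Icc_mem_nhds ht.1 (ht.2.trans_le x.2.2))
        rwa [IccExtend_of_mem _ _ htI]) (hjc.Icc_extend'.intervalIntegrable _ _)
    rw [key, IccExtend_val, IccExtend_left]
    exact (add_sub_cancel (J e 0) (J e x)).symm
  refine ⟨u, ?_, hfF.symm, hu2⟩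
  rw [LinearMap.mem_ker]
  ext v
  rw [pencil_apply_of_flux hJ (fun e => by
    filter_upwards [hu2 e] with x hx
    rw [hx, h.stiffness_apply]
    simp only [J]
    ring) hJc v]
  obtain ⟨φ, hφ⟩ := v.2.1
  simp only [fun e => (hφ e).1, fun e => (hφ e).2]
  rw [sum_boundary]
  have hk := hf.kirchhoff
  simp only [J, hk]
  simp

open scoped Classical in
/-- The element of the Sobolev space supported on the edge `e` with derivative `w`. -/
noncomputable def edgeBump (G : EdgeGraph V E) (e : E) (w : Lp ℝ 2 (volume : Measure I))
    (hw : ∫ x, w x = 0) : G.sobolev :=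
  ⟨(Pi.single e fun x => ∫ s in Iic x, w s, Pi.single e w), by
    refine ⟨⟨0, fun e' => ?_⟩, fun e' x => ?_⟩
    · by_cases h : e' = e
      · subst h
        simp only [Pi.single_eq_same, setIntegral_Iic_zero, Iic_one_unitInterval,
          setIntegral_univ, hw, Pi.zero_apply, and_self]
      · simp [h]
    · by_cases h : e' = e
      · subst h
        simp only [Pi.single_eq_same, setIntegral_Iic_zero, zero_add]
      · simp only [Pi.single_eq_of_ne h, Pi.zero_apply, zero_add]
        have : ∫ s in Iic x, (0 : Lp ℝ 2 (volume : Measure I)) s = ∫ s : I in Iic x, (0 : ℝ) :=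
          integral_congr_ae (ae_restrict_of_ae (Lp.coeFn_zero _ _ _))
        rw [this]
        simp⟩

/-- Elements of the radical of the pencil have a continuous flux. -/
theorem exists_flux {l : ℝ} {u : G.sobolev}
    (hu : u ∈ LinearMap.ker (G.derivForm (stiffness g) - l • G.massForm (massDensity g ρ)))
    (e : E) : ∃ a : ℝ, ∀ᵐ x, stiffness g e x * u.1.2 e x
      = a + ∫ s in Iic x, -l * (massDensity g ρ e s * u.1.1 e s) := by
  classical
  set j : I → ℝ := fun s => -l * (massDensity g ρ e s * u.1.1 e s) with hj
  have hjc : Continuous j :=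
    continuous_const.mul ((massDensity g ρ e).continuous.mul (sobolev_continuous u e))
  set p : I → ℝ := fun x => ∫ s in Iic x, j s with hp
  have hpc : Continuous p := by
    have : p = fun x : I => ∫ t in (0 : ℝ)..x, IccExtend (zero_le_one' ℝ) j t :=
      funext fun x => (primitive_coe_eq ⟨j, hjc⟩ x).symm
    rw [this]
    exact (intervalIntegral.continuous_primitive
      (fun a b => (hjc.Icc_extend').intervalIntegrable a b) 0).comp continuous_subtype_val
  have hφ : MemLp (fun x => stiffness g e x * u.1.2 e x - p x) 2 (volume : Measure I) := by
    refine MemLp.sub ?_ (MemLp.of_bound hpc.aestronglyMeasurable ‖(⟨p, hpc⟩ : C(I, ℝ))‖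
      (Eventually.of_forall fun x => (⟨p, hpc⟩ : C(I, ℝ)).norm_coe_le_norm x))
    refine (Lp.memLp (u.1.2 e)).of_le_mul (c := ‖stiffness g e‖)
      ((stiffness g e).continuous.aestronglyMeasurable.mul (Lp.aestronglyMeasurable _))
      (Eventually.of_forall fun x => ?_)
    rw [norm_mul]
    exact mul_le_mul_of_nonneg_right ((stiffness g e).norm_coe_le_norm x) (norm_nonneg _)
  set m := ∫ x, (stiffness g e x * u.1.2 e x - p x) with hm
  have hψ : MemLp (fun x => stiffness g e x * u.1.2 e x - p x - m) 2 (volume : Measure I) :=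
    hφ.sub (memLp_const m)
  set w := hψ.toLp with hwdef
  have hwae : (w : I → ℝ) =ᵐ[volume] fun x => stiffness g e x * u.1.2 e x - p x - m :=
    hψ.coeFn_toLp
  have hw0 : ∫ x, w x = 0 := by
    rw [integral_congr_ae hwae, integral_sub (hφ.integrable (by norm_num)) (integrable_const _),
      ← hm]
    simp
  set v := edgeBump G e w hw0 with hv
  have hker := ker_apply hu v
  have hsum : ∀ (f : E → ℝ), (∀ e', e' ≠ e → f e' = 0) → ∑ e', f e' = f e := fun f hf =>
    Finset.sum_eq_single e (fun e' _ he' => hf e' he') (by simp)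
  have hV : ∀ x, v.1.1 e x = ∫ s in Iic x, w s := fun x => by
    simp only [hv, edgeBump, Pi.single_eq_same]
  have hV2 : v.1.2 e = w := by
    simp only [hv, edgeBump, Pi.single_eq_same]
  have h1 : G.derivForm (stiffness g) u v = ∫ x, stiffness g e x * (u.1.2 e x * w x) := by
    rw [derivForm_apply, hsum, hV2]
    intro e' he'
    have : v.1.2 e' = 0 := by simp only [hv, edgeBump, Pi.single_eq_of_ne he']
    rw [this, integral_congr_ae (g := fun _ => 0)]
    · simp
    · filter_upwards [Lp.coeFn_zero ℝ 2 (volume : Measure I)] with x hx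
      rw [hx]
      simp
  have h2 : G.massForm (massDensity g ρ) u v
      = ∫ x, massDensity g ρ e x * (u.1.1 e x * v.1.1 e x) := by
    rw [massForm_apply, hsum]
    intro e' he'
    have : v.1.1 e' = 0 := by simp only [hv, edgeBump, Pi.single_eq_of_ne he']
    simp [this]
  have hpw : Integrable fun x => p x * w x :=
    (L2_integrable w).bdd_mul (c := ‖(⟨p, hpc⟩ : C(I, ℝ))‖) hpc.aestronglyMeasurable
      (Eventually.of_forall fun x => (⟨p, hpc⟩ : C(I, ℝ)).norm_coe_le_norm x)
  have h3 := integral_mul_add_integral_mul (J := p) (v := v.1.1 e) hjc.integrable_unitInterval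
    (L2_integrable w) (fun x => by simp only [hp, setIntegral_Iic_zero, zero_add])
    (fun x => by simp only [hV, setIntegral_Iic_zero, zero_add]) hpw
    (hjc.mul (sobolev_continuous v e)).integrable_unitInterval
  rw [hV 1, hV 0, Iic_one_unitInterval, setIntegral_univ, hw0, setIntegral_Iic_zero] at h3
  have h4 : ∫ x, j x * v.1.1 e x = -l * ∫ x, massDensity g ρ e x * (u.1.1 e x * v.1.1 e x) := by
    rw [← integral_const_mul]
    refine integral_congr_ae (Eventually.of_forall fun x => ?_)
    simp only [hj]
    ring
  simp only [LinearMap.sub_apply, LinearMap.smul_apply, smul_eq_mul] at hker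
  rw [h1, h2] at hker
  -- One factor `w` is expanded: the terms in the flux and in `p` cancel by the weak equation and
  -- integration by parts, and the term in `m` vanishes because `w` has mean zero.
  have h5 : ∫ x, w x ^ 2 = 0 := by
    have : ∀ᵐ x, w x ^ 2 = stiffness g e x * (u.1.2 e x * w x) - p x * w x - m * w x := by
      filter_upwards [hwae] with x hx
      rw [sq]
      conv_lhs => rw [hx, ← hx]
      rw [hx]
      ring
    have hi := integrable_mul_mul_of_L2 (stiffness g e) (u.1.2 e) w
    have hi2 : Integrable fun x => stiffness g e x * (u.1.2 e x * w x) - p x * w x := hi.sub hpw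
    rw [integral_congr_ae this, integral_sub hi2 ((L2_integrable w).const_mul m),
      integral_sub hi hpw, integral_const_mul, hw0]
    linarith
  rw [integral_sq_eq_norm_sq] at h5
  have hwz : w = 0 := by simpa using h5
  refine ⟨m, ?_⟩
  rw [hwz] at hwae
  filter_upwards [hwae, Lp.coeFn_zero ℝ 2 (volume : Measure I)] with x hx hx0
  rw [hx0] at hx
  simp only [Pi.zero_apply] at hx
  linarith

/-- Elements of the radical of the pencil are classical eigenfunctions. -/
theorem inEigenspace_of_mem_ker [Fintype V] (h : IsPair c g ρ) {l : ℝ} {u : G.sobolev}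
    (hu : u ∈ LinearMap.ker (G.derivForm (stiffness g) - l • G.massForm (massDensity g ρ))) :
    G.InEigenspace g ρ l u.1.1 ∧ ∀ e, ∀ᵐ x, u.1.2 e x = edgeDeriv (u.1.1 e) x := by
  classical
  choose a ha using fun e => exists_flux hu e
  choose S hS hSx using h.exists_sqrt_extension
  let j : E → C(I, ℝ) := fun e => ⟨fun s => -l * (massDensity g ρ e s * u.1.1 e s),
    continuous_const.mul ((massDensity g ρ e).continuous.mul (sobolev_continuous u e))⟩
  let je : E → ℝ → ℝ := fun e => IccExtend (zero_le_one' ℝ) (j e)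
  have hje : ∀ e, Continuous (je e) := fun e => (j e).continuous.Icc_extend'
  -- Regularity: `J` is a primitive of a continuous function, hence `C¹`; so is `u' = √g J`, and
  -- therefore `u` is `C²`.
  let J : E → ℝ → ℝ := fun e x => a e + ∫ t in (0 : ℝ)..x, je e t
  have hJ : ∀ e, ContDiff ℝ 1 (J e) := fun e => contDiff_one_primitive (hje e) (a e)
  have hJx : ∀ e (x : I), J e x = a e + ∫ s in Iic x, j e s := fun e x => by
    simp only [J, je, primitive_coe_eq]
  let q : E → ℝ → ℝ := fun e x => S e x * J e x
  have hq : ∀ e, ContDiff ℝ 1 (q e) := fun e => (hS e).mul (hJ e)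
  let F : E → ℝ → ℝ := fun e x => u.1.1 e 0 + ∫ t in (0 : ℝ)..x, q e t
  have hF : ∀ e, ContDiff ℝ 2 (F e) := fun e => contDiff_two_primitive (hq e) _
  have hu2 : ∀ e, ∀ᵐ x : I, u.1.2 e x = q e x := fun e => by
    filter_upwards [ha e] with x hx
    have hs := (h.sqrt_pos e x).ne'
    rw [h.stiffness_apply] at hx
    simp only [q, hJx, ← hSx]
    change _ = _ * (a e + ∫ s in Iic x, -l * (massDensity g ρ e s * u.1.1 e s))
    rw [← hx]
    field_simp
  have hFx : ∀ e (x : I), u.1.1 e x = F e x := fun e x => by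
    simp only [F]
    rw [sobolev_apply u e x, integral_congr_ae (ae_restrict_of_ae (hu2 e)), setIntegral_Iic_coe]
  have hdF : ∀ e (x : I), edgeDeriv (u.1.1 e) x = q e x := fun e x =>
    edgeDeriv_eq (hFx e) (hasDerivAt_primitive (hq e).continuous _ _)
  have hflux : ∀ e (x : I), edgeDeriv (u.1.1 e) x / √(g e x) = J e x := fun e x => by
    rw [hdF]
    simp only [q, ← hSx]
    have hs := (h.sqrt_pos e x).ne'
    field_simp
  refine ⟨⟨fun e => ⟨F e, hF e, hFx e⟩, u.2.1, fun e x => ?_, fun v => ?_⟩, fun e => ?_⟩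
  · have h1 : edgeDeriv (fun y => edgeDeriv (u.1.1 e) y / √(g e y)) x = j e x := by
      refine (edgeDeriv_eq (fun y => hflux e y) (hasDerivAt_primitive (hje e) _ _)).trans ?_
      simp only [je, IccExtend_val]
    have hs := (h.sqrt_pos e x).ne'
    rw [laplacian, h1]
    simp only [j, ContinuousMap.coe_mk, h.massDensity_apply]
    field_simp
  · let φ : V → ℝ := Pi.single v 1
    let L : E → ℝ → ℝ := fun e x => φ (G.src e) * (1 - x) + φ (G.tgt e) * x
    have hL : ∀ e, ContDiff ℝ 1 (L e) := fun e => by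
      simp only [L]
      fun_prop
    have hLm : G.MatchesAtVertices fun e x => L e x := ⟨φ, fun e => by simp [L]⟩
    set y := G.ofContDiff L hL hLm
    have hk := ker_apply hu y
    rw [pencil_apply_of_flux (J := fun e x => J e x)
      (fun e x => by
        rw [hJx, hJx, setIntegral_Iic_zero, add_zero]
        rfl)
      (fun e => by
        filter_upwards [ha e] with x hx
        rw [hx, hJx]
        rfl)
      (fun e => (hJ e).continuous.comp continuous_subtype_val) y] at hk
    have hy0 : ∀ e, y.1.1 e 0 = φ (G.src e) := fun e =>
      (ofContDiff_fst hL hLm e _).trans (by simp [L])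
    have hy1 : ∀ e, y.1.1 e 1 = φ (G.tgt e) := fun e =>
      (ofContDiff_fst hL hLm e _).trans (by simp [L])
    simp only [hy0, hy1] at hk
    have hsb := sum_boundary (G := G) (fun e (x : I) => J e x) φ
    rw [hk, zero_eq_neg] at hsb
    simp only [hflux]
    simpa only [φ, Pi.single_apply, ite_mul, one_mul, zero_mul, Finset.sum_ite_eq',
      Finset.mem_univ, if_true] using hsb
  · filter_upwards [hu2 e] with x hx
    rw [hx, hdF]

end EdgeGraph

/-! ### Separation of a space of forms from the positive definite ones -/

section Separation

/-- The convex hull of a compact set in a finite dimensional space is closed. -/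
theorem IsCompact.isClosed_convexHull {F : Type*} [NormedAddCommGroup F] [NormedSpace ℝ F]
    [FiniteDimensional ℝ F] {K : Set F} (hK : IsCompact K) (hne : K.Nonempty) :
    IsClosed (convexHull ℝ K) := by
  classical
  obtain ⟨y₀, hy₀⟩ := hne
  -- By Carathéodory this number of points suffices, so the hull is a continuous image of a compact
  -- set. Shorter combinations are padded with weight `0` at `y₀`.
  let N := Module.finrank ℝ F + 1
  let f : (Fin N → ℝ) × (Fin N → F) → F := fun p => ∑ i, p.1 i • p.2 i
  have hf : Continuous f := by fun_prop
  have hcomp : IsCompact (f '' (stdSimplex ℝ (Fin N) ×ˢ univ.pi fun _ => K)) :=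
    ((isCompact_stdSimplex ℝ (Fin N)).prod (isCompact_univ_pi fun _ => hK)).image hf
  have heq : convexHull ℝ K = f '' (stdSimplex ℝ (Fin N) ×ˢ univ.pi fun _ => K) := by
    apply Subset.antisymm
    · intro x hx
      obtain ⟨ι, _, z, w, hz, hai, hw, hw1, rfl⟩ := eq_pos_convex_span_of_mem_convexHull hx
      have hcard : Fintype.card ι ≤ N := by
        have := hai.card_le_finrank_succ
        have h2 := Submodule.finrank_le (vectorSpan ℝ (range z))
        omega
      obtain ⟨j⟩ : Nonempty (ι ↪ Fin N) := Function.Embedding.nonempty_of_card_le (by simpa using hcard)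
      refine ⟨(Function.extend j w 0, Function.extend j z fun _ => y₀), ⟨⟨fun i => ?_, ?_⟩, ?_⟩, ?_⟩
      · by_cases h : ∃ a, j a = i
        · obtain ⟨a, rfl⟩ := h
          simp only [j.injective.extend_apply]
          exact (hw a).le
        · simp [Function.extend_apply' _ _ _ h]
      · rw [← hw1]
        symm
        refine Fintype.sum_of_injective j j.injective _ _ (fun i hi => ?_) fun a => ?_
        · exact Function.extend_apply' _ _ _ fun ⟨a, ha⟩ => hi ⟨a, ha⟩
        · simp only [j.injective.extend_apply]
      · intro i _
        by_cases h : ∃ a, j a = i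
        · obtain ⟨a, rfl⟩ := h
          simp only [j.injective.extend_apply]
          exact hz ⟨a, rfl⟩
        · simp only [Function.extend_apply' _ _ _ h]
          exact hy₀
      · symm
        refine Fintype.sum_of_injective j j.injective _ _ (fun i hi => ?_) fun a => ?_
        · have : Function.extend j w 0 i = 0 :=
            Function.extend_apply' _ _ _ fun ⟨a, ha⟩ => hi ⟨a, ha⟩
          simp only [this, zero_smul]
        · simp only [j.injective.extend_apply]
    · rintro _ ⟨⟨w, z⟩, ⟨hw, hz⟩, rfl⟩
      exact (convex_convexHull ℝ K).sum_mem (fun i _ => hw.1 i) hw.2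
        fun i _ => subset_convexHull ℝ K (hz i (mem_univ i))
  rw [heq]
  exact hcomp.isClosed

/-- If a space of forms contains no positive definite form, then some nonzero sum of squares is
annihilated by all of its elements. -/
theorem FormPencil.exists_sum_eq_zero {X : Type*} [AddCommGroup X] [Module ℝ X]
    [FiniteDimensional ℝ X] (𝒯 : Submodule ℝ (BilinForm ℝ X))
    (h : ∀ T ∈ 𝒯, ∃ x, x ≠ 0 ∧ T x x ≤ 0) :
    ∃ (n : ℕ) (x : Fin n → X), (∃ i, x i ≠ 0) ∧ ∀ T ∈ 𝒯, ∑ i, T (x i) (x i) = 0 := by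
  classical
  let e : X ≃ₗ[ℝ] EuclideanSpace ℝ (Fin (Module.finrank ℝ X)) :=
    LinearEquiv.ofFinrankEq _ _ (by simp)
  obtain ⟨s, hs⟩ : 𝒯.FG := IsNoetherian.noetherian 𝒯
  let q : EuclideanSpace ℝ (Fin (Module.finrank ℝ X)) → (s → ℝ) :=
    fun y i => (i : BilinForm ℝ X) (e.symm y) (e.symm y)
  have hq : Continuous q := by
    refine continuous_pi fun i => ?_
    have h : Continuous fun y => ((i : BilinForm ℝ X).compl₁₂ e.symm.toLinearMap
      e.symm.toLinearMap).toContinuousBilinearMap y y := by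
      fun_prop
    simpa using h
  set S := Metric.sphere (0 : EuclideanSpace ℝ (Fin (Module.finrank ℝ X))) 1
  have hS : S.Nonempty := by
    obtain ⟨x, hx, -⟩ := h 0 𝒯.zero_mem
    have hn : 0 < ‖e x‖ := by
      rw [norm_pos_iff]
      simpa using hx
    exact ⟨‖e x‖⁻¹ • e x, by simp [S, norm_smul, hn.ne']⟩
  have hcl := ((isCompact_sphere _ _).image hq : IsCompact (q '' S)).isClosed_convexHull
    (hS.image q)
  have hrep : ∀ T ∈ 𝒯, ∃ r : s → ℝ, ∀ x, T x x = ∑ i, r i * (i : BilinForm ℝ X) x x := by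
    intro T hT
    rw [← hs, Submodule.mem_span_finset'] at hT
    obtain ⟨r, rfl⟩ := hT
    exact ⟨r, fun x => by simp [LinearMap.sum_apply]⟩
  -- The coordinates of `q` are the generators of `𝒯`. A functional separating `0` from the hull has
  -- as coefficients those of an element of `𝒯` that is positive on the unit sphere, which the
  -- hypothesis excludes.
  have h0 : (0 : s → ℝ) ∈ convexHull ℝ (q '' S) := by
    by_contra hnot
    obtain ⟨f, u, hfu, hf⟩ := geometric_hahn_banach_point_closed (convex_convexHull ℝ _) hcl hnot
    rw [map_zero] at hfu
    set T : BilinForm ℝ X := ∑ i, f (Pi.single i 1) • (i : BilinForm ℝ X) with hT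
    have hT𝒯 : T ∈ 𝒯 := 𝒯.sum_mem fun i _ => 𝒯.smul_mem _ (hs ▸ Submodule.subset_span i.2)
    obtain ⟨x, hx, hTx⟩ := h T hT𝒯
    have hn : 0 < ‖e x‖ := by
      rw [norm_pos_iff]
      simpa using hx
    set y := ‖e x‖⁻¹ • e x with hy
    have hys : y ∈ S := by simp [S, hy, norm_smul, hn.ne']
    have h1 : 0 < f (q y) := hfu.trans (hf _ (subset_convexHull ℝ _ ⟨y, hys, rfl⟩))
    have h2 : f (q y) = T (e.symm y) (e.symm y) := by
      have := LinearMap.pi_apply_eq_sum_univ f.toLinearMap (q y)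
      simp only [ContinuousLinearMap.coe_coe] at this
      rw [this, hT]
      simp only [LinearMap.sum_apply, LinearMap.smul_apply, smul_eq_mul, q]
      refine Finset.sum_congr rfl fun i _ => ?_
      have h3 : (fun j => if i = j then (1 : ℝ) else 0) = Pi.single i 1 := by
        funext j
        simp [Pi.single_apply, eq_comm]
      rw [mul_comm, h3]
    have h3 : T (e.symm y) (e.symm y) = ‖e x‖⁻¹ * (‖e x‖⁻¹ * T x x) := by
      simp [hy]
    rw [h2, h3] at h1
    have h4 : 0 < ‖e x‖⁻¹ := inv_pos.2 hn
    nlinarith [mul_pos h4 h4]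
  obtain ⟨ι, _, z, w, hz, -, hw, hw1, hsum⟩ := eq_pos_convex_span_of_mem_convexHull h0
  choose y hyS hyz using fun i => hz (mem_range_self i)
  let φ := Fintype.equivFin ι
  -- Square roots of the convex weights go into the vectors, since the forms are quadratic.
  refine ⟨Fintype.card ι, fun i => √(w (φ.symm i)) • e.symm (y (φ.symm i)), ?_, fun T hT => ?_⟩
  · have : Nonempty ι := by
      by_contra hne
      rw [not_nonempty_iff] at hne
      simp at hw1
    obtain ⟨a⟩ := this
    refine ⟨φ a, ?_⟩
    simp only [Equiv.symm_apply_apply]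
    refine smul_ne_zero (Real.sqrt_pos.2 (hw a)).ne' fun h0 => ?_
    have : y a = 0 := by simpa using h0
    have h2 := hyS a
    rw [this] at h2
    simp [S] at h2
  · rw [Equiv.sum_comp φ.symm fun a => T (√(w a) • e.symm (y a)) (√(w a) • e.symm (y a))]
    obtain ⟨r, hr⟩ := hrep T hT
    have h1 : ∀ a, T (√(w a) • e.symm (y a)) (√(w a) • e.symm (y a))
        = ∑ i, r i * (w a * z a i) := by
      intro a
      rw [hr]
      refine Finset.sum_congr rfl fun i _ => ?_
      have h2 : z a i = (i : BilinForm ℝ X) (e.symm (y a)) (e.symm (y a)) := by rw [← hyz a]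
      simp only [map_smul, LinearMap.smul_apply, smul_eq_mul, h2]
      rw [← mul_assoc (√(w a)), Real.mul_self_sqrt (hw a).le]
    simp only [h1]
    rw [Finset.sum_comm]
    refine Finset.sum_eq_zero fun i _ => ?_
    rw [← Finset.mul_sum]
    have h3 := congrFun hsum i
    simp only [Finset.sum_apply, Pi.smul_apply, smul_eq_mul, Pi.zero_apply] at h3
    rw [h3, mul_zero]

end Separation

/-! ### Extremality and the sign of the velocity form on the radical -/

section Extremality

theorem not_isLittleO_of_mul_le {r : ℝ → ℝ} (hr : r =o[𝓝 0] fun t : ℝ => t) {κ : ℝ} (hκ : 0 < κ) :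
    ¬ ∀ᶠ t in 𝓝[>] (0 : ℝ), κ * t ≤ r t := by
  intro h
  have h1 := (hr.def (half_pos hκ)).filter_mono (nhdsWithin_le_nhds (s := Ioi (0 : ℝ)))
  obtain ⟨t, ⟨h2, h3⟩, ht : 0 < t⟩ := ((h.and h1).and self_mem_nhdsWithin).exists
  rw [Real.norm_eq_abs, Real.norm_eq_abs, abs_of_pos ht] at h3
  have := (abs_le.1 h3).2
  nlinarith

theorem tendsto_neg_nhds_zero : Tendsto (fun t : ℝ => -t) (𝓝 0) (𝓝 0) := by
  simpa using (continuous_neg (G := ℝ)).tendsto 0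

/-- A function with `a - κ |t| ≤ f t` near `0` for every `κ > 0` is at least `a + o(t)`. -/
theorem exists_isLittleO_ge {f : ℝ → ℝ} (a : ℝ)
    (h : ∀ κ > 0, ∀ᶠ t in 𝓝 (0 : ℝ), a - κ * |t| ≤ f t) :
    ∃ r : ℝ → ℝ, r =o[𝓝 0] (fun t : ℝ => t) ∧ ∀ᶠ t in 𝓝 0, a + r t ≤ f t := by
  obtain ⟨r, hr, h1⟩ := exists_isLittleO_le (f := fun t => -f t) (-a) fun κ hκ => by
    filter_upwards [h κ hκ] with t ht
    linarith
  refine ⟨fun t => -r t, hr.neg_left, ?_⟩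
  filter_upwards [h1] with t ht
  linarith

/-- The values cannot all be positive. Applied to `T` and to `-T`, this selects the line of the
radical used in the upper and in the lower estimate. -/
theorem exists_nonpos_of_sum_eq_zero {ι H : Type*} [Fintype ι] [AddCommGroup H] [Module ℝ H]
    {T : BilinForm ℝ H} {u : ι → H} (hne : ∃ i, u i ≠ 0) (hsum : ∑ i, T (u i) (u i) = 0) :
    ∃ i, u i ≠ 0 ∧ T (u i) (u i) ≤ 0 := by
  by_contra! h
  obtain ⟨i, hi⟩ := hne
  have h1 : ∀ j ∈ Finset.univ, 0 ≤ T (u j) (u j) := fun j _ => by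
    by_cases hj : u j = 0
    · simp [hj]
    · exact (h j hj).le
  have h2 := (Finset.sum_eq_zero_iff_of_nonneg h1).1 hsum i (Finset.mem_univ i)
  exact (h i hi).ne' h2

namespace FormPencil.IsFormPath

variable {H : Type*} [AddCommGroup H] [Module ℝ H]
  {A : BilinForm ℝ H} {D M : ℝ → BilinForm ℝ H} {D' M' : BilinForm ℝ H}
  {Wm Wp : Submodule ℝ H} {l N' : ℝ} {k : ℕ} {ν : ℝ → ℝ}

theorem hasDerivAt_reverse (hν : HasDerivAt ν N' 0) : HasDerivAt (fun t => ν (-t)) (-N') 0 := by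
  have h1 : HasDerivAt (fun t : ℝ => -t) (-1) 0 := hasDerivAt_neg 0
  have h2 : HasDerivAt ν N' (-0 : ℝ) := by simpa using hν
  simpa [Function.comp_def] using HasDerivAt.comp (0 : ℝ) h2 h1

theorem reverse_velocity (x : ℝ) :
    x • (-D' - l • -M') + (l * -N') • M 0 = -(x • (D' - l • M') + (l * N') • M 0) := by
  ext u v
  simp only [LinearMap.add_apply, LinearMap.sub_apply, LinearMap.smul_apply, LinearMap.neg_apply,
    smul_eq_mul]
  ring

/-- If the velocity of `l ν` is positive on the radical, neither of the two estimates in the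
definition of extremality holds. -/
theorem exists_nonpos_of_extremal (h : IsFormPath A D M D' M')
    (hinf : ∀ n : ℕ, ∃ S : Submodule ℝ H, Module.finrank ℝ S = n)
    (hs : IsSplitting (D 0 - l • M 0) A Wm Wp) (h1 : Module.finrank ℝ Wm ≤ k)
    (h2 : k < Module.finrank ℝ ↥(Wm ⊔ LinearMap.ker (D 0 - l • M 0)))
    (hν : HasDerivAt ν N' 0) (hν0 : ∀ᶠ t in 𝓝 0, 0 < ν t)
    (hext : (∃ r : ℝ → ℝ, r =o[𝓝 0] (fun t : ℝ => t) ∧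
        ∀ᶠ t in 𝓝 0, minmax (D t) (M t) k * ν t ≤ l * ν 0 + r t) ∨
      (∃ r : ℝ → ℝ, r =o[𝓝 0] (fun t : ℝ => t) ∧
        ∀ᶠ t in 𝓝 0, l * ν 0 + r t ≤ minmax (D t) (M t) k * ν t)) :
    ∃ f ∈ LinearMap.ker (D 0 - l • M 0), f ≠ 0 ∧
      (ν 0 • (D' - l • M') + (l * N') • M 0) f f ≤ 0 := by
  by_contra! hpos
  have := hs.finite_ker
  rw [hs.finrank_sup le_rfl] at h2
  obtain ⟨η, hη, hle⟩ := exists_pos_mul_le_on _ _ (M 0) hpos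
  have hM : ∀ u, u ≠ 0 → 0 < M 0 u u := h.snd_pos.self_of_nhds
  -- With the whole radical in place of `P`, the lower bound with slope `η / 2` to the right of `0`
  -- refutes the first alternative, and the upper bound for the reversed path refutes the second.
  rcases hext with ⟨r, hr, hF⟩ | ⟨r, hr, hF⟩
  · have key := h.eventually_le_minmax_mul hinf hs le_rfl (k := k) (κ := η / 2)
      (by rw [hs.finrank_sup le_rfl]; omega) hν hν0 fun f hf hf0 => by
        have := hle f hf
        have := mul_pos hη (hM f hf0)
        linarith
    refine not_isLittleO_of_mul_le hr (half_pos hη) ?_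
    filter_upwards [key, hF.filter_mono nhdsWithin_le_nhds] with t e1 e2
    linarith
  · have key := h.reverse.eventually_minmax_mul_le (l := l) (k := k) (κ := -(η / 2)) (Wm := Wm)
      (Wp := Wp) (P := LinearMap.ker (D 0 - l • M 0)) (ν := fun t => ν (-t)) (N' := -N')
      (by simpa using hs) (by simp) (by omega) (hasDerivAt_reverse hν)
      (tendsto_neg_nhds_zero.eventually hν0) fun f hf hf0 => by
        have e1 := hle f hf
        have e2 := mul_pos hη (hM f hf0)
        simp only [neg_zero, reverse_velocity]
        rw [LinearMap.neg_apply, LinearMap.neg_apply]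
        linarith
    have hr' : (fun t => -r (-t)) =o[𝓝 0] fun t : ℝ => t := by
      have := (hr.comp_tendsto tendsto_neg_nhds_zero).neg_left
      simpa [Function.comp_def] using this.neg_right
    refine not_isLittleO_of_mul_le hr' (half_pos hη) ?_
    filter_upwards [key, (tendsto_neg_nhds_zero.eventually hF).filter_mono nhdsWithin_le_nhds]
      with t e1 e2
    simp only [neg_zero] at e1
    linarith

variable {ι : Type*} [Fintype ι] {u : ι → H}

/-- A vector `u i` with nonpositive velocity spans a line which, together with the at least
`k`-dimensional `Wm`, is a test space of sufficient dimension. Any `κ > 0` makes the inequality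
strict. -/
theorem eventually_le_of_sum_eq_zero (h : IsFormPath A D M D' M')
    (hs : IsSplitting (D 0 - l • M 0) A Wm Wp) (h1 : k ≤ Module.finrank ℝ Wm)
    (hν : HasDerivAt ν N' 0) (hν0 : ∀ᶠ t in 𝓝 0, 0 < ν t)
    (hu : ∀ i, u i ∈ LinearMap.ker (D 0 - l • M 0)) (hne : ∃ i, u i ≠ 0)
    (hsum : ∑ i, (ν 0 • (D' - l • M') + (l * N') • M 0) (u i) (u i) = 0) {κ : ℝ} (hκ : 0 < κ) :
    ∀ᶠ t in 𝓝[>] (0 : ℝ), minmax (D t) (M t) k * ν t ≤ l * ν 0 + κ * t := by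
  obtain ⟨i, hi, hT⟩ := exists_nonpos_of_sum_eq_zero hne hsum
  refine h.eventually_minmax_mul_le hs (P := Submodule.span ℝ {u i})
    ((Submodule.span_singleton_le_iff_mem _ _).2 (hu i))
    (by rw [finrank_span_singleton hi]; omega) hν hν0 fun f hf hf0 => ?_
  obtain ⟨a, rfl⟩ := Submodule.mem_span_singleton.1 hf
  have h2 := mul_pos hκ (h.snd_pos.self_of_nhds _ hf0)
  refine lt_of_le_of_lt ?_ h2
  simp only [map_smul, LinearMap.smul_apply (a := a), smul_eq_mul] at hT ⊢
  rw [← mul_assoc]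
  exact mul_nonpos_of_nonneg_of_nonpos (mul_self_nonneg a) hT

/-- A vector `u i` with nonnegative velocity spans a line that meets the dimension requirement of
the lower bound, because `Wm` and the radical together have dimension at most `k + 1`. -/
theorem eventually_ge_of_sum_eq_zero (h : IsFormPath A D M D' M')
    (hinf : ∀ n : ℕ, ∃ S : Submodule ℝ H, Module.finrank ℝ S = n)
    (hs : IsSplitting (D 0 - l • M 0) A Wm Wp)
    (h1 : Module.finrank ℝ ↥(Wm ⊔ LinearMap.ker (D 0 - l • M 0)) ≤ k + 1)
    (hν : HasDerivAt ν N' 0) (hν0 : ∀ᶠ t in 𝓝 0, 0 < ν t)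
    (hu : ∀ i, u i ∈ LinearMap.ker (D 0 - l • M 0)) (hne : ∃ i, u i ≠ 0)
    (hsum : ∑ i, (ν 0 • (D' - l • M') + (l * N') • M 0) (u i) (u i) = 0) {κ : ℝ} (hκ : 0 < κ) :
    ∀ᶠ t in 𝓝[>] (0 : ℝ), l * ν 0 - κ * t ≤ minmax (D t) (M t) k * ν t := by
  obtain ⟨i, hi, hT⟩ := exists_nonpos_of_sum_eq_zero
    (T := -(ν 0 • (D' - l • M') + (l * N') • M 0)) hne (by
      have := congrArg Neg.neg hsum
      rwa [← Finset.sum_neg_distrib, neg_zero] at this)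
  have key := h.eventually_le_minmax_mul hinf hs (k := k) (κ := -κ) (P := Submodule.span ℝ {u i})
    ((Submodule.span_singleton_le_iff_mem _ _).2 (hu i))
    (by rw [finrank_span_singleton hi]; omega) hν hν0 fun f hf hf0 => by
      obtain ⟨a, rfl⟩ := Submodule.mem_span_singleton.1 hf
      have h2 := mul_pos hκ (h.snd_pos.self_of_nhds _ hf0)
      rw [LinearMap.neg_apply, LinearMap.neg_apply, neg_nonpos] at hT
      rw [neg_mul]
      refine (neg_neg_of_pos h2).trans_le ?_
      simp only [map_smul, LinearMap.smul_apply (a := a), smul_eq_mul] at hT ⊢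
      rw [← mul_assoc]
      exact mul_nonneg (mul_self_nonneg a) hT
  filter_upwards [key] with t ht
  linarith

theorem reverse_sum_eq_zero
    (hsum : ∑ i, (ν 0 • (D' - l • M') + (l * N') • M 0) (u i) (u i) = 0) :
    ∑ i, (ν (-0) • (-D' - l • -M') + (l * -N') • M (-0)) (u i) (u i) = 0 := by
  simp only [neg_zero, reverse_velocity]
  have := congrArg Neg.neg hsum
  rwa [← Finset.sum_neg_distrib, neg_zero] at this

/-- Two-sided estimate when `l` is the first value of its cluster. -/
theorem exists_isLittleO_le_of_sum_eq_zero (h : IsFormPath A D M D' M')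
    (hs : IsSplitting (D 0 - l • M 0) A Wm Wp) (hl : minmax (D 0) (M 0) k = l)
    (h1 : k ≤ Module.finrank ℝ Wm)
    (hν : HasDerivAt ν N' 0) (hν0 : ∀ᶠ t in 𝓝 0, 0 < ν t)
    (hu : ∀ i, u i ∈ LinearMap.ker (D 0 - l • M 0)) (hne : ∃ i, u i ≠ 0)
    (hsum : ∑ i, (ν 0 • (D' - l • M') + (l * N') • M 0) (u i) (u i) = 0) :
    ∃ r : ℝ → ℝ, r =o[𝓝 0] (fun t : ℝ => t) ∧
      ∀ᶠ t in 𝓝 0, minmax (D t) (M t) k * ν t ≤ l * ν 0 + r t := by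
  refine exists_isLittleO_le _ fun κ hκ => eventually_nhds_zero_of_right_left ?_ ?_ ?_
  · simp [hl]
  · filter_upwards [h.eventually_le_of_sum_eq_zero hs h1 hν hν0 hu hne hsum hκ,
      self_mem_nhdsWithin] with t ht (ht0 : 0 < t)
    rwa [abs_of_pos ht0]
  · filter_upwards [h.reverse.eventually_le_of_sum_eq_zero (k := k) (l := l) (Wm := Wm) (Wp := Wp)
      (ν := fun t => ν (-t)) (N' := -N') (by simpa using hs) h1 (hasDerivAt_reverse hν)
      (tendsto_neg_nhds_zero.eventually hν0) (by simpa using hu) hne (reverse_sum_eq_zero hsum) hκ,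
      self_mem_nhdsWithin] with t ht (ht0 : 0 < t)
    rw [abs_neg, abs_of_pos ht0]
    simpa using ht

/-- Two-sided estimate when `l` is the last value of its cluster. -/
theorem exists_isLittleO_ge_of_sum_eq_zero (h : IsFormPath A D M D' M')
    (hinf : ∀ n : ℕ, ∃ S : Submodule ℝ H, Module.finrank ℝ S = n)
    (hs : IsSplitting (D 0 - l • M 0) A Wm Wp) (hl : minmax (D 0) (M 0) k = l)
    (h1 : Module.finrank ℝ ↥(Wm ⊔ LinearMap.ker (D 0 - l • M 0)) ≤ k + 1)
    (hν : HasDerivAt ν N' 0) (hν0 : ∀ᶠ t in 𝓝 0, 0 < ν t)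
    (hu : ∀ i, u i ∈ LinearMap.ker (D 0 - l • M 0)) (hne : ∃ i, u i ≠ 0)
    (hsum : ∑ i, (ν 0 • (D' - l • M') + (l * N') • M 0) (u i) (u i) = 0) :
    ∃ r : ℝ → ℝ, r =o[𝓝 0] (fun t : ℝ => t) ∧
      ∀ᶠ t in 𝓝 0, l * ν 0 + r t ≤ minmax (D t) (M t) k * ν t := by
  refine exists_isLittleO_ge _ fun κ hκ => eventually_nhds_zero_of_right_left ?_ ?_ ?_
  · simp [hl]
  · filter_upwards [h.eventually_ge_of_sum_eq_zero hinf hs h1 hν hν0 hu hne hsum hκ,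
      self_mem_nhdsWithin] with t ht (ht0 : 0 < t)
    rwa [abs_of_pos ht0]
  · filter_upwards [h.reverse.eventually_ge_of_sum_eq_zero (k := k) (l := l) (Wm := Wm) (Wp := Wp)
      (ν := fun t => ν (-t)) (N' := -N') hinf (by simpa using hs) (by rw [neg_zero]; exact h1)
      (hasDerivAt_reverse hν)
      (tendsto_neg_nhds_zero.eventually hν0) (by simpa using hu) hne (reverse_sum_eq_zero hsum) hκ,
      self_mem_nhdsWithin] with t ht (ht0 : 0 < t)
    rw [abs_neg, abs_of_pos ht0]
    simpa using ht

end FormPencil.IsFormPath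

open scoped Pointwise in
theorem FormPencil.minmax_smul {H : Type*} [AddCommGroup H] [Module ℝ H] (D M : BilinForm ℝ H)
    (k : ℕ) {b : ℝ} (hb : 0 < b) : minmax D (b • M) k = b⁻¹ * minmax D M k := by
  have hset : {x : ℝ | ∃ S : Submodule ℝ H, Module.finrank ℝ S = k + 1 ∧
      ∀ p ∈ S, D p p ≤ x * (b • M) p p} = b⁻¹ • {x : ℝ | ∃ S : Submodule ℝ H,
        Module.finrank ℝ S = k + 1 ∧ ∀ p ∈ S, D p p ≤ x * M p p} := by
    ext x
    rw [mem_inv_smul_set_iff₀ hb.ne']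
    simp only [mem_ofPred_eq, LinearMap.smul_apply, smul_eq_mul]
    refine exists_congr fun S => and_congr_right fun _ => forall₂_congr fun p _ => ?_
    rw [mul_left_comm, mul_assoc]
  rw [minmax, hset, Real.sInf_smul_of_nonneg (inv_nonneg.2 hb.le)]
  rfl

end Extremality

/-! ### Fundamental lemma of the calculus of variations on the unit interval -/

section FundamentalLemma

theorem ae_eq_zero_of_integral_mul_contDiff_eq_zero {h : I → ℝ} (hi : Integrable h)
    (h0 : ∀ Φ : ℝ → ℝ, ContDiff ℝ ∞ Φ → ∫ x : I, h x * Φ x = 0) : ∀ᵐ x, h x = 0 := by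
  have hem : MeasurableEmbedding ((↑) : I → ℝ) := MeasurableEmbedding.subtype_coe measurableSet_Icc
  have hcomp : ∀ x : I, IccExtend (zero_le_one' ℝ) h x = h x := fun x => IccExtend_val _ _ x
  have hint : Integrable (IccExtend (zero_le_one' ℝ) h) ((volume : Measure I).map (↑)) := by
    rw [hem.integrable_map_iff]
    exact hi.congr (Eventually.of_forall fun x => (hcomp x).symm)
  have key := ae_eq_zero_of_integral_contDiff_smul_eq_zero hint.locallyIntegrable
    fun Φ hΦ _ => by
      rw [hem.integral_map]
      refine Eq.trans (integral_congr_ae (Eventually.of_forall fun x => ?_)) (h0 Φ hΦ)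
      simp only [hcomp, smul_eq_mul, mul_comm]
  rw [hem.ae_map_iff] at key
  filter_upwards [key] with x hx
  rwa [hcomp] at hx

theorem MeasureTheory.Integrable.mul_continuous_unitInterval {f b : I → ℝ} (hf : Integrable f)
    (hb : Continuous b) : Integrable fun x => f x * b x := by
  obtain ⟨C, hC⟩ := isCompact_univ.exists_bound_of_continuousOn hb.continuousOn
  exact hf.mul_bdd hb.aestronglyMeasurable (Eventually.of_forall fun x => hC x (mem_univ x))

end FundamentalLemma

/-! ### The pairing with directions, and conserved energy of eigenfunctions -/

namespace EdgeGraph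

open FormPencil

section InnerProduct

variable {E : Type*} {c : MetricClass} {g A₁ A₂ B₁ B₂ φ ψ φ' ψ' : EdgeFun E}

theorem integrable_innerH (hg : ∀ e, Continuous (g e)) (h1 : ∀ e, Integrable (A₁ e))
    (h2 : ∀ e, Integrable (A₂ e)) (hφ : ∀ e, Continuous (φ e)) (hψ : ∀ e, Continuous (ψ e))
    (e : E) : Integrable fun x => (A₁ e x * φ e x + A₂ e x * ψ e x) * √(g e x) :=
  Integrable.mul_continuous_unitInterval
    ((Integrable.mul_continuous_unitInterval (h1 e) (hφ e)).add
      (Integrable.mul_continuous_unitInterval (h2 e) (hψ e))) (hg e).sqrt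

variable [Fintype E]

theorem innerH_add_mul_right (hg : ∀ e, Continuous (g e)) (h1 : ∀ e, Integrable (A₁ e))
    (h2 : ∀ e, Integrable (A₂ e)) (hφ : ∀ e, Continuous (φ e)) (hψ : ∀ e, Continuous (ψ e))
    (hφ' : ∀ e, Continuous (φ' e)) (hψ' : ∀ e, Continuous (ψ' e)) (t : ℝ) :
    innerH g A₁ A₂ (fun e x => φ e x + t * φ' e x) (fun e x => ψ e x + t * ψ' e x)
      = innerH g A₁ A₂ φ ψ + t * innerH g A₁ A₂ φ' ψ' := by
  rw [innerH, innerH, innerH, Finset.mul_sum, ← Finset.sum_add_distrib]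
  refine Finset.sum_congr rfl fun e _ => ?_
  rw [← integral_const_mul, ← integral_add (integrable_innerH hg h1 h2 hφ hψ e)
    ((integrable_innerH hg h1 h2 hφ' hψ' e).const_mul t)]
  exact integral_congr_ae (Eventually.of_forall fun x => by ring)

theorem innerH_sub_left (hg : ∀ e, Continuous (g e)) (h1 : ∀ e, Integrable (A₁ e))
    (h2 : ∀ e, Integrable (A₂ e)) (h3 : ∀ e, Integrable (B₁ e)) (h4 : ∀ e, Integrable (B₂ e))
    (hφ : ∀ e, Continuous (φ e)) (hψ : ∀ e, Continuous (ψ e)) :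
    innerH g (A₁ - B₁) (A₂ - B₂) φ ψ = innerH g A₁ A₂ φ ψ - innerH g B₁ B₂ φ ψ := by
  rw [innerH, innerH, innerH, ← Finset.sum_sub_distrib]
  refine Finset.sum_congr rfl fun e _ => ?_
  rw [← integral_sub (integrable_innerH hg h1 h2 hφ hψ e) (integrable_innerH hg h3 h4 hφ hψ e)]
  exact integral_congr_ae (Eventually.of_forall fun x => by simp only [Pi.sub_apply]; ring)

theorem innerH_sum_left {ι : Type*} (s : Finset ι) {A B : ι → EdgeFun E}
    (hg : ∀ e, Continuous (g e)) (h1 : ∀ i e, Integrable (A i e)) (h2 : ∀ i e, Integrable (B i e))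
    (hφ : ∀ e, Continuous (φ e)) (hψ : ∀ e, Continuous (ψ e)) :
    ∑ i ∈ s, innerH g (A i) (B i) φ ψ
      = innerH g (fun e x => ∑ i ∈ s, A i e x) (fun e x => ∑ i ∈ s, B i e x) φ ψ := by
  simp only [innerH]
  rw [Finset.sum_comm]
  refine Finset.sum_congr rfl fun e _ => ?_
  rw [← integral_finsetSum _ fun i _ => integrable_innerH hg (h1 i) (h2 i) hφ hψ e]
  refine integral_congr_ae (Eventually.of_forall fun x => ?_)
  simp only [Finset.sum_mul, ← Finset.sum_add_distrib]

theorem integral_sub_eq_zero_iff {f h : I → ℝ} (hf : Integrable f) (hh : Integrable h) :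
    ∫ x, (f x - h x) = 0 ↔ ∫ x, f x = ∫ x, h x := by
  rw [integral_sub hf hh, sub_eq_zero]

open scoped Classical in
omit [Fintype E] in
theorem smoothOnEdges_single (e : E) {Φ : ℝ → ℝ} (hΦ : ContDiff ℝ ∞ Φ) :
    SmoothOnEdges (Pi.single e fun x : I => Φ x) := by
  intro e'
  by_cases he : e' = e
  · subst he
    exact ⟨Φ, hΦ, fun x => by simp⟩
  · exact ⟨0, contDiff_const, fun x => by simp [he]⟩

omit [Fintype E] in
theorem smoothOnEdges_zero : SmoothOnEdges (0 : EdgeFun E) :=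
  fun _ => ⟨0, contDiff_const, fun _ => rfl⟩

omit [Fintype E] in
theorem metricDirection_zero : MetricDirection c (0 : EdgeFun E) := by
  cases c with
  | edgewiseConstant => exact fun _ _ _ => rfl
  | edgewiseSmooth => exact smoothOnEdges_zero

/-- Orthogonality to all smooth directions. -/
theorem eq_of_forall_innerH_eq (hg : ∀ e, Continuous (g e)) (hpos : ∀ e x, 0 < g e x)
    (h1 : ∀ e, Integrable (A₁ e)) (h2 : ∀ e, Integrable (A₂ e)) (h3 : ∀ e, Integrable (B₁ e))
    (h4 : ∀ e, Integrable (B₂ e))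
    (h : ∀ φ ψ, MetricDirection c φ → SmoothOnEdges ψ →
      innerH g A₁ A₂ φ ψ = innerH g B₁ B₂ φ ψ) :
    EqOnDirections c g A₁ B₁ ∧ ∀ e, ∀ᵐ x, A₂ e x = B₂ e x := by
  classical
  have hsq : ∀ {f : I → ℝ} (e : E), Integrable f → Integrable fun x => f x * √(g e x) :=
    fun e hf => Integrable.mul_continuous_unitInterval hf (hg e).sqrt
  have hz : ∀ {A B : EdgeFun E} (e : E), (∀ e, Integrable (A e)) → (∀ e, Integrable (B e)) →
      (∀ Φ : ℝ → ℝ, ContDiff ℝ ∞ Φ → ∫ x : I, (A e x - B e x) * √(g e x) * Φ x = 0) →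
      ∀ᵐ x, A e x = B e x := fun e hA hB hz => by
    filter_upwards [ae_eq_zero_of_integral_mul_contDiff_eq_zero (hsq e ((hA e).sub (hB e))) hz]
      with x hx
    have := (mul_eq_zero.1 hx).resolve_right (Real.sqrt_pos.2 (hpos e x)).ne'
    simpa [sub_eq_zero] using this
  have h' : ∀ φ ψ, MetricDirection c φ → SmoothOnEdges ψ →
      innerH g (A₁ - B₁) (A₂ - B₂) φ ψ = 0 := fun φ ψ hφ hψ => by
    rw [innerH_sub_left hg h1 h2 h3 h4 hφ.smoothOnEdges.continuous hψ.continuous, h φ ψ hφ hψ,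
      sub_self]
  have hfst : ∀ (e : E) (Φ : I → ℝ), innerH g (A₁ - B₁) (A₂ - B₂) (Pi.single e Φ) 0
      = ∫ x, (A₁ e x - B₁ e x) * √(g e x) * Φ x := fun e Φ => by
    rw [innerH, Finset.sum_eq_single e]
    · refine integral_congr_ae (Eventually.of_forall fun x => ?_)
      simp only [Pi.sub_apply, Pi.single_eq_same, Pi.zero_apply]
      ring
    · intro e' _ he
      simp [he]
    · simp
  refine ⟨?_, fun e => hz e h2 h4 fun Φ hΦ => ?_⟩
  · cases c with
    | edgewiseConstant =>
      intro e
      have := h' (Pi.single e fun _ => 1) 0 (fun e' x y => by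
        by_cases he : e' = e
        · subst he; simp
        · simp [he]) smoothOnEdges_zero
      rw [hfst] at this
      rw [← integral_sub_eq_zero_iff (hsq e (h1 e)) (hsq e (h3 e)), ← this]
      exact integral_congr_ae (Eventually.of_forall fun x => by ring)
    | edgewiseSmooth =>
      refine fun e => hz e h1 h3 fun Φ hΦ => ?_
      rw [← hfst e fun x => Φ x]
      exact h' _ _ (smoothOnEdges_single e hΦ) smoothOnEdges_zero
  · rw [← h' 0 (Pi.single e fun x => Φ x) metricDirection_zero (smoothOnEdges_single e hΦ), innerH,
      Finset.sum_eq_single e]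
    · refine integral_congr_ae (Eventually.of_forall fun x => ?_)
      simp only [Pi.sub_apply, Pi.single_eq_same, Pi.zero_apply]
      ring
    · intro e' _ he
      simp [he]
    · simp

theorem innerH_eq_of_eqOnDirections (hg : ∀ e, Continuous (g e))
    (h1 : ∀ e, Integrable (A₁ e)) (h2 : ∀ e, Integrable (A₂ e)) (h3 : ∀ e, Integrable (B₁ e))
    (h4 : ∀ e, Integrable (B₂ e)) (hφ : ∀ e, Continuous (φ e)) (hψ : ∀ e, Continuous (ψ e))
    (hc : c = MetricClass.edgewiseConstant → ∀ e x y, φ e x = φ e y)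
    (hfst : EqOnDirections c g A₁ B₁) (hsnd : ∀ e, ∀ᵐ x, A₂ e x = B₂ e x) :
    innerH g A₁ A₂ φ ψ = innerH g B₁ B₂ φ ψ := by
  have hsplit : ∀ {A B : EdgeFun E}, (∀ e, Integrable (A e)) → (∀ e, Integrable (B e)) → ∀ e,
      ∫ x, (A e x * φ e x + B e x * ψ e x) * √(g e x)
        = (∫ x, A e x * φ e x * √(g e x)) + ∫ x, B e x * ψ e x * √(g e x) := fun hA hB e => by
    simp only [add_mul]
    exact integral_add
      (Integrable.mul_continuous_unitInterval
        (Integrable.mul_continuous_unitInterval (hA e) (hφ e)) (hg e).sqrt)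
      (Integrable.mul_continuous_unitInterval
        (Integrable.mul_continuous_unitInterval (hB e) (hψ e)) (hg e).sqrt)
  refine Finset.sum_congr rfl fun e _ => ?_
  rw [hsplit h1 h2, hsplit h3 h4]
  congr 1
  · cases c with
    | edgewiseConstant =>
      have hx : ∀ (A : EdgeFun E) x, A e x * φ e x * √(g e x) = φ e 0 * (A e x * √(g e x)) :=
        fun A x => by rw [hc rfl e x 0]; ring
      simp only [hx, integral_const_mul, hfst e]
    | edgewiseSmooth =>
      refine integral_congr_ae ?_
      filter_upwards [hfst e] with x hx
      rw [hx]
  · refine integral_congr_ae ?_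
    filter_upwards [hsnd e] with x hx
    rw [hx]

omit [Fintype E] in
/-- The first equation of the criterion in terms of the density that is dual to the metric. -/
theorem IsPair.eqOnDirections_iff {ρ S : EdgeFun E} (h : IsPair c g ρ)
    (hS : ∀ e, Integrable (S e)) (h1 : ∀ e, Integrable (A₁ e)) (h2 : ∀ e, Integrable (A₂ e)) :
    EqOnDirections c g S (fun e x => 2 * g e x * A₁ e x - ρ e x * A₂ e x) ↔
      EqOnDirections c g (fun e x => (S e x + ρ e x * A₂ e x) / (2 * g e x)) A₁ := by
  cases c with
  | edgewiseConstant =>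
    refine forall_congr' fun e => ?_
    have hc : ∀ x, g e x = g e 0 := fun x => h.metric e x 0
    have hg := h.metric_pos e 0
    have hρ : Integrable fun x => ρ e x * A₂ e x := by
      simpa only [mul_comm] using
        Integrable.mul_continuous_unitInterval (h2 e) (h.continuous_density e)
    simp only [hc, integral_mul_const]
    have hs : √(g e 0) ≠ 0 := (Real.sqrt_pos.2 hg).ne'
    rw [mul_left_inj' hs, mul_left_inj' hs, integral_sub ((h1 e).const_mul _) hρ,
      integral_const_mul, integral_div, integral_add (hS e) hρ, div_eq_iff (by positivity)]
    constructor <;> intro H <;> linarith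
  | edgewiseSmooth =>
    refine forall_congr' fun e => eventually_congr (Eventually.of_forall fun x => ?_)
    have hg := h.metric_pos e x
    rw [div_eq_iff (by positivity)]
    constructor <;> intro H <;> linarith

omit [Fintype E] in
theorem EqOnDirections.congr_left {S S' : EdgeFun E} (hS : EqOnDirections c g S A₁)
    (he : ∀ e, ∀ᵐ x, S e x = S' e x) : EqOnDirections c g S' A₁ := by
  cases c with
  | edgewiseConstant =>
    intro e
    rw [← hS e]
    refine integral_congr_ae ?_
    filter_upwards [he e] with x hx
    rw [hx]
  | edgewiseSmooth =>
    intro e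
    filter_upwards [hS e, he e] with x h1 h2
    rw [← h2, h1]

end InnerProduct

section Eigenfunctions

variable {V E : Type*} [Fintype E] {G : EdgeGraph V E} {c : MetricClass} {g ρ f φ ψ : EdgeFun E}
  {l : ℝ}

theorem InEigenspace.exists_extension (hf : G.InEigenspace g ρ l f) (e : E) :
    ∃ F : ℝ → ℝ, ContDiff ℝ 2 F ∧ (∀ x : I, f e x = F x) ∧
      ∀ x : I, edgeDeriv (f e) x = deriv F x := by
  obtain ⟨F, hF, hx⟩ := hf.contDiff e
  exact ⟨F, hF, hx, fun x => edgeDeriv_eq hx (hF.differentiable (by norm_num) x).hasDerivAt⟩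

theorem InEigenspace.continuous (hf : G.InEigenspace g ρ l f) (e : E) : Continuous (f e) := by
  obtain ⟨F, hF, hx, -⟩ := hf.exists_extension e
  rw [funext hx]
  exact hF.continuous.comp continuous_subtype_val

theorem InEigenspace.continuous_edgeDeriv (hf : G.InEigenspace g ρ l f) (e : E) :
    Continuous (edgeDeriv (f e)) := by
  obtain ⟨F, hF, -, hx⟩ := hf.exists_extension e
  rw [funext hx]
  exact (hF.continuous_deriv (by norm_num)).comp continuous_subtype_val

theorem InEigenspace.continuous_gradSq (h : IsPair c g ρ) (hf : G.InEigenspace g ρ l f) (e : E) :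
    Continuous (gradSq g f e) :=
  ((hf.continuous_edgeDeriv e).pow 2).div (h.continuous_metric e) fun x => (h.metric_pos e x).ne'

/-- Energy conservation for the oscillator `f'' = -l ρ g f` with constant coefficients. -/
theorem InEigenspace.exists_gradSq_add_eq (h : IsPair c g ρ) (hf : G.InEigenspace g ρ l f) {e : E}
    (hg : ∀ x, g e x = g e 0) (hρ : ∀ x, ρ e x = ρ e 0) :
    ∃ w, ∀ x, gradSq g f e x + l * ρ e x * f e x ^ 2 = w := by
  obtain ⟨F, hF, hx, hd⟩ := hf.exists_extension e
  have hg0 := h.metric_pos e 0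
  have hF2 : Differentiable ℝ (deriv F) := by
    have : ContDiff ℝ 1 (deriv F) := by
      rw [show (2 : WithTop ℕ∞) = 1 + 1 from rfl, contDiff_succ_iff_deriv] at hF
      exact hF.2.2
    exact this.differentiable (by norm_num)
  have hF1 : Differentiable ℝ F := hF.differentiable (by norm_num)
  have hode : ∀ x : I, deriv (deriv F) x = -(g e 0 * (l * ρ e 0 * F x)) := fun x => by
    have h1 := hf.equation e x
    have h2 : edgeDeriv (fun y => edgeDeriv (f e) y / √(g e y)) x
        = deriv (deriv F) x / √(g e 0) :=
      edgeDeriv_eq (F := fun y => deriv F y / √(g e 0)) (fun y => by rw [hd, hg])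
        ((hF2 x).hasDerivAt.div_const _)
    rw [laplacian, h2, hg x, hρ x, hx, div_div, Real.mul_self_sqrt hg0.le, neg_eq_iff_eq_neg,
      div_eq_iff hg0.ne'] at h1
    rw [h1]
    ring
  -- Energy of the oscillator; its derivative is `2 F'` times a factor that vanishes on `[0,1]` by
  -- the equation.
  let W : ℝ → ℝ := fun x => deriv F x ^ 2 / g e 0 + l * ρ e 0 * F x ^ 2
  have hW : ∀ x, HasDerivAt W (2 * deriv F x * (deriv (deriv F) x / g e 0 + l * ρ e 0 * F x)) x :=
    fun x => by
      have h1 := (((hF2 x).hasDerivAt.pow 2).div_const (g e 0)).add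
        (((hF1 x).hasDerivAt.pow 2).const_mul (l * ρ e 0))
      refine h1.congr_deriv ?_
      norm_num
      ring
  have hc := constant_of_has_deriv_right_zero (f := W) (a := 0) (b := 1)
    (fun x _ => (hW x).continuousAt.continuousWithinAt) fun x hx1 => by
      have := (hW x).hasDerivWithinAt (s := Ici x)
      have h2 := hode ⟨x, hx1.1, hx1.2.le⟩
      rw [h2] at this
      convert this using 1
      field_simp
      ring
  refine ⟨W 0, fun x => ?_⟩
  rw [← hc x x.2, gradSq, hd, hx, hg, hρ]

/-- Density dual to the metric in the derivative of the quadratic form. -/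
theorem IsPair.velocityForm_apply (h : IsPair c g ρ) (hφ : ∀ e, Continuous (φ e))
    (hψ : ∀ e, Continuous (ψ e)) {u : G.sobolev}
    (hu : ∀ e, ∀ᵐ x, u.1.2 e x = edgeDeriv (u.1.1 e) x) :
    (G.derivForm (stiffnessVelocity g φ) - l • G.massForm (massVelocity g ρ φ ψ)) u u
      = -innerH g (fun e x => (gradSq g u.1.1 e x + l * ρ e x * u.1.1 e x ^ 2) / (2 * g e x))
          (fun e x => l * u.1.1 e x ^ 2) φ ψ := by
  simp only [LinearMap.sub_apply, LinearMap.smul_apply, smul_eq_mul, derivForm_apply,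
    massForm_apply]
  rw [innerH, Finset.mul_sum, ← Finset.sum_sub_distrib, ← Finset.sum_neg_distrib]
  refine Finset.sum_congr rfl fun e _ => ?_
  have hc : Continuous fun x => l * (massVelocity g ρ φ ψ e x * (u.1.1 e x * u.1.1 e x)) :=
    ((massVelocity g ρ φ ψ e).continuous.mul
      ((sobolev_continuous u e).mul (sobolev_continuous u e))).const_mul l
  rw [← integral_const_mul, ← integral_sub (integrable_mul_mul_of_L2 _ _ _)
    hc.integrable_unitInterval, ← integral_neg]
  refine integral_congr_ae ?_
  filter_upwards [hu e] with x hx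
  have hg := h.metric_pos e x
  have hs := h.sqrt_pos e x
  have hss : √(g e x) ^ 2 = g e x := Real.sq_sqrt hg.le
  rw [hx, h.stiffnessVelocity_apply (hφ e), h.massVelocity_apply (hφ e) (hψ e), gradSq]
  generalize edgeDeriv (u.1.1 e) x = d
  generalize u.1.1 e x = y
  generalize √(g e x) = s at *
  rw [← hss]
  field_simp
  ring

end Eigenfunctions

end EdgeGraph

/-! ### Direction forms: extremality of pairs in terms of the radical -/

theorem FormPencil.exists_mem_sum_eq_zero {H : Type*} [AddCommGroup H] [Module ℝ H]
    (K : Submodule ℝ H) [FiniteDimensional ℝ K] (𝒯 : Submodule ℝ (BilinForm ℝ H))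
    (h : ∀ T ∈ 𝒯, ∃ x ∈ K, x ≠ 0 ∧ T x x ≤ 0) :
    ∃ n, ∃ x : Fin n → H, (∀ i, x i ∈ K) ∧ (∃ i, x i ≠ 0) ∧ ∀ T ∈ 𝒯, ∑ i, T (x i) (x i) = 0 := by
  let R : BilinForm ℝ H →ₗ[ℝ] BilinForm ℝ K :=
    { toFun := fun T => T.restrict K
      map_add' := fun _ _ => rfl
      map_smul' := fun _ _ => rfl }
  obtain ⟨n, x, ⟨i, hi⟩, hx⟩ := exists_sum_eq_zero (𝒯.map R) (by
    rintro _ ⟨T, hT, rfl⟩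
    obtain ⟨y, hy, hy0, hle⟩ := h T hT
    exact ⟨⟨y, hy⟩, fun h0 => hy0 (congrArg Subtype.val h0), hle⟩)
  exact ⟨n, fun i => x i, fun i => (x i).2, ⟨i, fun h0 => hi (Subtype.ext h0)⟩,
    fun T hT => hx _ ⟨T, hT, rfl⟩⟩

namespace EdgeGraph

open FormPencil

section

variable {V E : Type*} [Fintype E] {G : EdgeGraph V E} {c : MetricClass}
  {N : EdgeFun E → EdgeFun E → ℝ} {g ρ N₁ N₂ φ ψ φ' ψ' : EdgeFun E} {k : ℕ} {ε : ℝ}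
  {γ τ : ℝ → EdgeFun E}

/-- The form on the radical of the pencil whose values are the velocities of the branches of
`l N`. -/
noncomputable def directionForm (G : EdgeGraph V E) (g ρ : EdgeFun E) (N₀ l : ℝ)
    (N₁ N₂ φ ψ : EdgeFun E) : BilinForm ℝ G.sobolev :=
  N₀ • (G.derivForm (stiffnessVelocity g φ) - l • G.massForm (massVelocity g ρ φ ψ))
    + (l * innerH g N₁ N₂ φ ψ) • G.massForm (massDensity g ρ)

theorem sum_directionForm {ι : Type*} [Fintype ι] (u : ι → G.sobolev) (N₀ l : ℝ) :
    ∑ i, G.directionForm g ρ N₀ l N₁ N₂ φ ψ (u i) (u i)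
      = N₀ * ∑ i, (G.derivForm (stiffnessVelocity g φ) - l • G.massForm (massVelocity g ρ φ ψ))
          (u i) (u i)
        + l * innerH g N₁ N₂ φ ψ * ∑ i, G.massForm (massDensity g ρ) (u i) (u i) := by
  rw [Finset.mul_sum, Finset.mul_sum, ← Finset.sum_add_distrib]
  rfl

omit [Fintype E] in
theorem IsPair.stiffnessVelocity_add_mul (h : IsPair c g ρ) (hφ : ∀ e, Continuous (φ e))
    (hφ' : ∀ e, Continuous (φ' e)) (t : ℝ) :
    stiffnessVelocity g (fun e x => φ e x + t * φ' e x)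
      = stiffnessVelocity g φ + t • stiffnessVelocity g φ' := by
  ext e x
  simp only [Pi.add_apply, Pi.smul_apply, ContinuousMap.add_apply, ContinuousMap.smul_apply,
    smul_eq_mul]
  rw [h.stiffnessVelocity_apply (hφ e), h.stiffnessVelocity_apply (hφ' e),
    h.stiffnessVelocity_apply (by have := hφ e; have := hφ' e; fun_prop)]
  ring

omit [Fintype E] in
theorem IsPair.massVelocity_add_mul (h : IsPair c g ρ) (hφ : ∀ e, Continuous (φ e))
    (hφ' : ∀ e, Continuous (φ' e)) (hψ : ∀ e, Continuous (ψ e)) (hψ' : ∀ e, Continuous (ψ' e))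
    (t : ℝ) :
    massVelocity g ρ (fun e x => φ e x + t * φ' e x) (fun e x => ψ e x + t * ψ' e x)
      = massVelocity g ρ φ ψ + t • massVelocity g ρ φ' ψ' := by
  ext e x
  simp only [Pi.add_apply, Pi.smul_apply, ContinuousMap.add_apply, ContinuousMap.smul_apply,
    smul_eq_mul]
  rw [h.massVelocity_apply (hφ e) (hψ e), h.massVelocity_apply (hφ' e) (hψ' e),
    h.massVelocity_apply (by have := hφ e; have := hφ' e; fun_prop)
      (by have := hψ e; have := hψ' e; fun_prop)]
  ring

theorem IsGradient.integrable_fst (h : IsGradient c N g ρ N₁ N₂) (e : E) : Integrable (N₁ e) :=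
  (h.memLp_fst e).integrable (by norm_num)

theorem IsGradient.integrable_snd (h : IsGradient c N g ρ N₁ N₂) (e : E) : Integrable (N₂ e) :=
  (h.memLp_snd e).integrable (by norm_num)

theorem IsPair.directionForm_add_mul (h : IsPair c g ρ) (h1 : ∀ e, Integrable (N₁ e))
    (h2 : ∀ e, Integrable (N₂ e)) (hφ : ∀ e, Continuous (φ e))
    (hφ' : ∀ e, Continuous (φ' e)) (hψ : ∀ e, Continuous (ψ e)) (hψ' : ∀ e, Continuous (ψ' e))
    (N₀ l t : ℝ) :
    G.directionForm g ρ N₀ l N₁ N₂ (fun e x => φ e x + t * φ' e x) (fun e x => ψ e x + t * ψ' e x)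
      = G.directionForm g ρ N₀ l N₁ N₂ φ ψ + t • G.directionForm g ρ N₀ l N₁ N₂ φ' ψ' := by
  rw [directionForm, directionForm, directionForm, h.stiffnessVelocity_add_mul hφ hφ',
    h.massVelocity_add_mul hφ hφ' hψ hψ',
    innerH_add_mul_right h.continuous_metric h1 h2 hφ hψ hφ' hψ', derivForm_add, derivForm_smul,
    massForm_add, massForm_smul]
  ext u v
  simp only [LinearMap.add_apply, LinearMap.sub_apply, LinearMap.smul_apply, smul_eq_mul]
  ring

/-- The forms of all directions make up a linear space. -/
theorem IsPair.exists_submodule_directionForm (h : IsPair c g ρ) (h1 : ∀ e, Integrable (N₁ e))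
    (h2 : ∀ e, Integrable (N₂ e)) (N₀ l : ℝ) :
    ∃ 𝒯 : Submodule ℝ (BilinForm ℝ G.sobolev), ∀ T, T ∈ 𝒯 ↔ ∃ φ ψ, MetricDirection c φ ∧
      SmoothOnEdges ψ ∧ T = G.directionForm g ρ N₀ l N₁ N₂ φ ψ := by
  have hadd : ∀ {φ ψ φ' ψ' : EdgeFun E}, MetricDirection c φ → SmoothOnEdges ψ →
      MetricDirection c φ' → SmoothOnEdges ψ' → ∀ t : ℝ,
      G.directionForm g ρ N₀ l N₁ N₂ (fun e x => φ e x + t * φ' e x)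
        (fun e x => ψ e x + t * ψ' e x)
      = G.directionForm g ρ N₀ l N₁ N₂ φ ψ + t • G.directionForm g ρ N₀ l N₁ N₂ φ' ψ' :=
    fun hφ hψ hφ' hψ' t => h.directionForm_add_mul h1 h2 hφ.smoothOnEdges.continuous
      hφ'.smoothOnEdges.continuous hψ.continuous hψ'.continuous N₀ l t
  -- Additivity at the zero direction gives `T = T + T`.
  have h0 : G.directionForm g ρ N₀ l N₁ N₂ 0 0 = 0 := by
    have := hadd metricDirection_zero smoothOnEdges_zero metricDirection_zero smoothOnEdges_zero 1
    simp only [Pi.zero_apply, mul_zero, add_zero, one_smul] at this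
    ext u v
    have h3 := congrArg (fun T : BilinForm ℝ G.sobolev => T u v) this
    exact left_eq_add.1 h3
  refine ⟨{ carrier := {T | ∃ φ ψ, MetricDirection c φ ∧ SmoothOnEdges ψ ∧
              T = G.directionForm g ρ N₀ l N₁ N₂ φ ψ}
            zero_mem' := ⟨0, 0, metricDirection_zero, smoothOnEdges_zero, h0.symm⟩
            add_mem' := ?_
            smul_mem' := ?_ }, fun T => Iff.rfl⟩
  · rintro _ _ ⟨φ, ψ, hφ, hψ, rfl⟩ ⟨φ', ψ', hφ', hψ', rfl⟩
    exact ⟨_, _, metricDirection_add_mul hφ hφ' 1, smoothOnEdges_add_mul hψ hψ' 1, by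
      rw [hadd hφ hψ hφ' hψ', one_smul]⟩
  · rintro t _ ⟨φ, ψ, hφ, hψ, rfl⟩
    exact ⟨_, _, metricDirection_add_mul metricDirection_zero hφ t,
      smoothOnEdges_add_mul smoothOnEdges_zero hψ t, by
      rw [hadd metricDirection_zero smoothOnEdges_zero hφ hψ, h0, zero_add]⟩

omit [Fintype E] in
theorem IsFamily.eventually_pos (hfam : IsFamily c g ρ ε γ τ)
    (hN : ∀ g ρ, IsPair c g ρ → 0 < N g ρ) : ∀ᶠ t in 𝓝 0, 0 < N (γ t) (τ t) := by
  filter_upwards [hfam.eventually_isPair] with t ht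
  exact hN _ _ ht

/-- This is the hypothesis of the separation argument, one direction at a time. The two dimension
bounds come from the value of `λ_k` alone, so no spectral gap enters. -/
theorem IsFamily.exists_nonpos_of_extremal (hfam : IsFamily c g ρ ε γ τ) (e₀ : E)
    (hN : ∀ g ρ, IsPair c g ρ → 0 < N g ρ) (hgrad : IsGradient c N g ρ N₁ N₂)
    (hext : IsExtremal c (fun g' ρ' => G.eigenvalue g' ρ' k * N g' ρ') g ρ) :
    ∃ u ∈ LinearMap.ker (G.derivForm (stiffness g)
        - G.eigenvalue g ρ k • G.massForm (massDensity g ρ)), u ≠ 0 ∧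
      G.directionForm g ρ (N g ρ) (G.eigenvalue g ρ k) N₁ N₂ (velocity γ) (velocity τ) u u ≤ 0 := by
  obtain rfl := hfam.start_metric
  obtain rfl := hfam.start_density
  have hpath := hfam.isFormPath (G := G)
  have hp := hfam.isPair_zero
  have hl := hp.eigenvalue_eq (G := G) k
  obtain ⟨Wm, Wp, hs⟩ := exists_isSplitting (G := G) hp.stiffness_pos
    (massDensity (γ 0) (τ 0)) (G.eigenvalue (γ 0) (τ 0) k)
  refine hpath.exists_nonpos_of_extremal (ν := fun t => N (γ t) (τ t)) (k := k)
    (exists_finrank_eq e₀) hs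
    (finrank_neg_le hpath.fst_nonneg.self_of_nhds hpath.snd_pos.self_of_nhds hs hl.symm)
    (lt_finrank_sup_ker hpath.ref_nonneg hpath.snd_pos.self_of_nhds hpath.snd_zero_bound
      (exists_finrank_eq e₀) hs hl.symm) (hgrad.hasDerivAt ε γ τ hfam) (hfam.eventually_pos hN) ?_
  refine (hext ε γ τ hfam).imp ?_ ?_
  all_goals
    rintro ⟨r, hr, hF⟩
    refine ⟨r, hr, ?_⟩
    filter_upwards [hF, hfam.eventually_isPair] with t ht hpt
    rwa [hpt.eigenvalue_eq] at ht

/-- A gap below gives the index bound for the upper estimate, a gap above the one for the lower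
estimate. -/
theorem IsFamily.exists_isLittleO_of_sum_eq_zero {ι : Type*} [Fintype ι] {u : ι → G.sobolev}
    (hfam : IsFamily c g ρ ε γ τ) (e₀ : E)
    (hN : ∀ g ρ, IsPair c g ρ → 0 < N g ρ) (hgrad : IsGradient c N g ρ N₁ N₂)
    (hu : ∀ i, u i ∈ LinearMap.ker (G.derivForm (stiffness g)
        - G.eigenvalue g ρ k • G.massForm (massDensity g ρ))) (hne : ∃ i, u i ≠ 0)
    (hsum : ∑ i, G.directionForm g ρ (N g ρ) (G.eigenvalue g ρ k) N₁ N₂ (velocity γ) (velocity τ)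
      (u i) (u i) = 0)
    (hgap : G.eigenvalue g ρ (k - 1) < G.eigenvalue g ρ k ∨
        G.eigenvalue g ρ k < G.eigenvalue g ρ (k + 1)) :
    (∃ r : ℝ → ℝ, r =o[𝓝 0] (fun t : ℝ => t) ∧ ∀ᶠ t in 𝓝 0,
      G.eigenvalue (γ t) (τ t) k * N (γ t) (τ t) ≤ G.eigenvalue g ρ k * N g ρ + r t) ∨
    (∃ r : ℝ → ℝ, r =o[𝓝 0] (fun t : ℝ => t) ∧ ∀ᶠ t in 𝓝 0,
      G.eigenvalue g ρ k * N g ρ + r t ≤ G.eigenvalue (γ t) (τ t) k * N (γ t) (τ t)) := by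
  obtain rfl := hfam.start_metric
  obtain rfl := hfam.start_density
  have hpath := hfam.isFormPath (G := G)
  have hp := hfam.isPair_zero
  have hl := hp.eigenvalue_eq (G := G) k
  obtain ⟨Wm, Wp, hs⟩ := exists_isSplitting (G := G) hp.stiffness_pos
    (massDensity (γ 0) (τ 0)) (G.eigenvalue (γ 0) (τ 0) k)
  have hν := hgrad.hasDerivAt ε γ τ hfam
  have hν0 := hfam.eventually_pos hN
  refine hgap.imp (fun hgap => ?_) fun hgap => ?_
  · rw [hp.eigenvalue_eq (k - 1)] at hgap
    obtain ⟨r, hr, hF⟩ := hpath.exists_isLittleO_le_of_sum_eq_zero hs hl.symm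
      (le_finrank_neg_of_gap hpath.ref_nonneg (hpath.symm_fst 0) (hpath.symm_snd 0)
        hpath.snd_pos.self_of_nhds (exists_finrank_eq e₀) hs hgap) hν hν0 hu hne hsum
    refine ⟨r, hr, ?_⟩
    filter_upwards [hF, hfam.eventually_isPair] with t ht hpt
    rwa [hpt.eigenvalue_eq k]
  · rw [hp.eigenvalue_eq (k + 1)] at hgap
    obtain ⟨r, hr, hF⟩ := hpath.exists_isLittleO_ge_of_sum_eq_zero (exists_finrank_eq e₀) hs
      hl.symm (finrank_sup_ker_le_of_gap (hpath.symm_fst 0) (hpath.symm_snd 0)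
        hpath.fst_nonneg.self_of_nhds hpath.snd_pos.self_of_nhds hs hgap) hν hν0 hu hne hsum
    refine ⟨r, hr, ?_⟩
    filter_upwards [hF, hfam.eventually_isPair] with t ht hpt
    rwa [hpt.eigenvalue_eq k]

omit [Fintype E] in
theorem IsFamily.velocity_eq (hfam : IsFamily MetricClass.edgewiseConstant g ρ ε γ τ) (e : E)
    (x y : I) : velocity γ e x = velocity γ e y := by
  refine Filter.EventuallyEq.deriv_eq ?_
  filter_upwards [hfam.eventually_isPair] with t ht
  exact ht.metric e x y

omit [Fintype E] in
theorem IsPair.smul_density (h : IsPair c g ρ) {b : ℝ} (hb : 0 < b) : IsPair c g (b • ρ) :=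
  ⟨h.metric, h.metric_pos, fun e => by
    obtain ⟨F, hF, hx⟩ := h.density e
    exact ⟨fun x => b * F x, contDiff_const.mul hF, fun x => by simp [hx]⟩,
    fun e x => mul_pos hb (h.density_pos e x)⟩

theorem IsPair.eigenvalue_smul_density (h : IsPair c g ρ) (k : ℕ) {b : ℝ} (hb : 0 < b) :
    G.eigenvalue g (b • ρ) k = b⁻¹ * G.eigenvalue g ρ k := by
  have hm : massDensity g (b • ρ) = b • massDensity g ρ := by
    ext e x
    simp only [Pi.smul_apply, ContinuousMap.smul_apply, (h.smul_density hb).massDensity_apply,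
      h.massDensity_apply, smul_eq_mul, mul_assoc]
  rw [(h.smul_density hb).eigenvalue_eq, h.eigenvalue_eq, hm, massForm_smul, minmax_smul _ _ _ hb]

/-- Euler's relation for the homogeneity in the density. -/
theorem IsGradient.innerH_density (hgrad : IsGradient c N g ρ N₁ N₂) (h : IsPair c g ρ)
    (hl : 0 < G.eigenvalue g ρ k)
    (hscale : ∀ b : ℝ, 0 < b →
      G.eigenvalue g (b • ρ) k * N g (b • ρ) = G.eigenvalue g ρ k * N g ρ) :
    innerH g N₁ N₂ 0 ρ = N g ρ := by
  obtain ⟨ε, hfam⟩ := h.exists_isFamily (metricDirection_zero (c := c)) h.density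
  have h1 := hgrad.hasDerivAt _ _ _ hfam
  have h2 : HasDerivAt (fun t : ℝ => (1 + t) * N g ρ) (N g ρ) 0 := by
    simpa using ((hasDerivAt_id (0 : ℝ)).const_add 1).mul_const (N g ρ)
  have h3 : (fun t : ℝ => N (fun e x => g e x + t * (0 : EdgeFun E) e x)
      (fun e x => ρ e x + t * ρ e x)) =ᶠ[𝓝 0] fun t : ℝ => (1 + t) * N g ρ := by
    -- Since `λ_k` scales with the inverse of the density, invariance of the product makes `N`
    -- homogeneous of degree one in `ρ`; `t > -1` keeps the density positive.
    filter_upwards [Ioi_mem_nhds (show (-1 : ℝ) < 0 by norm_num)] with t (ht : -1 < t)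
    have hb : 0 < 1 + t := by linarith
    have h4 := hscale (1 + t) hb
    rw [h.eigenvalue_smul_density k hb] at h4
    have h5 : (fun e x => g e x + t * (0 : EdgeFun E) e x) = g := by simp
    have h6 : (fun e x => ρ e x + t * ρ e x) = (1 + t) • ρ := by
      funext e x
      simp only [Pi.smul_apply, smul_eq_mul]
      ring
    rw [h5, h6]
    field_simp at h4
    exact h4
  have h7 := h1.unique (h2.congr_of_eventuallyEq h3)
  rw [← h7]
  change _ = innerH g N₁ N₂ (velocity _) (velocity _)
  rw [velocity_affine, velocity_affine]

end

/-! ### The two directions of the criterion in dual form -/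

section Criterion

variable {V E : Type*} [Fintype V] [Fintype E] {G : EdgeGraph V E} {c : MetricClass}
  {N : EdgeFun E → EdgeFun E → ℝ} {g ρ N₁ N₂ φ ψ : EdgeFun E} {k n : ℕ} {l : ℝ}
  {f : Fin n → EdgeFun E}

omit [Fintype V] in
theorem IsPair.continuous_dualDensity (h : IsPair c g ρ) {f : EdgeFun E}
    (hf : G.InEigenspace g ρ l f) (e : E) :
    Continuous fun x => (gradSq g f e x + l * ρ e x * f e x ^ 2) / (2 * g e x) := by
  have h1 := hf.continuous_gradSq h e
  have h2 := h.continuous_density e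
  have h3 := hf.continuous e
  have h4 := h.continuous_metric e
  exact (h1.add ((h2.const_mul l).mul (h3.pow 2))).div (h4.const_mul 2)
    fun x => by have := h.metric_pos e x; positivity

omit [Fintype V] in
-- The pairing is linear in the densities, so a system of eigenfunctions acts through its summed
-- densities only; these are to be identified with the gradient of `N`.
theorem IsPair.sum_velocityForm (h : IsPair c g ρ) (hφ : ∀ e, Continuous (φ e))
    (hψ : ∀ e, Continuous (ψ e)) {u : Fin n → G.sobolev}
    (hf : ∀ i, G.InEigenspace g ρ l (u i).1.1)
    (hu : ∀ i e, ∀ᵐ x, (u i).1.2 e x = edgeDeriv ((u i).1.1 e) x) :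
    ∑ i, (G.derivForm (stiffnessVelocity g φ) - l • G.massForm (massVelocity g ρ φ ψ)) (u i) (u i)
      = -innerH g (fun e x => (∑ i, gradSq g (u i).1.1 e x
          + ρ e x * (l * ∑ i, (u i).1.1 e x ^ 2)) / (2 * g e x))
          (fun e x => l * ∑ i, (u i).1.1 e x ^ 2) φ ψ := by
  rw [Finset.sum_congr rfl fun i _ => h.velocityForm_apply (l := l) hφ hψ (hu i),
    Finset.sum_neg_distrib, innerH_sum_left _ (B := fun i e x => l * (u i).1.1 e x ^ 2)
      h.continuous_metric
      (fun i e => (h.continuous_dualDensity (hf i) e).integrable_unitInterval)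
      (fun i e => (((hf i).continuous e).pow 2 |>.const_mul l).integrable_unitInterval) hφ hψ]
  congr 2
  · funext e x
    rw [← Finset.sum_div, Finset.sum_add_distrib, Finset.mul_sum, Finset.mul_sum]
    congr 2
    exact Finset.sum_congr rfl fun i _ => by ring
  · funext e x
    rw [Finset.mul_sum]

omit [Fintype V] in
theorem integrable_sum_gradSq (h : IsPair c g ρ) (hf : ∀ i, G.InEigenspace g ρ l (f i)) (e : E) :
    Integrable fun x => ∑ i, gradSq g (f i) e x :=
  integrable_finsetSum _ fun i _ => ((hf i).continuous_gradSq h e).integrable_unitInterval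

omit [Fintype V] in
theorem integrable_sum_sq (hf : ∀ i, G.InEigenspace g ρ l (f i)) (e : E) :
    Integrable fun x => l * ∑ i, f i e x ^ 2 :=
  (integrable_finsetSum _ fun i _ =>
    (((hf i).continuous e).pow 2).integrable_unitInterval).const_mul l

omit [Fintype V] in
theorem integrable_dualDensity (h : IsPair c g ρ) (hf : ∀ i, G.InEigenspace g ρ l (f i)) (e : E) :
    Integrable fun x => (∑ i, gradSq g (f i) e x + ρ e x * (l * ∑ i, f i e x ^ 2))
      / (2 * g e x) := by
  refine Continuous.integrable_unitInterval ?_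
  have h1 := fun i => (hf i).continuous_gradSq h e
  have h2 := h.continuous_density e
  have h3 := fun i => (hf i).continuous e
  have h4 := h.continuous_metric e
  exact ((continuous_finsetSum _ fun i _ => h1 i).add (h2.mul
    ((continuous_finsetSum _ fun i _ => (h3 i).pow 2).const_mul l))).div (h4.const_mul 2)
    fun x => by have := h.metric_pos e x; positivity

/-- At an extremal pair the gradient is the pair of densities dual to a system of
eigenfunctions. -/
theorem exists_eigenfunctions_of_extremal (hG : G.IsConnected) (hk : 1 ≤ k) (e₀ : E)
    (hN : ∀ g ρ, IsPair c g ρ → 0 < N g ρ) (h : IsPair c g ρ)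
    (hgrad : IsGradient c N g ρ N₁ N₂)
    (hext : IsExtremal c (fun g' ρ' => G.eigenvalue g' ρ' k * N g' ρ') g ρ) :
    ∃ (n : ℕ) (f : Fin n → EdgeFun E),
      (∀ i, G.InEigenspace g ρ (G.eigenvalue g ρ k) (f i)) ∧
      (∀ e, ∀ᵐ x, G.eigenvalue g ρ k * ∑ i, f i e x ^ 2 = N₂ e x) ∧
      EqOnDirections c g (fun e x => (∑ i, gradSq g (f i) e x
        + ρ e x * (G.eigenvalue g ρ k * ∑ i, f i e x ^ 2)) / (2 * g e x)) N₁ := by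
  set l := G.eigenvalue g ρ k with hl
  have hl0 : 0 < l := by
    rw [hl, h.eigenvalue_eq]
    exact minmax_pos hG e₀ h.stiffness_pos h.massDensity_pos hk
  have hN0 := hN g ρ h
  obtain ⟨𝒯, h𝒯⟩ := h.exists_submodule_directionForm (G := G) hgrad.integrable_fst
    hgrad.integrable_snd (N g ρ) l
  obtain ⟨Wm, Wp, hs⟩ := exists_isSplitting (G := G) h.stiffness_pos (massDensity g ρ) l
  have := hs.finite_ker
  obtain ⟨n, u, hu, ⟨i₀, hi₀⟩, hsum⟩ := exists_mem_sum_eq_zero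
    (LinearMap.ker (G.derivForm (stiffness g) - l • G.massForm (massDensity g ρ))) 𝒯 (by
      intro T hT
      obtain ⟨φ, ψ, hφ, hψ, rfl⟩ := (h𝒯 T).1 hT
      obtain ⟨ε, hfam⟩ := h.exists_isFamily hφ hψ
      have key := hfam.exists_nonpos_of_extremal e₀ hN hgrad hext
      rwa [velocity_affine, velocity_affine] at key)
  set s := ∑ i, G.massForm (massDensity g ρ) (u i) (u i) with hsdef
  have hM := massForm_pos (G := G) h.massDensity_pos
  have hs0 : 0 < s := Finset.sum_pos' (fun i _ => by
    by_cases hi : u i = 0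
    · simp [hi]
    · exact (hM _ hi).le) ⟨i₀, Finset.mem_univ _, hM _ hi₀⟩
  -- This scaling gives the system the total mass `N / l`, so that the vanishing of the direction
  -- forms says that the densities pair with each direction exactly as `(N₁, N₂)` does.
  set r := √(N g ρ / (l * s)) with hr
  have hrr : r * r = N g ρ / (l * s) := Real.mul_self_sqrt (by positivity)
  have hy : ∀ i, r • u i ∈ LinearMap.ker (G.derivForm (stiffness g)
      - l • G.massForm (massDensity g ρ)) := fun i => Submodule.smul_mem _ _ (hu i)
  have hfi := fun i => (inEigenspace_of_mem_ker h (hy i)).1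
  have key := eq_of_forall_innerH_eq (c := c) h.continuous_metric h.metric_pos
    (integrable_dualDensity h hfi) (integrable_sum_sq hfi) hgrad.integrable_fst
    hgrad.integrable_snd fun φ ψ hφ hψ => by
      have h1 := h.sum_velocityForm hφ.smoothOnEdges.continuous hψ.continuous hfi
        fun i => (inEigenspace_of_mem_ker h (hy i)).2
      have h2 := hsum _ ((h𝒯 _).2 ⟨φ, ψ, hφ, hψ, rfl⟩)
      rw [sum_directionForm, ← hsdef] at h2
      have h3 : ∀ Q : BilinForm ℝ G.sobolev,
          ∑ i, Q (r • u i) (r • u i) = r * r * ∑ i, Q (u i) (u i) := fun Q => by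
        simp only [map_smul, LinearMap.smul_apply r, smul_eq_mul, ← mul_assoc, ← Finset.mul_sum]
      rw [h3, hrr, eq_comm, neg_eq_iff_eq_neg] at h1
      rw [h1]
      field_simp
      linarith
  exact ⟨n, fun i => (r • u i).1.1, hfi, key.2, key.1⟩

/-- The converse for the first and the last eigenvalue of a cluster. -/
theorem isExtremal_of_eigenfunctions (hG : G.IsConnected) (hk : 1 ≤ k) (e₀ : E)
    (hN : ∀ g ρ, IsPair c g ρ → 0 < N g ρ) (h : IsPair c g ρ)
    (hscale : ∀ b : ℝ, 0 < b →
      G.eigenvalue g (b • ρ) k * N g (b • ρ) = G.eigenvalue g ρ k * N g ρ)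
    (hgrad : IsGradient c N g ρ N₁ N₂)
    (hf : ∀ i, G.InEigenspace g ρ (G.eigenvalue g ρ k) (f i))
    (hsnd : ∀ e, ∀ᵐ x, G.eigenvalue g ρ k * ∑ i, f i e x ^ 2 = N₂ e x)
    (hfst : EqOnDirections c g (fun e x => (∑ i, gradSq g (f i) e x
      + ρ e x * (G.eigenvalue g ρ k * ∑ i, f i e x ^ 2)) / (2 * g e x)) N₁)
    (hgap : G.eigenvalue g ρ (k - 1) < G.eigenvalue g ρ k ∨
      G.eigenvalue g ρ k < G.eigenvalue g ρ (k + 1)) :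
    IsExtremal c (fun g' ρ' => G.eigenvalue g' ρ' k * N g' ρ') g ρ := by
  intro ε γ τ hfam
  set l := G.eigenvalue g ρ k with hl
  have hl0 : 0 < l := by
    rw [hl, h.eigenvalue_eq]
    exact minmax_pos hG e₀ h.stiffness_pos h.massDensity_pos hk
  have hN0 := hN g ρ h
  choose u hu hu1 hu2 using fun i => (hf i).exists_mem_ker h
  obtain rfl : (fun i => (u i).1.1) = f := funext hu1
  have hform : ∀ {φ ψ : EdgeFun E}, (∀ e, Continuous (φ e)) → (∀ e, Continuous (ψ e)) →
      (c = MetricClass.edgewiseConstant → ∀ e x y, φ e x = φ e y) →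
      ∑ i, (G.derivForm (stiffnessVelocity g φ) - l • G.massForm (massVelocity g ρ φ ψ))
        (u i) (u i) = -innerH g N₁ N₂ φ ψ := fun hφ hψ hc => by
    rw [h.sum_velocityForm hφ hψ hf hu2, innerH_eq_of_eqOnDirections h.continuous_metric
      (integrable_dualDensity h hf) (integrable_sum_sq hf) hgrad.integrable_fst
      hgrad.integrable_snd hφ hψ hc hfst hsnd]
  -- In the direction `(0, ρ)` the Dirichlet form does not move and the mass form is its own
  -- velocity; Euler's relation evaluates the other side as `N`.
  have hmass : l * ∑ i, G.massForm (massDensity g ρ) (u i) (u i) = N g ρ := by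
    have h1 := hform (φ := 0) (ψ := ρ) (fun _ => continuous_const) h.continuous_density
      fun _ _ _ _ => rfl
    have h2 : stiffnessVelocity g 0 = 0 := by
      ext e x
      rw [h.stiffnessVelocity_apply continuous_const]
      simp
    have h3 : massVelocity g ρ 0 ρ = massDensity g ρ := by
      ext e x
      rw [h.massVelocity_apply continuous_const (h.continuous_density e), h.massDensity_apply]
      simp
    rw [hgrad.innerH_density h hl0 hscale, h2, h3] at h1
    have h4 : ∀ v : G.sobolev, G.derivForm 0 v v = 0 := fun v => by simp [derivForm_apply]
    simp only [LinearMap.sub_apply, LinearMap.smul_apply, smul_eq_mul, h4, zero_sub,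
      Finset.sum_neg_distrib, ← Finset.mul_sum] at h1
    exact neg_injective h1
  refine hfam.exists_isLittleO_of_sum_eq_zero e₀ hN hgrad hu ?_ ?_ hgap
  -- A system of zeros would have mass zero, against `N > 0`.
  · by_contra! h0
    simp only [h0, map_zero, Finset.sum_const_zero, mul_zero] at hmass
    exact hN0.ne hmass
  · have h1 := hform (hfam.smooth_metric.velocity_continuous hfam.pos)
      (hfam.smooth_density.velocity_continuous hfam.pos) fun hc => by
        subst hc
        exact hfam.velocity_eq
    -- The two summands are `∓ N ⟨∇N, (φ, ψ)⟩` and cancel.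
    rw [sum_directionForm, h1, mul_right_comm, hmass]
    ring

end Criterion

end EdgeGraph

/-! ### Pointwise equality on edges of constant density, and the final assembly -/

namespace EdgeGraph

/-- Where the density is constant, the first equation of the criterion holds pointwise. -/
theorem ae_eq_of_edgewiseConstant {V E : Type*} [Fintype E] {G : EdgeGraph V E}
    {g ρ N₁ N₂ : EdgeFun E} {n : ℕ} {l : ℝ} {f : Fin n → EdgeFun E}
    (h : IsPair MetricClass.edgewiseConstant g ρ) (hf : ∀ i, G.InEigenspace g ρ l (f i))
    (hsnd : ∀ e, ∀ᵐ x, l * ∑ i, f i e x ^ 2 = N₂ e x)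
    (hfst : EqOnDirections MetricClass.edgewiseConstant g (fun e x => (∑ i, gradSq g (f i) e x
      + ρ e x * (l * ∑ i, f i e x ^ 2)) / (2 * g e x)) N₁) {e : E}
    (hN₁ : ∃ a : ℝ, ∀ᵐ x, N₁ e x = a) (hρ : ∀ x, ρ e x = ρ e 0) :
    ∀ᵐ x, ∑ i, gradSq g (f i) e x = 2 * g e x * N₁ e x - ρ e x * N₂ e x := by
  have hg : ∀ x, g e x = g e 0 := fun x => h.metric e x 0
  have hg0 := h.metric_pos e 0
  obtain ⟨a, ha⟩ := hN₁
  choose w hw using fun i => (hf i).exists_gradSq_add_eq h hg hρ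
  -- The numerator of the first density is a sum of conserved energies. Being constant, like `N₁`,
  -- it is determined by its integral.
  have hsum : ∀ x, ∑ i, gradSq g (f i) e x + ρ e x * (l * ∑ i, f i e x ^ 2) = ∑ i, w i := by
    intro x
    rw [Finset.mul_sum, Finset.mul_sum, ← Finset.sum_add_distrib]
    exact Finset.sum_congr rfl fun i _ => by rw [← hw i x]; ring
  have h1 : ∫ x : I, N₁ e x * √(g e x) = ∫ _ : I, a * √(g e 0) := by
    refine integral_congr_ae ?_
    filter_upwards [ha] with x hx
    rw [hx, hg]
  have hs : √(g e 0) ≠ 0 := (Real.sqrt_pos.2 hg0).ne'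
  have key := (hfst e).trans h1
  simp only [hsum, hg, integral_const, probReal_univ, one_smul] at key
  rw [mul_left_inj' hs, div_eq_iff (by positivity)] at key
  filter_upwards [ha, hsnd e] with x hx hx2
  rw [hx, ← hx2, hg x]
  linarith [hsum x]

end EdgeGraph

open EdgeGraph
theorem theorem3p1 {V E : Type*} [Fintype V] [Fintype E] (G : EdgeGraph V E)
    (hG : G.IsConnected) (k : ℕ) (hk : 1 ≤ k)
    -- the space of metrics: constant on edges, or smooth on edges
    (c : MetricClass)
    -- the normalising functional
    (N : EdgeFun E → EdgeFun E → ℝ)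
    (hN : ∀ g ρ, IsPair c g ρ → 0 < N g ρ)
    (hscale : ∀ g ρ, IsPair c g ρ → ∀ a b : ℝ, 0 < a → 0 < b →
      G.eigenvalue (a • g) (b • ρ) k * N (a • g) (b • ρ) = G.eigenvalue g ρ k * N g ρ)
    -- a pair and the gradient of the functional there
    (g ρ : EdgeFun E) (hgρ : IsPair c g ρ)
    (N₁ N₂ : EdgeFun E) (hgrad : IsGradient c N g ρ N₁ N₂) :
    (IsExtremal c (fun g' ρ' => G.eigenvalue g' ρ' k * N g' ρ') g ρ →
      ∃ (n : ℕ) (f : Fin n → EdgeFun E),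
        (∀ i, G.InEigenspace g ρ (G.eigenvalue g ρ k) (f i)) ∧
        (∀ e, ∀ᵐ x : unitInterval, ∑ i, f i e x ^ 2 = N₂ e x / G.eigenvalue g ρ k) ∧
        EqOnDirections c g (fun e x => ∑ i, gradSq g (f i) e x)
          (fun e x => 2 * g e x * N₁ e x - ρ e x * N₂ e x) ∧
        (∀ e, (∀ x y, ρ e x = ρ e y) →
          ∀ᵐ x : unitInterval, ∑ i, gradSq g (f i) e x = 2 * g e x * N₁ e x - ρ e x * N₂ e x)) ∧
    (∀ (n : ℕ) (f : Fin n → EdgeFun E),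
      (∀ i, G.InEigenspace g ρ (G.eigenvalue g ρ k) (f i)) →
      (∀ e, ∀ᵐ x : unitInterval, ∑ i, f i e x ^ 2 = N₂ e x / G.eigenvalue g ρ k) →
      EqOnDirections c g (fun e x => ∑ i, gradSq g (f i) e x)
          (fun e x => 2 * g e x * N₁ e x - ρ e x * N₂ e x) →
      (G.eigenvalue g ρ (k - 1) < G.eigenvalue g ρ k ∨
        G.eigenvalue g ρ k < G.eigenvalue g ρ (k + 1)) →
      IsExtremal c (fun g' ρ' => G.eigenvalue g' ρ' k * N g' ρ') g ρ) := by
  -- Without edges there is only one function on edges, so every family is constant and all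
  -- conditions on edges are void.
  rcases isEmpty_or_nonempty E with hE | ⟨⟨e₀⟩⟩
  · refine ⟨fun _ => ⟨0, fun i => i.elim0, fun i => i.elim0, fun e => hE.elim e, ?_,
      fun e => hE.elim e⟩, fun _ _ _ _ _ _ ε γ τ _ => Or.inl ⟨0, isLittleO_zero _ _, ?_⟩⟩
    · cases c <;> exact fun e => hE.elim e
    · refine Eventually.of_forall fun t => ?_
      rw [Subsingleton.elim (γ t) g, Subsingleton.elim (τ t) ρ, Pi.zero_apply, add_zero]
  set l := G.eigenvalue g ρ k with hl
  have hl0 : 0 < l := by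
    rw [hl, hgρ.eigenvalue_eq]
    exact minmax_pos hG e₀ hgρ.stiffness_pos hgρ.massDensity_pos hk
  have hN₁ := hgrad.integrable_fst
  have hN₂ := hgrad.integrable_snd
  have hdual : ∀ {n : ℕ} {f : Fin n → EdgeFun E}, (∀ e, ∀ᵐ x, l * ∑ i, f i e x ^ 2 = N₂ e x) →
      ∀ e, ∀ᵐ x, (∑ i, gradSq g (f i) e x + ρ e x * (l * ∑ i, f i e x ^ 2)) / (2 * g e x)
        = (∑ i, gradSq g (f i) e x + ρ e x * N₂ e x) / (2 * g e x) := fun hsnd e => by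
    filter_upwards [hsnd e] with x hx
    rw [hx]
  constructor
  · intro hext
    obtain ⟨n, f, hf, hsnd, hfst⟩ :=
      exists_eigenfunctions_of_extremal hG hk e₀ hN hgρ hgrad hext
    have hS := integrable_sum_gradSq hgρ hf
    have hEq := (hgρ.eqOnDirections_iff hS hN₁ hN₂).2 (hfst.congr_left (hdual hsnd))
    refine ⟨n, f, hf, fun e => ?_, hEq, fun e hρ => ?_⟩
    · filter_upwards [hsnd e] with x hx
      rw [← hx, mul_div_cancel_left₀ _ hl0.ne']
    · cases c with
      | edgewiseSmooth => exact hEq e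
      | edgewiseConstant =>
        exact ae_eq_of_edgewiseConstant hgρ hf hsnd hfst (hgrad.tangent rfl e) fun x => hρ x 0
  · intro n f hf hsnd hfst hgap
    have hsnd' : ∀ e, ∀ᵐ x, l * ∑ i, f i e x ^ 2 = N₂ e x := fun e => by
      filter_upwards [hsnd e] with x hx
      rw [hx, mul_div_cancel₀ _ hl0.ne']
    -- Scaling enters with the metric fixed, that is with `a = 1`.
    refine isExtremal_of_eigenfunctions hG hk e₀ hN hgρ (fun b hb => ?_) hgrad hf hsnd' ?_ hgap
    · have := hscale g ρ hgρ 1 b one_pos hb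
      rwa [one_smul] at this
    · refine ((hgρ.eqOnDirections_iff (integrable_sum_gradSq hgρ hf) hN₁ hN₂).1 hfst).congr_left
        fun e => ?_
      filter_upwards [hdual hsnd' e] with x hx
      exact hx.symm
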